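/- For a space $X$ and $m\ge 0$ let $\mathrm{Conf}_m(X)$ be the configuration space of $m$ unordered distinct points of $X$, i.e. the quotient of $\{(x_1,\dots,x_m)\in X^m : x_i\ne x_j \text{ for } i\neq j\}$ by the permutation action of the symmetric group. Let $S\subset[-1,1]\subset\mathbb{C}$ be a finite set with $s\ge 3$ elements that contains $-1$ and $1$, orient the segment $[-1,1]$ in either direction, and let $p_1,\dots,p_s$ be the elements of $S$ in the resulting order. Let $A=\mathbb{C}\setminus\{-1,1\}$. For $1\le i\le s-1$ let $\sigma_i\in\pi_1(\mathrm{Conf}_s(\mathbb{C}),S)$ be the class of the loop in which $p_i$ moves along the segment to the position of $p_{i+1}$ on the right of the segment while $p_{i+1}$ moves to the position of $p_i$ on its left (that is, the two points are exchanged by a counter-clockwise half turn along the circle having the segment between them as a diameter), the other points being at rest. Let $\tau_1$ (resp. $\tau_2$) be the class of the loop in which $p_2$ moves once counter-clockwise along a circle around $p_1$ (resp. $p_{s-1}$ moves once counter-clockwise along a circle around $p_s$), starting and ending at its own position, the other points being at rest. Then the homomorphism $$\pi_1(\mathrm{Conf}_{s-2}(A),\,S\setminus\{-1,1\})\longrightarrow\pi_1(\mathrm{Conf}_s(\mathbb{C}),\,S)$$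 induced by $\{x_1,\dots,x_{s-2}\}\mapsto\{-1,1,x_1,\dots,x_{s-2}\}$ is injective, and its image is the subgroup generated by the $\sigma_i$ with $2\le i\le s-2$ together with $\tau_1$ and $\tau_2$. Moreover $\tau_1=\sigma_1^2$ and $\tau_2=\sigma_{s-1}^{2}$; in particular $\tau_2$ may be replaced by $\tau_2^{-1}=\sigma_{s-1}^{-2}$ as a generator. -/

import Mathlib

open scoped unitInterval

noncomputable section

namespace PlaneBraids

/-! ### Configuration spaces -/

/-- The ordered configuration space of `m` distinct points of `X`, topologised as a subspace of the
product `X ^ m`. -/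
def OConf (X : Type) (m : ℕ) : Type := {f : Fin m → X // Function.Injective f}

instance (X : Type) [TopologicalSpace X] (m : ℕ) : TopologicalSpace (OConf X m) :=
  inferInstanceAs (TopologicalSpace {f : Fin m → X // Function.Injective f})

/-- The symmetric group permutes the labels of an ordered configuration. -/
instance (X : Type) (m : ℕ) : MulAction (Equiv.Perm (Fin m)) (OConf X m) where
  smul π f := ⟨f.1 ∘ ⇑π⁻¹, f.2.comp (π⁻¹).injective⟩
  one_smul _ := rfl
  mul_smul _ _ _ := rfl

/-- The (unordered) configuration space of `m` distinct points of `X`: the quotient of the ordered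
configuration space by the permutation action of the symmetric group. -/
abbrev Conf (X : Type) (m : ℕ) : Type :=
  Quotient (MulAction.orbitRel (Equiv.Perm (Fin m)) (OConf X m))

/-- The unordered configuration underlying an ordered one. -/
def Conf.mk {X : Type} {m : ℕ} (f : OConf X m) : Conf X m := Quotient.mk _ f

theorem Conf.continuous_mk {X : Type} [TopologicalSpace X] {m : ℕ} :
    Continuous (Conf.mk : OConf X m → Conf X m) := continuous_quot_mk

/-- Two ordered configurations have the same underlying unordered configuration as soon as they
consist of the same points. -/
theorem Conf.mk_eq_of_range_eq {X : Type} {m : ℕ} {f g : OConf X m}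
    (h : Set.range f.1 = Set.range g.1) : Conf.mk f = Conf.mk g := by
  refine Quotient.sound (MulAction.orbitRel_apply.2 ?_)
  let e : Equiv.Perm (Fin m) := (Equiv.ofInjective f.1 f.2).trans
    ((Equiv.setCongr h).trans (Equiv.ofInjective g.1 g.2).symm)
  refine ⟨e⁻¹, Subtype.ext (funext fun i => ?_)⟩
  change g.1 (e i) = f.1 i
  simp [e, Equiv.apply_ofInjective_symm]

theorem Conf.range_eq_of_mk_eq {X : Type} {m : ℕ} {f g : OConf X m}
    (h : Conf.mk f = Conf.mk g) : Set.range f.1 = Set.range g.1 := by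
  obtain ⟨π, hπ⟩ := MulAction.orbitRel_apply.1 (Quotient.exact h)
  have : f.1 = g.1 ∘ ⇑π⁻¹ := by rw [← hπ]; rfl
  rw [this]
  exact (π⁻¹).surjective.range_comp g.1

/-! ### Adding the points `-1` and `1` -/

/-- The plane with the two points `-1` and `1` removed. -/
abbrev PuncturedPlane : Type := {z : ℂ // z ≠ -1 ∧ z ≠ 1}

/-- `(x₁, …, xₙ) ↦ (-1, x₁, …, xₙ, 1)` on ordered configurations. -/
def addEndsOrdered {n : ℕ} (f : OConf PuncturedPlane n) : OConf ℂ (n + 2) :=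
  ⟨Fin.cons (-1) (Fin.snoc (fun i => (f.1 i : ℂ)) 1 : Fin (n + 1) → ℂ), by
    rw [Fin.cons_injective_iff, Fin.snoc_injective_iff]
    refine ⟨?_, Subtype.val_injective.comp f.2, ?_⟩
    · rintro ⟨i, hi⟩
      induction i using Fin.lastCases with
      | last =>
        rw [Fin.snoc_last] at hi
        norm_num [Complex.ext_iff] at hi
      | cast i =>
        rw [Fin.snoc_castSucc] at hi
        exact (f.1 i).2.1 hi
    · rintro ⟨i, hi⟩
      exact (f.1 i).2.2 hi⟩

theorem range_addEndsOrdered {n : ℕ} (f : OConf PuncturedPlane n) :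
    Set.range (addEndsOrdered f).1 =
      insert (-1) (insert 1 (Set.range fun i => (f.1 i : ℂ))) := by
  change Set.range (Fin.cons (-1) (Fin.snoc (fun i => (f.1 i : ℂ)) 1 : Fin (n + 1) → ℂ) :
    Fin (n + 2) → ℂ) = _
  rw [Fin.range_cons, Fin.range_snoc]

theorem continuous_addEndsOrdered {n : ℕ} :
    Continuous (addEndsOrdered : OConf PuncturedPlane n → OConf ℂ (n + 2)) := by
  have hc : ∀ i, Continuous fun f : OConf PuncturedPlane n => ((f.1 i : PuncturedPlane) : ℂ) :=
    fun i => continuous_subtype_val.comp ((continuous_apply i).comp continuous_subtype_val)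
  refine Continuous.subtype_mk (continuous_pi fun i => ?_) _
  induction i using Fin.cases with
  | zero => simpa using continuous_const
  | succ i =>
    induction i using Fin.lastCases with
    | last => simpa using continuous_const
    | cast i => simpa using hc i

/-- The inclusion `{x₁, …, xₙ} ↦ {-1, 1, x₁, …, xₙ}` of unordered configuration spaces. -/
def addEnds (n : ℕ) : C(Conf PuncturedPlane n, Conf ℂ (n + 2)) where
  toFun := Quotient.lift (fun f => Conf.mk (addEndsOrdered f)) fun f g h => by
    refine Conf.mk_eq_of_range_eq ?_
    have h' := Conf.range_eq_of_mk_eq (Quotient.sound h : Conf.mk f = Conf.mk g)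
    have h2 : Set.range (fun i => (f.1 i : ℂ)) = Set.range (fun i => (g.1 i : ℂ)) := by
      have := congrArg (Set.image (Subtype.val : PuncturedPlane → ℂ)) h'
      rwa [← Set.range_comp, ← Set.range_comp] at this
    rw [range_addEndsOrdered, range_addEndsOrdered, h2]
  continuous_toFun :=
    (Conf.continuous_mk.comp continuous_addEndsOrdered).quotient_lift _

/-! ### The points on the segment and the base points -/

/-- `x` lists the elements of `S` in the order given by an orientation of the segment `[-1, 1]`:
in increasing order if the segment is oriented from `-1` to `1`, in decreasing order if it is
oriented from `1` to `-1`. The element numbered `i` in `1, …, s` is `x (i - 1)`. -/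
structure ListsAlongSegment {s : ℕ} (S : Finset ℝ) (x : Fin s → ℝ) : Prop where
  ordered : StrictMono x ∨ StrictAnti x
  range_eq : Set.range x = S

theorem ListsAlongSegment.injective {s : ℕ} {S : Finset ℝ} {x : Fin s → ℝ}
    (hx : ListsAlongSegment S x) : Function.Injective x :=
  hx.ordered.elim StrictMono.injective StrictAnti.injective

/-- `S` is a subset of `[-1, 1]` that contains `-1` and `1`. -/
structure IsSegmentSet (S : Finset ℝ) : Prop where
  subset : ∀ r ∈ S, r ∈ Set.Icc (-1 : ℝ) 1
  neg_one_mem : -1 ∈ S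
  one_mem : 1 ∈ S

section Points

variable {n : ℕ} {S : Finset ℝ} {x : Fin (n + 2) → ℝ}

theorem ListsAlongSegment.ends (hx : ListsAlongSegment S x) (hS : IsSegmentSet S) :
    (x 0 = -1 ∧ x (Fin.last _) = 1) ∨ (x 0 = 1 ∧ x (Fin.last _) = -1) := by
  have hmem : ∀ i, x i ∈ Set.Icc (-1 : ℝ) 1 := fun i =>
    hS.subset _ (Finset.mem_coe.1 (hx.range_eq ▸ Set.mem_range_self i))
  obtain ⟨i, hi⟩ : -1 ∈ Set.range x := hx.range_eq ▸ Finset.mem_coe.2 hS.neg_one_mem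
  obtain ⟨j, hj⟩ : 1 ∈ Set.range x := hx.range_eq ▸ Finset.mem_coe.2 hS.one_mem
  rcases hx.ordered with h | h
  · left
    have h0 := h.monotone (Fin.zero_le i)
    have h1 := h.monotone (Fin.le_last j)
    exact ⟨le_antisymm (by linarith) (hmem _).1, le_antisymm (hmem _).2 (by linarith)⟩
  · right
    have h0 := h.antitone (Fin.zero_le j)
    have h1 := h.antitone (Fin.le_last i)
    exact ⟨le_antisymm (hmem _).2 (by linarith), le_antisymm (by linarith) (hmem _).1⟩

theorem ListsAlongSegment.inner_ne (hx : ListsAlongSegment S x) (hS : IsSegmentSet S)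
    (i : Fin n) : (x i.castSucc.succ : ℂ) ≠ -1 ∧ (x i.castSucc.succ : ℂ) ≠ 1 := by
  have a : x i.castSucc.succ ≠ x 0 := fun h => Fin.succ_ne_zero _ (hx.injective h)
  have b : x i.castSucc.succ ≠ x (Fin.last _) := fun h => by
    have := hx.injective h
    rw [← Fin.succ_last, Fin.succ_inj] at this
    exact (Fin.castSucc_lt_last i).ne this
  have key : x i.castSucc.succ ≠ -1 ∧ x i.castSucc.succ ≠ 1 := by
    rcases hx.ends hS with ⟨h0, h1⟩ | ⟨h0, h1⟩
    · exact ⟨h0 ▸ a, h1 ▸ b⟩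
    · exact ⟨h1 ▸ b, h0 ▸ a⟩
  exact ⟨fun h => key.1 (by exact_mod_cast h), fun h => key.2 (by exact_mod_cast h)⟩

/-- The points of `S` as an ordered configuration of the plane. -/
def orderedBase (hx : ListsAlongSegment S x) : OConf ℂ (n + 2) :=
  ⟨fun i => (x i : ℂ), Complex.ofReal_injective.comp hx.injective⟩

/-- The base point `S` of the configuration space of the plane. -/
def base (hx : ListsAlongSegment S x) : Conf ℂ (n + 2) := Conf.mk (orderedBase hx)

/-- The points of `S ∖ {-1, 1}`, that is, all the points of `S` except the first and the last one, as
an ordered configuration of the twice punctured plane. -/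
def orderedInnerBase (hS : IsSegmentSet S) (hx : ListsAlongSegment S x) :
    OConf PuncturedPlane n :=
  ⟨fun i => ⟨(x i.castSucc.succ : ℂ), hx.inner_ne hS i⟩, fun i j h => by
    have := hx.injective (Complex.ofReal_injective (congrArg Subtype.val h))
    exact Fin.castSucc_injective _ (Fin.succ_injective _ this)⟩

/-- The base point `S ∖ {-1, 1}` of the configuration space of the twice punctured plane. -/
def innerBase (hS : IsSegmentSet S) (hx : ListsAlongSegment S x) : Conf PuncturedPlane n :=
  Conf.mk (orderedInnerBase hS hx)

theorem addEnds_innerBase (hS : IsSegmentSet S) (hx : ListsAlongSegment S x) :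
    addEnds n (innerBase hS hx) = base hx := by
  refine Conf.mk_eq_of_range_eq ((range_addEndsOrdered (orderedInnerBase hS hx)).trans ?_)
  change insert (-1) (insert 1 (Set.range fun i : Fin n => (x i.castSucc.succ : ℂ))) = _
  have hr : Set.range (orderedBase hx).1 =
      insert (x 0 : ℂ) (insert (x (Fin.last _) : ℂ)
        (Set.range fun i : Fin n => (x i.castSucc.succ : ℂ))) := by
    ext z
    simp only [orderedBase, Set.mem_range, Set.mem_insert_iff]
    rw [Fin.exists_fin_succ, Fin.exists_fin_succ']
    simp only [Fin.succ_last, eq_comm (b := z)]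
    tauto
  rw [hr]
  rcases hx.ends hS with ⟨h0, h1⟩ | ⟨h0, h1⟩
  · simp [h0, h1]
  · simp [h0, h1, Set.insert_comm]

/-- The homomorphism of fundamental groups
`π₁(Conf (ℂ ∖ {-1, 1}) n, S ∖ {-1, 1}) → π₁(Conf ℂ (n + 2), S)` induced by
`{x₁, …, xₙ} ↦ {-1, 1, x₁, …, xₙ}`. -/
def inclHom (hS : IsSegmentSet S) (hx : ListsAlongSegment S x) :
    FundamentalGroup (Conf PuncturedPlane n) (innerBase hS hx) →*
      FundamentalGroup (Conf ℂ (n + 2)) (base hx) :=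
  FundamentalGroup.mapOfEq (addEnds n) (addEnds_innerBase hS hx)

/-! ### Braids in which some of the points of `S` rotate about a common centre -/

/-- At time `t`, the points with label in `M` have been rotated counter-clockwise about `c` through
the angle `t θ`; the other points stay where they are. -/
def rotation (x : Fin (n + 2) → ℝ) (M : Finset (Fin (n + 2))) (c θ : ℝ) (t : I) :
    Fin (n + 2) → ℂ := fun k =>
  if k ∈ M then c + ((x k : ℂ) - c) * Complex.exp (((t : ℝ) * θ : ℝ) * Complex.I) else x k

theorem rotation_injective (hx : Function.Injective x) {M : Finset (Fin (n + 2))} {c : ℝ} (θ : ℝ)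
    (hM : ∀ k ∈ M, ∀ l ∉ M, |x k - c| ≠ |x l - c|) (t : I) :
    Function.Injective (rotation x M c θ t) := by
  have aux : ∀ k ∈ M, ∀ l ∉ M, rotation x M c θ t k ≠ rotation x M c θ t l := by
    intro k hk l hl h
    simp only [rotation, hk, hl, if_true, if_false] at h
    have h2 : ((x k - c : ℝ) : ℂ) * Complex.exp (((t : ℝ) * θ : ℝ) * Complex.I) =
        ((x l - c : ℝ) : ℂ) := by
      push_cast at h ⊢
      linear_combination h
    have h3 := congrArg norm h2
    rw [norm_mul, Complex.norm_exp_ofReal_mul_I, mul_one, Complex.norm_real, Complex.norm_real]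
      at h3
    exact hM k hk l hl h3
  intro k l h
  by_cases hk : k ∈ M <;> by_cases hl : l ∈ M
  · simp only [rotation, hk, hl, if_true, add_right_inj] at h
    have := mul_right_cancel₀ (Complex.exp_ne_zero _) h
    exact hx (Complex.ofReal_injective (sub_left_inj.1 this))
  · exact absurd h (aux k hk l hl)
  · exact absurd h.symm (aux l hl k hk)
  · simp only [rotation, hk, hl, if_false] at h
    exact hx (Complex.ofReal_injective h)

theorem continuous_rotation (x : Fin (n + 2) → ℝ) (M : Finset (Fin (n + 2))) (c θ : ℝ) :
    Continuous (rotation x M c θ) := by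
  refine continuous_pi fun k => ?_
  by_cases hk : k ∈ M
  · simp only [rotation, hk, if_true]
    fun_prop
  · simp only [rotation, hk, if_false]
    fun_prop

/-- The loop at `S` in the configuration space of the plane obtained by rotating the points with
label in `M` about `c` counter-clockwise through the angle `θ`, provided that the points never
collide and that the points at the end are again those of `S`. -/
def rotationLoop (hx : ListsAlongSegment S x) (M : Finset (Fin (n + 2))) (c θ : ℝ)
    (hM : ∀ k ∈ M, ∀ l ∉ M, |x k - c| ≠ |x l - c|)
    (hend : Set.range (rotation x M c θ 1) = Set.range fun k => (x k : ℂ)) :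
    Path (base hx) (base hx) where
  toFun t := Conf.mk ⟨rotation x M c θ t, rotation_injective hx.injective θ hM t⟩
  continuous_toFun :=
    Conf.continuous_mk.comp (Continuous.subtype_mk (continuous_rotation x M c θ) _)
  source' := Conf.mk_eq_of_range_eq (by
    refine congrArg Set.range (funext fun k => ?_)
    simp [rotation, orderedBase])
  target' := Conf.mk_eq_of_range_eq hend

/-- The class of a loop in the fundamental group. -/
def loopClass {X : Type} [TopologicalSpace X] {p : X} (γ : Path p p) : FundamentalGroup X p :=
  FundamentalGroup.fromPath (Path.Homotopic.Quotient.mk γ)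

theorem ListsAlongSegment.halfTwist_aux (hx : ListsAlongSegment S x) (j : Fin (n + 1)) :
    ∀ k ∈ ({j.castSucc, j.succ} : Finset (Fin (n + 2))), ∀ l ∉ ({j.castSucc, j.succ} : Finset _),
      |x k - (x j.castSucc + x j.succ) / 2| ≠ |x l - (x j.castSucc + x j.succ) / 2| := by
  intro k hk l hl h
  simp only [Finset.mem_insert, Finset.mem_singleton, not_or] at hk hl
  have h2 : (x l - x j.castSucc) * (x l - x j.succ) = 0 := by
    have := sq_eq_sq_iff_abs_eq_abs _ _ |>.2 h
    rcases hk with rfl | rfl <;> linear_combination -this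
  rcases mul_eq_zero.1 h2 with h3 | h3
  · exact hl.1 (hx.injective (sub_eq_zero.1 h3))
  · exact hl.2 (hx.injective (sub_eq_zero.1 h3))

theorem rotation_halfTwist_one (x : Fin (n + 2) → ℝ) (j : Fin (n + 1)) :
    rotation x {j.castSucc, j.succ} ((x j.castSucc + x j.succ) / 2) Real.pi 1 =
      (fun k => (x k : ℂ)) ∘ Equiv.swap j.castSucc j.succ := by
  funext k
  by_cases h1 : k = j.castSucc
  · subst h1
    simp [rotation, Complex.exp_pi_mul_I]
    ring
  · by_cases h2 : k = j.succ
    · subst h2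
      simp [rotation, Complex.exp_pi_mul_I]
      ring
    · simp [rotation, h1, h2, Equiv.swap_apply_of_ne_of_ne h1 h2]

/-- The braid `σ_i`, `1 ≤ i ≤ s - 1` (where `s = n + 2`): the `i`-th and the `(i+1)`-st point
exchange their places by moving counter-clockwise along the circle having the segment between them
as a diameter. Thus the `i`-th point moves to the place of the `(i+1)`-st one on the right of the
oriented segment, and the `(i+1)`-st point moves to the place of the `i`-th one on its left, for
either orientation. -/
def sigma (hx : ListsAlongSegment S x) (i : ℕ) (h1 : 1 ≤ i) (hi : i ≤ n + 1) :
    FundamentalGroup (Conf ℂ (n + 2)) (base hx) :=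
  let j : Fin (n + 1) := ⟨i - 1, by omega⟩
  loopClass (rotationLoop hx {j.castSucc, j.succ} ((x j.castSucc + x j.succ) / 2) Real.pi
    (hx.halfTwist_aux j) (by
      rw [rotation_halfTwist_one]
      exact (Equiv.surjective _).range_comp _))

theorem ListsAlongSegment.full_aux_first (hx : ListsAlongSegment S x) :
    ∀ k ∈ ({1} : Finset (Fin (n + 2))), ∀ l ∉ ({1} : Finset (Fin (n + 2))),
      |x k - x 0| ≠ |x l - x 0| := by
  intro k hk l hl h
  rw [Finset.mem_singleton] at hk hl
  subst hk
  rcases eq_or_ne l 0 with rfl | hl0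
  · rw [sub_self, abs_zero, abs_eq_zero, sub_eq_zero] at h
    exact hl (hx.injective h).symm
  · have h01 : (0 : Fin (n + 2)) < 1 := Fin.pos_of_ne_zero (by simp)
    have hlt : (0 : Fin (n + 2)) < l := Fin.pos_of_ne_zero hl0
    have hx' : x 1 = x l := by
      rcases hx.ordered with hm | hm
      · have a := hm h01
        have b := hm hlt
        rw [abs_of_pos (by linarith), abs_of_pos (by linarith)] at h
        linarith
      · have a := hm h01
        have b := hm hlt
        rw [abs_of_neg (by linarith), abs_of_neg (by linarith)] at h
        linarith
    exact hl (hx.injective hx').symm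

theorem ListsAlongSegment.full_aux_last (hx : ListsAlongSegment S x) :
    ∀ k ∈ ({(Fin.last n).castSucc} : Finset (Fin (n + 2))),
      ∀ l ∉ ({(Fin.last n).castSucc} : Finset (Fin (n + 2))),
      |x k - x (Fin.last (n + 1))| ≠ |x l - x (Fin.last (n + 1))| := by
  intro k hk l hl h
  rw [Finset.mem_singleton] at hk hl
  subst hk
  have h01 : (Fin.last n).castSucc < Fin.last (n + 1) := Fin.castSucc_lt_last _
  rcases eq_or_ne l (Fin.last (n + 1)) with rfl | hl0
  · rw [sub_self, abs_zero, abs_eq_zero, sub_eq_zero] at h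
    exact hl (hx.injective h).symm
  · have hlt : l < Fin.last (n + 1) := Fin.lt_last_iff_ne_last.2 hl0
    have hx' : x (Fin.last n).castSucc = x l := by
      rcases hx.ordered with hm | hm
      · have a := hm h01
        have b := hm hlt
        rw [abs_of_neg (by linarith), abs_of_neg (by linarith)] at h
        linarith
      · have a := hm h01
        have b := hm hlt
        rw [abs_of_pos (by linarith), abs_of_pos (by linarith)] at h
        linarith
    exact hl (hx.injective hx').symm

theorem rotation_full_one (x : Fin (n + 2) → ℝ) (M : Finset (Fin (n + 2))) (c : ℝ) :
    rotation x M c (2 * Real.pi) 1 = fun k => (x k : ℂ) := by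
  funext k
  by_cases hk : k ∈ M <;> simp [rotation, hk, Complex.exp_two_pi_mul_I]

/-- The braid `τ₁`: the second point moves once counter-clockwise around the first point, back
to where it was, while all the other points are at rest. It approaches the first point on the left
of the oriented segment and returns on the right. -/
def tau₁ (hx : ListsAlongSegment S x) : FundamentalGroup (Conf ℂ (n + 2)) (base hx) :=
  loopClass (rotationLoop hx {1} (x 0) (2 * Real.pi) hx.full_aux_first
    (congrArg Set.range (rotation_full_one x _ _)))

/-- The braid `τ₂`: the last but one point moves once counter-clockwise around the last point, back
to where it was, while all the other points are at rest. It approaches the last point on the right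
of the oriented segment and returns on the left. -/
def tau₂ (hx : ListsAlongSegment S x) : FundamentalGroup (Conf ℂ (n + 2)) (base hx) :=
  loopClass (rotationLoop hx {(Fin.last n).castSucc} (x (Fin.last (n + 1))) (2 * Real.pi)
    hx.full_aux_last (congrArg Set.range (rotation_full_one x _ _)))

end Points

end PlaneBraids

end

open PlaneBraids

noncomputable section

namespace PlaneBraids

/-! ### The covering of the unordered configuration space by the ordered one -/

/-! Injectivity comes from a retraction at the level of ordered configurations. Adding `-1` and `1`
as first and last points has a left inverse: move the first and the last point of a configuration of
the plane to `-1` and `1` by an affine map, then forget them. This does not descend to unordered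
configurations, but ordered configurations cover unordered ones, so a homotopy between image loops
lifts and the retraction applies to the lift (`homotopic_of_addEnds_homotopic`).

The generators lie in the image because the rotations defining them leave both end points at rest
(`exists_lift_rotationLoop`). That they generate it is a general position argument. Slit the plane
along the vertical rays downward from `-1` and `1`. The chamber consists of the configurations that
avoid the slits and are labelled by increasing real part; it is contractible and contains at most
one labelling of each unordered configuration. Hence a path whose ends have labellings in the
chamber determines an element of the fundamental group; it is called good if this element lies in a
given subgroup.

Any path is cut into pieces lying in convex open boxes. In a box the points can be moved one at a
time, and each such move can be split until it meets at most one wall, a wall being the real part of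
a puncture or of another point (`good_pathClass`, `good_of_mem_box`, `good_of_move_sorted`). Up to
relabelling and inversion only two kinds of move leave the chamber: the left one of two neighbours
passes below the right one, or a point passes below a puncture.

Exchanges of neighbours are the half twists. A full circle of the outermost point about its adjacent
puncture has one half in the chamber, so the other half, the passage below the puncture, is good as
soon as the full circle belongs to the subgroup. For the remaining points the passage is carried
over from neighbour to neighbour by a hexagon of moves around the configuration where two points and
a puncture are vertically aligned (`goodUnder_succ_iff`). Together these give
`eq_top_of_generators`.

Finally, the square of an outer half twist is a full rotation of two points about their midpoint;
`slide` deforms it into the rotation of one point about the other. -/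

theorem Conf.isQuotientCoveringMap_mk (X : Type) [TopologicalSpace X] [T2Space X] (m : ℕ) :
    IsQuotientCoveringMap (Conf.mk : OConf X m → Conf X m) (Equiv.Perm (Fin m)) where
  toIsQuotientMap := isQuotientMap_quotient_mk'
  continuous_const_smul π := by
    have h : Continuous fun f : OConf X m => f.1 ∘ ⇑π⁻¹ :=
      continuous_pi fun i => (continuous_apply (π⁻¹ i)).comp continuous_subtype_val
    exact h.subtype_mk fun f => f.2.comp (π⁻¹).injective
  apply_eq_iff_mem_orbit {_ _} := Quotient.eq''
  disjoint f := by
    -- Pairwise disjoint neighbourhoods of the points of `f` give the evenly covered set: a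
    -- permutation mapping one such configuration to another must fix every label.
    obtain ⟨U, hU, hd⟩ := (Set.finite_range f.1).t2_separation
    refine ⟨{g | ∀ i, g.1 i ∈ U (f.1 i)}, IsOpen.mem_nhds ?_ fun i => (hU _).1, ?_⟩
    · rw [Set.ofPred_forall]
      exact isOpen_iInter_of_finite fun i =>
        (hU _).2.preimage ((continuous_apply i).comp continuous_subtype_val)
    · rintro π ⟨_, ⟨g, hg, rfl⟩, hg'⟩
      rw [← inv_eq_one]
      refine Equiv.ext fun i => ?_
      have h1 : g.1 (π⁻¹ i) ∈ U (f.1 i) := hg' i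
      by_contra hne
      exact Set.disjoint_left.1 (hd (Set.mem_range_self (π⁻¹ i)) (Set.mem_range_self i)
        fun h => hne (f.2 h)) (hg (π⁻¹ i)) h1

theorem Conf.isCoveringMap_mk (X : Type) [TopologicalSpace X] [T2Space X] (m : ℕ) :
    IsCoveringMap (Conf.mk : OConf X m → Conf X m) :=
  (Conf.isQuotientCoveringMap_mk X m).isCoveringMap

/-! ### Injectivity: a retraction on ordered configurations -/

/-- The affine map of the plane that takes `a` to `-1` and `b` to `1`. -/
def normalize (a b z : ℂ) : ℂ := (2 * z - a - b) / (b - a)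

theorem normalize_ne {a b z : ℂ} (hab : a ≠ b) (ha : z ≠ a) (hb : z ≠ b) :
    normalize a b z ≠ -1 ∧ normalize a b z ≠ 1 := by
  have h : b - a ≠ 0 := sub_ne_zero.2 hab.symm
  constructor
  · intro h1
    rw [normalize, div_eq_iff h] at h1
    exact ha (by linear_combination h1 / 2)
  · intro h1
    rw [normalize, div_eq_iff h] at h1
    exact hb (by linear_combination h1 / 2)

/-- The first and the last point are moved to `-1` and `1` by an affine map, and then forgotten. -/
def forgetEnds {n : ℕ} (f : OConf ℂ (n + 2)) : OConf PuncturedPlane n :=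
  ⟨fun i => ⟨normalize (f.1 0) (f.1 (Fin.last _)) (f.1 i.castSucc.succ),
    normalize_ne (fun h => (Fin.last_pos (n := n)).ne (f.2 h))
      (fun h => Fin.succ_ne_zero _ (f.2 h))
      (fun h => by
        have := f.2 h
        rw [← Fin.succ_last, Fin.succ_inj] at this
        exact (Fin.castSucc_lt_last i).ne this)⟩, fun i j h => by
    have h0 : f.1 (Fin.last _) - f.1 0 ≠ 0 :=
      sub_ne_zero.2 fun h => (Fin.last_pos (n := n)).ne (f.2 h).symm
    have h1 := congrArg Subtype.val h
    simp only [normalize, div_left_inj' h0] at h1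
    have h2 : f.1 i.castSucc.succ = f.1 j.castSucc.succ := by linear_combination h1 / 2
    exact Fin.castSucc_injective _ (Fin.succ_injective _ (f.2 h2))⟩

theorem continuous_forgetEnds {n : ℕ} :
    Continuous (forgetEnds : OConf ℂ (n + 2) → OConf PuncturedPlane n) := by
  have hc : ∀ i, Continuous fun f : OConf ℂ (n + 2) => f.1 i :=
    fun i => (continuous_apply i).comp continuous_subtype_val
  refine Continuous.subtype_mk (continuous_pi fun i => Continuous.subtype_mk ?_ _) _
  refine Continuous.div (((continuous_const.mul (hc _)).sub (hc _)).sub (hc _))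
    ((hc _).sub (hc _)) fun f => ?_
  exact sub_ne_zero.2 fun h => (Fin.last_pos (n := n)).ne (f.2 h).symm

/-- `normalize (-1) 1` is the identity. The retraction depends on which points are first and last,
so it exists only for ordered configurations. -/
theorem forgetEnds_addEndsOrdered {n : ℕ} (f : OConf PuncturedPlane n) :
    forgetEnds (addEndsOrdered f) = f := by
  refine Subtype.ext (funext fun i => Subtype.ext ?_)
  have h0 : (addEndsOrdered f).1 0 = -1 := rfl
  have h1 : (addEndsOrdered f).1 (Fin.last _) = 1 := by
    simp [addEndsOrdered, ← Fin.succ_last]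
  have h2 : (addEndsOrdered f).1 i.castSucc.succ = f.1 i := by
    simp [addEndsOrdered]
  change normalize _ _ _ = _
  rw [h0, h1, h2, normalize]
  ring

/-- Two paths of unordered configurations with a common starting point are homotopic if they
become homotopic after the points `-1` and `1` have been added. -/
theorem homotopic_of_addEnds_homotopic {n : ℕ} {p q : Conf PuncturedPlane n} {γ γ' : Path p q}
    (h : (γ.map (addEnds n).continuous).Homotopic (γ'.map (addEnds n).continuous)) :
    γ.Homotopic γ' := by
  have cov := Conf.isCoveringMap_mk PuncturedPlane n
  obtain ⟨e, he⟩ : ∃ e : OConf PuncturedPlane n, Conf.mk e = p := Quotient.exists_rep p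
  obtain ⟨Γ, hΓ, hΓ0⟩ := cov.exists_path_lifts γ.toContinuousMap e (γ.source.trans he.symm)
  obtain ⟨Γ', hΓ', hΓ0'⟩ := cov.exists_path_lifts γ'.toContinuousMap e (γ'.source.trans he.symm)
  let a : C(OConf PuncturedPlane n, OConf ℂ (n + 2)) := ⟨addEndsOrdered, continuous_addEndsOrdered⟩
  -- Lifts with a common starting point are homotopic relative to their ends as soon as their
  -- projections are.
  have key : (a.comp Γ).HomotopicRel (a.comp Γ') {0, 1} := by
    rw [(Conf.isCoveringMap_mk ℂ (n + 2)).homotopicRel_iff_comp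
      ⟨0, by simp, by simp [hΓ0, hΓ0']⟩]
    have e1 : (ContinuousMap.comp ⟨Conf.mk, Conf.continuous_mk⟩ (a.comp Γ)) =
        (γ.map (addEnds n).continuous).toContinuousMap := by
      ext t
      exact congrArg (addEnds n) (congrFun hΓ t)
    have e2 : (ContinuousMap.comp ⟨Conf.mk, Conf.continuous_mk⟩ (a.comp Γ')) =
        (γ'.map (addEnds n).continuous).toContinuousMap := by
      ext t
      exact congrArg (addEnds n) (congrFun hΓ' t)
    rw [e1, e2]
    exact h
  -- Composed with `a` and a lift, `r` gives back the original path of unordered configurations.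
  let r : C(OConf ℂ (n + 2), Conf PuncturedPlane n) :=
    ⟨fun f => Conf.mk (forgetEnds f), Conf.continuous_mk.comp continuous_forgetEnds⟩
  have h2 := key.comp_continuousMap r
  have e1 : r.comp (a.comp Γ) = γ.toContinuousMap := by
    ext t
    exact (congrArg Conf.mk (forgetEnds_addEndsOrdered (Γ t))).trans (congrFun hΓ t)
  have e2 : r.comp (a.comp Γ') = γ'.toContinuousMap := by
    ext t
    exact (congrArg Conf.mk (forgetEnds_addEndsOrdered (Γ' t))).trans (congrFun hΓ' t)
  rw [e1, e2] at h2
  exact h2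

theorem inclHom_injective {n : ℕ} {S : Finset ℝ} {x : Fin (n + 2) → ℝ} (hS : IsSegmentSet S)
    (hx : ListsAlongSegment S x) : Function.Injective (inclHom hS hx) := by
  intro g g' h
  obtain ⟨γ, rfl⟩ := Path.Homotopic.Quotient.mk_surjective g
  obtain ⟨γ', rfl⟩ := Path.Homotopic.Quotient.mk_surjective g'
  rw [inclHom, FundamentalGroup.mapOfEq_apply, FundamentalGroup.mapOfEq_apply,
    ← Path.Homotopic.Quotient.mk_map, ← Path.Homotopic.Quotient.mk_map,
    ← Path.Homotopic.Quotient.mk_cast, ← Path.Homotopic.Quotient.mk_cast] at h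
  have h2 := (Path.Homotopic.Quotient.exact h).pathCast (addEnds_innerBase hS hx)
    (addEnds_innerBase hS hx)
  exact Quotient.sound (homotopic_of_addEnds_homotopic h2)

section Groupoid

open CategoryTheory

/-! ### Configurations in coordinates -/

/-- The `n`-tuples of distinct points of the twice punctured plane. -/
def confSet (n : ℕ) : Set (Fin n → ℂ) := {p | Function.Injective p ∧ ∀ i, p i ≠ -1 ∧ p i ≠ 1}

/-- The unordered configuration with given coordinates. -/
def toConf {n : ℕ} (p : confSet n) : Conf PuncturedPlane n :=
  Conf.mk ⟨fun i => ⟨p.1 i, p.2.2 i⟩, fun _ _ h => p.2.1 (congrArg Subtype.val h)⟩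

theorem continuous_toConf {n : ℕ} : Continuous (toConf : confSet n → Conf PuncturedPlane n) := by
  refine Conf.continuous_mk.comp (Continuous.subtype_mk (continuous_pi fun i => ?_) _)
  exact ((continuous_apply i).comp continuous_subtype_val).subtype_mk _

/-- Relabelling of the points of a configuration. -/
def relabel {n : ℕ} (π : Equiv.Perm (Fin n)) (p : confSet n) : confSet n :=
  ⟨p.1 ∘ π, p.2.1.comp π.injective, fun i => p.2.2 (π i)⟩

theorem continuous_relabel {n : ℕ} (π : Equiv.Perm (Fin n)) :
    Continuous (relabel π : confSet n → confSet n) := by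
  have h : Continuous fun p : confSet n => p.1 ∘ ⇑π :=
    continuous_pi fun i => (continuous_apply (π i)).comp continuous_subtype_val
  exact h.subtype_mk fun p => (relabel π p).2

theorem toConf_eq_of_range_eq {n : ℕ} {p q : confSet n} (h : Set.range p.1 = Set.range q.1) :
    toConf p = toConf q := by
  refine Conf.mk_eq_of_range_eq ?_
  have key : ∀ p : confSet n, Set.range (fun i => (⟨p.1 i, p.2.2 i⟩ : PuncturedPlane)) =
      Subtype.val ⁻¹' Set.range p.1 := by
    intro p
    ext z
    simp [Subtype.ext_iff]
  exact (key p).trans ((congrArg _ h).trans (key q).symm)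

theorem range_eq_of_toConf_eq {n : ℕ} {p q : confSet n} (h : toConf p = toConf q) :
    Set.range p.1 = Set.range q.1 := by
  have h2 := congrArg (Set.image (Subtype.val : PuncturedPlane → ℂ)) (Conf.range_eq_of_mk_eq h)
  rwa [← Set.range_comp, ← Set.range_comp] at h2

theorem toConf_relabel {n : ℕ} (π : Equiv.Perm (Fin n)) (p : confSet n) :
    toConf (relabel π p) = toConf p :=
  toConf_eq_of_range_eq (π.surjective.range_comp p.1)

/-- An unordered configuration, as an object of the fundamental groupoid. -/
abbrev pt {n : ℕ} (p : confSet n) : FundamentalGroupoid (Conf PuncturedPlane n) := ⟨toConf p⟩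

theorem pt_relabel {n : ℕ} (π : Equiv.Perm (Fin n)) (p : confSet n) : pt (relabel π p) = pt p :=
  congrArg FundamentalGroupoid.mk (toConf_relabel π p)

/-- The homotopy class of a path of ordered configurations, as a path of unordered ones. -/
def pathClass {n : ℕ} {p q : confSet n} (γ : Path p q) : pt p ⟶ pt q :=
  Path.Homotopic.Quotient.mk (γ.map continuous_toConf)

theorem pathClass_trans {n : ℕ} {p q r : confSet n} (γ : Path p q) (δ : Path q r) :
    pathClass (γ.trans δ) = pathClass γ ≫ pathClass δ := by
  rw [pathClass, Path.map_trans]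
  exact Path.Homotopic.Quotient.mk_trans _ _

theorem pathClass_refl {n : ℕ} (p : confSet n) : pathClass (Path.refl p) = 𝟙 (pt p) := rfl

/-- Relabelling a configuration changes `pt` only up to a propositional equality, so classes of the
same unordered path are compared heterogeneously. -/
theorem pathClass_heq {n : ℕ} {p q p' q' : confSet n} (γ : Path p q) (γ' : Path p' q')
    (h : ∀ t, toConf (γ t) = toConf (γ' t)) : HEq (pathClass γ) (pathClass γ') :=
  Path.Homotopic.hpath_hext h

theorem pathClass_relabel {n : ℕ} (π : Equiv.Perm (Fin n)) {p q : confSet n} (γ : Path p q) :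
    HEq (pathClass (γ.map (continuous_relabel π))) (pathClass γ) :=
  pathClass_heq _ _ fun t => toConf_relabel π (γ t)

theorem pathClass_eq_of_homotopic {n : ℕ} {p q : confSet n} {γ γ' : Path p q}
    (h : γ.Homotopic γ') : pathClass γ = pathClass γ' :=
  Quotient.sound (h.map ⟨toConf, continuous_toConf⟩)

/-! ### Cells -/

/-- A simply connected set of configurations. -/
structure Cell (n : ℕ) where
  carrier : Set (Fin n → ℂ)
  subset : carrier ⊆ confSet n
  simplyConnected : IsSimplyConnected carrier

instance {n : ℕ} : Membership (confSet n) (Cell n) := ⟨fun V p => p.1 ∈ V.carrier⟩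

namespace Cell

variable {n : ℕ}

theorem exists_path (V : Cell n) {p q : confSet n} (hp : p ∈ V) (hq : q ∈ V) :
    ∃ γ : Path p q, ∀ t, γ t ∈ V := by
  have := V.simplyConnected.simplyConnectedSpace
  let δ : Path (⟨p.1, hp⟩ : V.carrier) ⟨q.1, hq⟩ := PathConnectedSpace.somePath _ _
  exact ⟨δ.map (continuous_inclusion V.subset), fun t => (δ t).2⟩

theorem homotopic (V : Cell n) {p q : confSet n} {γ γ' : Path p q}
    (h : ∀ t, γ t ∈ V) (h' : ∀ t, γ' t ∈ V) : γ.Homotopic γ' := by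
  have := V.simplyConnected.simplyConnectedSpace
  have hp : p ∈ V := γ.source ▸ h 0
  have hq : q ∈ V := γ.target ▸ h 1
  have key : ∀ {γ : Path p q} (h : ∀ t, γ t ∈ V),
      ∃ δ : Path (⟨p.1, hp⟩ : V.carrier) ⟨q.1, hq⟩,
        δ.map (continuous_inclusion V.subset) = γ := by
    intro γ h
    refine ⟨⟨⟨fun t => ⟨(γ t).1, h t⟩,
      (continuous_subtype_val.comp γ.continuous).subtype_mk _⟩, ?_, ?_⟩, ?_⟩
    · simp
    · simp
    · ext t
      rfl
  obtain ⟨δ, rfl⟩ := key h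
  obtain ⟨δ', rfl⟩ := key h'
  exact (SimplyConnectedSpace.paths_homotopic δ δ').map ⟨_, continuous_inclusion V.subset⟩

/-- The class of the paths from `p` to `q` in a cell. -/
def cls (V : Cell n) {p q : confSet n} (hp : p ∈ V) (hq : q ∈ V) : pt p ⟶ pt q :=
  pathClass (V.exists_path hp hq).choose

theorem pathClass_eq_cls (V : Cell n) {p q : confSet n} (hp : p ∈ V) (hq : q ∈ V)
    (γ : Path p q) (h : ∀ t, γ t ∈ V) : pathClass γ = V.cls hp hq :=
  pathClass_eq_of_homotopic (V.homotopic h (V.exists_path hp hq).choose_spec)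

theorem cls_comp_cls (V : Cell n) {p q r : confSet n} (hp : p ∈ V) (hq : q ∈ V) (hr : r ∈ V) :
    V.cls hp hq ≫ V.cls hq hr = V.cls hp hr := by
  obtain ⟨γ, hγ⟩ := V.exists_path hp hq
  obtain ⟨δ, hδ⟩ := V.exists_path hq hr
  rw [← V.pathClass_eq_cls hp hq γ hγ, ← V.pathClass_eq_cls hq hr δ hδ, ← pathClass_trans]
  refine V.pathClass_eq_cls hp hr _ fun t => ?_
  rw [Path.trans_apply]
  split_ifs
  · exact hγ _
  · exact hδ _

theorem cls_self (V : Cell n) {p : confSet n} (hp : p ∈ V) : V.cls hp hp = 𝟙 (pt p) :=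
  (V.pathClass_eq_cls hp hp (Path.refl p) fun _ => hp).symm

theorem inv_cls (V : Cell n) {p q : confSet n} (hp : p ∈ V) (hq : q ∈ V) :
    inv (V.cls hp hq) = V.cls hq hp :=
  IsIso.inv_eq_of_hom_inv_id ((V.cls_comp_cls hp hq hp).trans (V.cls_self hp))

theorem cls_eq_cls_of_path {V W : Cell n} {p q : confSet n} (hp : p ∈ V) (hq : q ∈ V)
    (hp' : p ∈ W) (hq' : q ∈ W) (γ : Path p q) (h : ∀ t, γ t ∈ V) (h' : ∀ t, γ t ∈ W) :
    V.cls hp hq = W.cls hp' hq' :=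
  (V.pathClass_eq_cls hp hq γ h).symm.trans (W.pathClass_eq_cls hp' hq' γ h')

theorem cls_eq_cls_of_subset {V W : Cell n} (hVW : V.carrier ⊆ W.carrier) {p q : confSet n}
    (hp : p ∈ V) (hq : q ∈ V) : V.cls hp hq = W.cls (hVW hp) (hVW hq) := by
  obtain ⟨γ, hγ⟩ := V.exists_path hp hq
  exact cls_eq_cls_of_path hp hq _ _ γ hγ fun t => hVW (hγ t)

/-- A common path suffices to identify classes in two cells; nothing has to be known about the
intersection of the cells. This is the main device for passing from one cell to another. -/
theorem cls_eq_cls_of_segment {V W : Cell n} {p q : confSet n} (hp : p ∈ V) (hq : q ∈ V)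
    (hp' : p ∈ W) (hq' : q ∈ W) (h : segment ℝ p.1 q.1 ⊆ V.carrier)
    (h' : segment ℝ p.1 q.1 ⊆ W.carrier) : V.cls hp hq = W.cls hp' hq' := by
  have hl : ∀ t : I, AffineMap.lineMap p.1 q.1 (t : ℝ) ∈ segment ℝ p.1 q.1 := fun t => by
    rw [segment_eq_image_lineMap]
    exact ⟨t, t.2, rfl⟩
  let γ : Path p q := ⟨⟨fun t => ⟨AffineMap.lineMap p.1 q.1 (t : ℝ), V.subset (h (hl t))⟩,
    (AffineMap.lineMap_continuous.comp continuous_subtype_val).subtype_mk _⟩,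
    Subtype.ext (by simp), Subtype.ext (by simp)⟩
  exact cls_eq_cls_of_path _ _ _ _ γ (fun t => h (hl t)) fun t => h' (hl t)

/-- The cell of the configurations that lie in a given cell after a permutation of their labels. -/
def perm (V : Cell n) (π : Equiv.Perm (Fin n)) : Cell n where
  carrier := {p | p ∘ π ∈ V.carrier}
  subset p hp := by
    have h := V.subset hp
    refine ⟨fun i j hij => ?_, fun i => ?_⟩
    · have := h.1 (a₁ := π.symm i) (a₂ := π.symm j) (by simpa using hij)
      simpa using this
    · simpa using h.2 (π.symm i)
  simplyConnected :=
    (Homeomorph.isSimplyConnected_preimage (Homeomorph.piCongrLeft (Y := fun _ => ℂ) π).symm).2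
      V.simplyConnected

theorem cls_perm_heq (V : Cell n) (π : Equiv.Perm (Fin n)) {p q : confSet n}
    (hp : relabel π p ∈ V) (hq : relabel π q ∈ V) :
    HEq (V.cls hp hq) ((V.perm π).cls (p := p) (q := q) hp hq) := by
  obtain ⟨γ, hγ⟩ := (V.perm π).exists_path (p := p) (q := q) hp hq
  rw [← (V.perm π).pathClass_eq_cls hp hq γ hγ,
    ← V.pathClass_eq_cls hp hq (γ.map (continuous_relabel π)) hγ]
  exact pathClass_relabel π γ

end Cell

/-! ### Good paths -/

/-- The data with respect to which paths are good: a chamber, with at most one labelling in it for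
every unordered configuration, a base point in it, and a subgroup of the fundamental group. -/
structure Frame (n : ℕ) where
  chamber : Cell n
  base : confSet n
  base_mem : base ∈ chamber
  subgroup : Subgroup (End (pt base))
  unique : ∀ {p q : confSet n}, p ∈ chamber → q ∈ chamber → toConf p = toConf q → p = q

namespace Frame

variable {n : ℕ} (F : Frame n)

/-- A path class is good if it becomes an element of the subgroup after its ends have been connected
with the base point in the chamber. -/
def Good {a b : FundamentalGroupoid (Conf PuncturedPlane n)} (s : a ⟶ b) : Prop :=
  ∃ (p q : confSet n) (hp : p ∈ F.chamber) (hq : q ∈ F.chamber) (ep : pt p = a) (eq : pt q = b),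
    F.chamber.cls F.base_mem hp ≫ eqToHom ep ≫ s ≫ eqToHom eq.symm ≫
      F.chamber.cls hq F.base_mem ∈ F.subgroup

variable {F}

/-- By `unique` the labellings in the chamber are determined by the unordered ends, so the
existential quantifiers in `Good` involve no choice. -/
theorem good_iff {p q : confSet n} (hp : p ∈ F.chamber) (hq : q ∈ F.chamber) (s : pt p ⟶ pt q) :
    F.Good s ↔ F.chamber.cls F.base_mem hp ≫ s ≫ F.chamber.cls hq F.base_mem ∈ F.subgroup := by
  constructor
  · rintro ⟨p', q', hp', hq', ep, eq, h⟩
    obtain rfl := F.unique hp' hp (congrArg FundamentalGroupoid.as ep)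
    obtain rfl := F.unique hq' hq (congrArg FundamentalGroupoid.as eq)
    simpa using h
  · intro h
    exact ⟨p, q, hp, hq, rfl, rfl, by simpa using h⟩

theorem good_base_iff (s : pt F.base ⟶ pt F.base) : F.Good s ↔ s ∈ F.subgroup := by
  rw [good_iff F.base_mem F.base_mem, Cell.cls_self, Category.id_comp, Category.comp_id]

theorem Good.comp {a b c : FundamentalGroupoid (Conf PuncturedPlane n)} {s : a ⟶ b} {t : b ⟶ c}
    (hs : F.Good s) (ht : F.Good t) : F.Good (s ≫ t) := by
  obtain ⟨p, q, hp, hq, rfl, rfl, h⟩ := hs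
  obtain ⟨q', r, hq', hr, eq, rfl, h'⟩ := ht
  obtain rfl := F.unique hq' hq (congrArg FundamentalGroupoid.as eq)
  rw [good_iff hp hr]
  -- Multiplication in `End` is composition in the reverse order.
  have := F.subgroup.mul_mem h' h
  rw [End.mul_def] at this
  simp only [eqToHom_refl, Category.id_comp, Category.assoc] at this
  rw [← Category.assoc (F.chamber.cls hq' _), Cell.cls_comp_cls, Cell.cls_self,
    Category.id_comp] at this
  simpa using this

theorem Good.inv {a b : FundamentalGroupoid (Conf PuncturedPlane n)} {s : a ⟶ b}
    (hs : F.Good s) : F.Good (CategoryTheory.inv s) := by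
  obtain ⟨p, q, hp, hq, rfl, rfl, h⟩ := hs
  rw [good_iff hq hp]
  simp only [eqToHom_refl, Category.id_comp] at h
  have h2 := F.subgroup.inv_mem h
  have h3 : ∀ g : End (pt F.base), g⁻¹ = CategoryTheory.inv (X := pt F.base) (Y := pt F.base) g := by
    intro g
    exact (IsIso.inv_eq_of_hom_inv_id (by
      change g⁻¹ * g = 1
      simp)).symm
  rw [h3] at h2
  simpa [Cell.inv_cls] using h2

theorem Good.of_heq {a b a' b' : FundamentalGroupoid (Conf PuncturedPlane n)} {s : a ⟶ b}
    {s' : a' ⟶ b'} (ha : a = a') (hb : b = b') (h : HEq s s') (hs : F.Good s) : F.Good s' := by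
  subst ha hb
  rwa [← eq_of_heq h]

theorem good_chamber {p q : confSet n} (hp : p ∈ F.chamber) (hq : q ∈ F.chamber) :
    F.Good (F.chamber.cls hp hq) := by
  rw [good_iff hp hq, ← Category.assoc, Cell.cls_comp_cls, Cell.cls_comp_cls, Cell.cls_self]
  exact F.subgroup.one_mem

/-- Goodness depends only on the path of unordered configurations, so it may be tested after any
relabelling. This reduces every crossing to a sorted starting configuration. -/
theorem good_perm_iff (V : Cell n) (π : Equiv.Perm (Fin n)) {p q : confSet n}
    (hp : relabel π p ∈ V) (hq : relabel π q ∈ V) :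
    F.Good ((V.perm π).cls (p := p) (q := q) hp hq) ↔ F.Good (V.cls hp hq) :=
  ⟨Good.of_heq (pt_relabel π p).symm (pt_relabel π q).symm (V.cls_perm_heq π hp hq).symm,
    Good.of_heq (pt_relabel π p) (pt_relabel π q) (V.cls_perm_heq π hp hq)⟩

theorem Good.cls_symm {V : Cell n} {p q : confSet n} {hp : p ∈ V} {hq : q ∈ V}
    (h : F.Good (V.cls hp hq)) : F.Good (V.cls hq hp) := by
  rw [← V.inv_cls hp hq]
  exact h.inv

theorem Good.cls_trans {V : Cell n} {p q r : confSet n} {hp : p ∈ V} {hq : q ∈ V} {hr : r ∈ V}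
    (h : F.Good (V.cls hp hq)) (h' : F.Good (V.cls hq hr)) : F.Good (V.cls hp hr) := by
  rw [← V.cls_comp_cls hp hq hr]
  exact h.comp h'

end Frame

/-! ### Simply connected sets of configurations -/

/-- Each point of a configuration moves vertically with its own speed. -/
def vshift {n : ℕ} (v : Fin n → ℝ) (t : ℝ) (p : Fin n → ℂ) : Fin n → ℂ :=
  fun k => p k + ((t * v k : ℝ) : ℂ) * Complex.I

section vshift

variable {n : ℕ} (v : Fin n → ℝ) (t : ℝ) (p : Fin n → ℂ) (k : Fin n)

@[simp] theorem vshift_re : (vshift v t p k).re = (p k).re := by simp [vshift]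

@[simp] theorem vshift_im : (vshift v t p k).im = (p k).im + t * v k := by simp [vshift]

end vshift

/-- A set of configurations is simply connected if it is mapped to itself by a vertical flow that
moves each point up or down, and if the part where all points are above or below the real axis
according to that direction is star-shaped. -/
theorem isSimplyConnected_of_vshift {n : ℕ} {V : Set (Fin n → ℂ)} (v : Fin n → ℝ) {c : Fin n → ℂ}
    (hc : c ∈ V) (hv : ∀ k, v k * v k = 1) (hflow : ∀ p ∈ V, ∀ t : ℝ, 0 ≤ t → vshift v t p ∈ V)
    (hstar : ∀ p ∈ V, (∀ k, 0 < v k * (p k).im) → segment ℝ c p ⊆ V) : IsSimplyConnected V := by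
  -- Since `|Im (p k)| ≤ ‖p‖`, flowing for the time `1 + ‖p‖` brings every point strictly to its
  -- side of the real axis; the time depends continuously on `p`.
  have hpos : ∀ p : Fin n → ℂ, ∀ k, 0 < v k * (vshift v (1 + ‖p‖) p k).im := by
    intro p k
    rw [vshift_im]
    have h1 : |(p k).im| ≤ ‖p‖ := (Complex.abs_im_le_norm _).trans (norm_le_pi_norm p k)
    have h2 : |v k| = 1 := by
      have h0 : |v k| * |v k| = 1 := by rw [abs_mul_abs_self, hv]
      nlinarith [abs_nonneg (v k)]
    have h3 : |v k * (p k).im| ≤ ‖p‖ := by rw [abs_mul, h2, one_mul]; exact h1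
    have h4 := (abs_le.1 h3).1
    have h5 : v k * ((p k).im + (1 + ‖p‖) * v k) = v k * (p k).im + (1 + ‖p‖) * (v k * v k) := by
      ring
    rw [h5, hv]
    linarith
  let f : C(V, V) := ⟨fun p => ⟨vshift v (1 + ‖p.1‖) p.1, hflow p.1 p.2 _ (by positivity)⟩, by
    refine Continuous.subtype_mk (continuous_pi fun k => ?_) _
    have : Continuous fun p : V => p.1 k := (continuous_apply k).comp continuous_subtype_val
    unfold vshift
    exact this.add (by fun_prop)⟩
  have h1 : (ContinuousMap.id V).Homotopic f := ⟨{
    toFun := fun z => ⟨vshift v (z.1 * (1 + ‖z.2.1‖)) z.2.1,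
      hflow _ z.2.2 _ (mul_nonneg z.1.2.1 (by positivity))⟩
    continuous_toFun := by
      refine Continuous.subtype_mk (continuous_pi fun k => ?_) _
      have : Continuous fun z : I × V => z.2.1 k :=
        (continuous_apply k).comp (continuous_subtype_val.comp continuous_snd)
      unfold vshift
      fun_prop
    map_zero_left := fun p => Subtype.ext (funext fun k => by simp [vshift])
    map_one_left := fun p => Subtype.ext (funext fun k => by simp [f]) }⟩
  have hmem : ∀ (t : I) (p : V), AffineMap.lineMap c (f p).1 (t : ℝ) ∈ V := fun t p => by
    refine hstar _ (f p).2 (hpos p.1) ?_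
    rw [segment_eq_image_lineMap]
    exact ⟨t, t.2, rfl⟩
  have h2 : (ContinuousMap.const V (⟨c, hc⟩ : V)).Homotopic f := ⟨{
    toFun := fun z => ⟨AffineMap.lineMap c (f z.2).1 (z.1 : ℝ), hmem z.1 z.2⟩
    continuous_toFun := by
      refine Continuous.subtype_mk ?_ _
      simp only [AffineMap.lineMap_apply_module]
      have : Continuous fun z : I × V => (f z.2).1 :=
        continuous_subtype_val.comp (f.continuous.comp continuous_snd)
      fun_prop
    map_zero_left := fun p => Subtype.ext (by simp)
    map_one_left := fun p => Subtype.ext (by simp) }⟩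
  have : ContractibleSpace V := (contractible_iff_id_nullhomotopic V).2 ⟨⟨c, hc⟩, h1.trans h2.symm⟩
  exact SimplyConnectedSpace.ofContractible V

theorem isSimplyConnected_of_convex {n : ℕ} {V : Set (Fin n → ℂ)} (h : Convex ℝ V)
    (hne : V.Nonempty) : IsSimplyConnected V := by
  have : ContractibleSpace V := h.contractibleSpace hne
  exact SimplyConnectedSpace.ofContractible V

theorem combo_lt {a b x x' y y' : ℝ} (ha : 0 ≤ a) (hb : 0 ≤ b) (hab : a + b = 1) (hx : x < x')
    (hy : y < y') : a * x + b * y < a * x' + b * y' := by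
  rcases ha.eq_or_lt with rfl | ha
  · obtain rfl : b = 1 := by linarith
    simpa using hy
  · have h1 := mul_lt_mul_of_pos_left hx ha
    have h2 := mul_le_mul_of_nonneg_left hy.le hb
    linarith

theorem combo_pos {a b x y : ℝ} (ha : 0 ≤ a) (hb : 0 ≤ b) (hab : a + b = 1) (hx : 0 < x)
    (hy : 0 < y) : 0 < a * x + b * y := by
  simpa using combo_lt ha hb hab hx hy

theorem combo_re {n : ℕ} (a b : ℝ) (p q : Fin n → ℂ) (k : Fin n) :
    ((a • p + b • q) k).re = a * (p k).re + b * (q k).re := by simp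

theorem combo_im {n : ℕ} (a b : ℝ) (p q : Fin n → ℂ) (k : Fin n) :
    ((a • p + b • q) k).im = a * (p k).im + b * (q k).im := by simp

/-- The plane slit along the vertical rays downward from `-1` and `1`. -/
def Unslit (z : ℂ) : Prop := z.re = -1 ∨ z.re = 1 → 0 < z.im

theorem Unslit.ne {z : ℂ} (h : Unslit z) : z ≠ -1 ∧ z ≠ 1 := by
  constructor <;> rintro rfl <;> simp [Unslit] at h

theorem unslit_of_im_pos {z : ℂ} (h : 0 < z.im) : Unslit z := fun _ => h

theorem Unslit.vshift {n : ℕ} {v : Fin n → ℝ} {t : ℝ} {p : Fin n → ℂ} {k : Fin n}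
    (h : Unslit (p k)) (ht : 0 ≤ t) (hv : v k = 1) : Unslit (vshift v t p k) := by
  intro h'
  rw [vshift_re] at h'
  rw [vshift_im, hv]
  linarith [h h']

/-- The configurations that are ordered by their real parts and avoid the slits. -/
def chamberSet (n : ℕ) : Set (Fin n → ℂ) :=
  {p | StrictMono (fun k => (p k).re) ∧ ∀ k, Unslit (p k)}

/-- The configurations that avoid the slits and are ordered by their real parts, except that the
`i`-th point may pass below the `j`-th one. -/
def twistSet {n : ℕ} (i j : Fin n) : Set (Fin n → ℂ) :=
  {p | (∀ k l, k < l → ¬(k = i ∧ l = j) → (p k).re < (p l).re) ∧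
    ((p i).re = (p j).re → (p i).im < (p j).im) ∧ ∀ k, Unslit (p k)}

/-- The configurations that are ordered by their real parts and avoid the slits, except that the
`i`-th point may pass below `e`, but not above `e`. -/
def underSet {n : ℕ} (e : ℝ) (i : Fin n) : Set (Fin n → ℂ) :=
  {p | StrictMono (fun k => (p k).re) ∧ (∀ k, k ≠ i → Unslit (p k)) ∧ -1 < e * (p i).re ∧
    ((p i).re = e → (p i).im < 0)}

/-- The configurations in the chamber with the `i`-th point on a given side of `e`. -/
def sideSet {n : ℕ} (e d : ℝ) (i : Fin n) : Set (Fin n → ℂ) :=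
  {p | p ∈ chamberSet n ∧ -1 < e * (p i).re ∧ 0 < d * ((p i).re - e)}

theorem chamberSet_subset (n : ℕ) : chamberSet n ⊆ confSet n := fun _ hp =>
  ⟨fun _ _ h => hp.1.injective (congrArg Complex.re h), fun k => (hp.2 k).ne⟩

theorem twistSet_subset {n : ℕ} (i j : Fin n) : twistSet i j ⊆ confSet n := by
  intro p hp
  refine ⟨?_, fun k => (hp.2.2 k).ne⟩
  have key : ∀ k l, k < l → p k ≠ p l := by
    intro k l hkl h
    by_cases hc : k = i ∧ l = j
    · obtain ⟨rfl, rfl⟩ := hc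
      have := hp.2.1 (congrArg Complex.re h)
      rw [h] at this
      exact this.false
    · have := hp.1 k l hkl hc
      rw [h] at this
      exact this.false
  intro k l h
  by_contra hne
  rcases lt_or_gt_of_ne hne with h' | h'
  · exact key k l h' h
  · exact key l k h' h.symm

theorem underSet_subset {n : ℕ} {e : ℝ} (he : e = -1 ∨ e = 1) (i : Fin n) :
    underSet e i ⊆ confSet n := by
  intro p hp
  refine ⟨fun _ _ h => hp.1.injective (congrArg Complex.re h), fun k => ?_⟩
  by_cases hk : k = i
  · subst hk
    obtain ⟨-, -, h1, h2⟩ := hp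
    constructor <;> intro h <;> rw [h] at h1 h2 <;> rcases he with rfl | rfl <;>
      first | (norm_num at h1; done) | norm_num at h2
  · exact (hp.2.1 k hk).ne

theorem isSimplyConnected_chamberSet (n : ℕ) : IsSimplyConnected (chamberSet n) := by
  refine isSimplyConnected_of_vshift (fun _ => 1) (c := fun k => ⟨(k : ℕ), 1⟩) ?_ (by simp) ?_ ?_
  · refine ⟨fun k l h => ?_, fun k => unslit_of_im_pos (by simp)⟩
    simpa using h
  · intro p hp t ht
    exact ⟨by simpa using hp.1, fun k => (hp.2 k).vshift ht rfl⟩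
  · rintro p hp h _ ⟨a, b, ha, hb, hab, rfl⟩
    refine ⟨fun k l hkl => ?_, fun k => unslit_of_im_pos ?_⟩
    · simp only [combo_re]
      exact combo_lt ha hb hab (by simpa using hkl) (hp.1 hkl)
    · rw [combo_im]
      exact combo_pos ha hb hab (by simp) (by simpa using h k)

theorem isSimplyConnected_sideSet {n : ℕ} {e d : ℝ} (he : e = -1 ∨ e = 1) (hd : d = -1 ∨ d = 1)
    (i : Fin n) : IsSimplyConnected (sideSet e d i) := by
  have hc : -1 < e * (e + d / 2) ∧ 0 < d * ((e + d / 2) - e) := by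
    rcases he with rfl | rfl <;> rcases hd with rfl | rfl <;> norm_num
  have hc' : ∀ k l : Fin n, k < l → (e + d / 2 + ((k : ℕ) - (i : ℕ)) : ℝ) <
      e + d / 2 + ((l : ℕ) - (i : ℕ)) := by
    intro k l h
    have : ((k : ℕ) : ℝ) < (l : ℕ) := by exact_mod_cast h
    linarith
  refine isSimplyConnected_of_vshift (fun _ => 1)
    (c := fun k => ⟨e + d / 2 + ((k : ℕ) - (i : ℕ)), 1⟩) ?_ (by simp) ?_ ?_
  · refine ⟨⟨fun k l h => hc' k l h, fun k => unslit_of_im_pos (by simp)⟩, ?_⟩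
    simpa using hc
  · intro p hp t ht
    exact ⟨⟨by simpa using hp.1.1, fun k => (hp.1.2 k).vshift ht rfl⟩, by simpa using hp.2⟩
  · rintro p hp h _ ⟨a, b, ha, hb, hab, rfl⟩
    refine ⟨⟨fun k l hkl => ?_, fun k => unslit_of_im_pos ?_⟩, ?_, ?_⟩
    · simp only [combo_re]
      exact combo_lt ha hb hab (hc' k l hkl) (hp.1.1 hkl)
    · rw [combo_im]
      exact combo_pos ha hb hab (by simp) (by simpa using h k)
    · have := combo_pos ha hb hab (x := e * (e + d / 2) + 1) (y := e * (p i).re + 1)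
        (by linarith [hc.1]) (by linarith [hp.2.1])
      rw [combo_re]
      simp only [sub_self, add_zero]
      linear_combination this + hab
    · have := combo_pos ha hb hab hc.2 hp.2.2
      rw [combo_re]
      simp only [sub_self, add_zero]
      linear_combination this - d * e * hab

theorem isSimplyConnected_twistSet {n : ℕ} {i j : Fin n} (hij : (i : ℕ) + 1 = j) :
    IsSimplyConnected (twistSet i j) := by
  have hne : j ≠ i := fun h => by rw [h] at hij; omega
  -- The centre lies on the wall itself: the two points have the same real part, with the `j`-th one
  -- higher. On a segment from `c` to `p` the two real parts then agree only at `c`, or if they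
  -- already agree at `p`.
  set c : Fin n → ℂ := fun k => ⟨if k = j then (i : ℕ) else (k : ℕ), if k = j then 2 else 1⟩
  have hre : ∀ k, (c k).re = ((if k = j then (i : ℕ) else (k : ℕ) : ℕ) : ℝ) := fun k => by
    simp only [c]; split_ifs <;> simp
  have him : ∀ k, 0 < (c k).im := fun k => by simp only [c]; split_ifs <;> norm_num
  have hc : ∀ k l, k < l → ¬(k = i ∧ l = j) → (c k).re < (c l).re := by
    intro k l hkl h
    rw [hre, hre]
    norm_cast
    have h1 : (k : ℕ) < l := hkl
    split_ifs with h2 h3 h3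
    · subst h2 h3; exact absurd hkl (lt_irrefl _)
    · subst h2; omega
    · subst h3
      have : (k : ℕ) ≠ i := fun h' => h ⟨Fin.ext h', rfl⟩
      omega
    · exact h1
  have hci : (c i).re = (i : ℕ) ∧ (c j).re = (i : ℕ) ∧ (c i).im = 1 ∧ (c j).im = 2 := by
    simp [c, hne.symm]
  refine isSimplyConnected_of_vshift (fun _ => 1) (c := c) ?_ (by simp) ?_ ?_
  · refine ⟨hc, fun _ => ?_, fun k => unslit_of_im_pos (him k)⟩
    rw [hci.2.2.1, hci.2.2.2]
    norm_num
  · intro p hp t ht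
    exact ⟨by simpa using hp.1, by simpa using hp.2.1, fun k => (hp.2.2 k).vshift ht rfl⟩
  · rintro p hp h _ ⟨a, b, ha, hb, hab, rfl⟩
    refine ⟨fun k l hkl hkl' => ?_, fun h' => ?_, fun k => unslit_of_im_pos ?_⟩
    · rw [combo_re, combo_re]
      exact combo_lt ha hb hab (hc k l hkl hkl') (hp.1 k l hkl hkl')
    · rw [combo_re, combo_re, hci.1, hci.2.1, add_right_inj] at h'
      rw [combo_im, combo_im, hci.2.2.1, hci.2.2.2]
      rcases hb.eq_or_lt with rfl | hb'
      · obtain rfl : a = 1 := by linarith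
        norm_num
      · exact combo_lt ha hb hab (by norm_num) (hp.2.1 (mul_left_cancel₀ hb'.ne' h'))
    · rw [combo_im]
      exact combo_pos ha hb hab (him k) (by simpa using h k)

theorem isSimplyConnected_underSet {n : ℕ} {e : ℝ} (he : e = -1 ∨ e = 1) (i : Fin n) :
    IsSimplyConnected (underSet e i) := by
  have hee : e * e = 1 := by rcases he with rfl | rfl <;> norm_num
  -- The `i`-th point flows down, away from the puncture it passes below; the others flow up, out of
  -- the slits.
  set v : Fin n → ℝ := fun k => if k = i then -1 else 1
  have hvi : v i = -1 := by simp [v]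
  have hvk : ∀ k, k ≠ i → v k = 1 := fun k hk => by simp [v, hk]
  have hc' : ∀ k l : Fin n, k < l → (e + ((k : ℕ) - (i : ℕ)) : ℝ) < e + ((l : ℕ) - (i : ℕ)) := by
    intro k l h
    have : ((k : ℕ) : ℝ) < (l : ℕ) := by exact_mod_cast h
    linarith
  refine isSimplyConnected_of_vshift v (c := fun k => ⟨e + ((k : ℕ) - (i : ℕ)), v k⟩) ?_
    (fun k => by simp only [v]; split_ifs <;> norm_num) ?_ ?_
  · refine ⟨fun k l h => hc' k l h, fun k hk => unslit_of_im_pos (by simp [hvk k hk]), ?_, ?_⟩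
    · simp only [sub_self, add_zero, hee]; norm_num
    · simp [hvi]
  · intro p hp t ht
    refine ⟨by simpa using hp.1, fun k hk => (hp.2.1 k hk).vshift ht (hvk k hk),
      by simpa using hp.2.2.1, fun h => ?_⟩
    rw [vshift_re] at h
    rw [vshift_im, hvi]
    linarith [hp.2.2.2 h]
  · rintro p hp h _ ⟨a, b, ha, hb, hab, rfl⟩
    refine ⟨fun k l hkl => ?_, fun k hk => unslit_of_im_pos ?_, ?_, fun _ => ?_⟩
    · simp only [combo_re]
      exact combo_lt ha hb hab (hc' k l hkl) (hp.1 hkl)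
    · rw [combo_im]
      have := h k
      rw [hvk k hk, one_mul] at this
      exact combo_pos ha hb hab (by simp [hvk k hk]) this
    · have := combo_pos ha hb hab (x := e * e + 1) (y := e * (p i).re + 1)
        (by rw [hee]; norm_num) (by linarith [hp.2.2.1])
      rw [combo_re]
      simp only [sub_self, add_zero]
      linear_combination this + hab
    · have h1 := h i
      rw [hvi] at h1
      have := combo_pos ha hb hab (x := 1) (y := -(p i).im) one_pos (by linarith)
      rw [combo_im]
      simp only [hvi]
      linarith

/-- The configurations that are ordered by their real parts and avoid the slits, as a cell. -/
def chamberCell (n : ℕ) : Cell n := ⟨_, chamberSet_subset n, isSimplyConnected_chamberSet n⟩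

/-- The configurations in the chamber with the `i`-th point on a given side of `e`, as a cell. -/
def sideCell {n : ℕ} {e d : ℝ} (he : e = -1 ∨ e = 1) (hd : d = -1 ∨ d = 1) (i : Fin n) : Cell n :=
  ⟨sideSet e d i, fun _ hp => chamberSet_subset n hp.1, isSimplyConnected_sideSet he hd i⟩

/-- The cell of the configurations where the `i`-th point may pass below the `j`-th one. -/
def twistCell {n : ℕ} {i j : Fin n} (hij : (i : ℕ) + 1 = j) : Cell n :=
  ⟨_, twistSet_subset i j, isSimplyConnected_twistSet hij⟩

/-- The cell of the configurations where the `i`-th point may pass below `e`. -/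
def underCell {n : ℕ} {e : ℝ} (he : e = -1 ∨ e = 1) (i : Fin n) : Cell n :=
  ⟨_, underSet_subset he i, isSimplyConnected_underSet he i⟩

/-! ### The chamber as a frame -/

/-- A strictly increasing family of real parts is determined by its range, and distinct points of a
configuration in the chamber have distinct real parts. -/
theorem eq_of_mem_chamberCell {n : ℕ} {p q : confSet n} (hp : p ∈ chamberCell n)
    (hq : q ∈ chamberCell n) (h : toConf p = toConf q) : p = q := by
  have hr := range_eq_of_toConf_eq h
  have hre : (fun k => (p.1 k).re) = fun k => (q.1 k).re := by
    rw [← hp.1.range_inj hq.1]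
    have := congrArg (Set.image Complex.re) hr
    rwa [← Set.range_comp, ← Set.range_comp] at this
  refine Subtype.ext (funext fun k => ?_)
  obtain ⟨l, hl⟩ : p.1 k ∈ Set.range q.1 := hr ▸ Set.mem_range_self k
  have h1 : (q.1 l).re = (q.1 k).re := (congrArg Complex.re hl).trans (congrFun hre k)
  rw [← hl, hq.1.injective h1]

/-- The frame given by the chamber, a base point and a subgroup of the fundamental group. -/
def chamberFrame {n : ℕ} (y : confSet n) (hy : y ∈ chamberCell n) (G : Subgroup (End (pt y))) :
    Frame n where
  chamber := chamberCell n
  base := y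
  base_mem := hy
  subgroup := G
  unique := eq_of_mem_chamberCell

theorem swap_lt_swap {n : ℕ} {i j : Fin n} (hij : (i : ℕ) + 1 = j) {k l : Fin n} (hkl : k < l)
    (h : ¬(k = i ∧ l = j)) : Equiv.swap i j k < Equiv.swap i j l := by
  simp only [Equiv.swap_apply_def, Fin.ext_iff] at h ⊢
  rw [Fin.lt_def] at hkl ⊢
  split_ifs <;> omega

theorem chamberSet_subset_twistSet {n : ℕ} {i j : Fin n} (hij : (i : ℕ) + 1 = j) :
    chamberSet n ⊆ twistSet i j := by
  intro p hp
  refine ⟨fun k l hkl _ => hp.1 hkl, fun h => ?_, hp.2⟩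
  have := hp.1.injective h
  rw [this] at hij
  omega

theorem perm_chamberCell_subset_twistSet {n : ℕ} {i j : Fin n} (hij : (i : ℕ) + 1 = j) :
    ((chamberCell n).perm (Equiv.swap i j)).carrier ⊆ twistSet i j := by
  intro p hp
  have hp' : p ∘ Equiv.swap i j ∈ chamberSet n := hp
  refine ⟨fun k l hkl h => ?_, fun h => ?_, fun k => ?_⟩
  · simpa using hp'.1 (swap_lt_swap hij hkl h)
  · have := hp'.1.injective (a₁ := j) (a₂ := i) (by simpa using h)
    rw [this] at hij
    omega
  · simpa using hp'.2 (Equiv.swap i j k)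

theorem sideSet_subset_underSet {n : ℕ} (e d : ℝ) (i : Fin n) :
    sideSet e d i ⊆ underSet e i :=
  fun _ hp => ⟨hp.1.1, fun k _ => hp.1.2 k, hp.2.1, fun h => by simpa [h] using hp.2.2⟩

theorem mem_twistCell {n : ℕ} {i j : Fin n} (hij : (i : ℕ) + 1 = j) {p : confSet n}
    (hp : p ∈ chamberCell n) : p ∈ twistCell hij := chamberSet_subset_twistSet hij hp

theorem mem_twistCell_of_relabel {n : ℕ} {i j : Fin n} (hij : (i : ℕ) + 1 = j) {p : confSet n}
    (hp : relabel (Equiv.swap i j) p ∈ chamberCell n) : p ∈ twistCell hij :=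
  perm_chamberCell_subset_twistSet hij hp

theorem mem_underCell {n : ℕ} {e d : ℝ} (he : e = -1 ∨ e = 1) {i : Fin n} {p : confSet n}
    (hp : p.1 ∈ sideSet e d i) : p ∈ underCell he i := sideSet_subset_underSet e d i hp

theorem relabel_swap_relabel_swap {n : ℕ} (i j : Fin n) (p : confSet n) :
    relabel (Equiv.swap i j) (relabel (Equiv.swap i j) p) = p :=
  Subtype.ext (funext fun k => by simp [relabel])

/-! ### Elementary crossings, and two points near a puncture -/

section Crossings

variable {n : ℕ} {y : confSet n} {hy : y ∈ chamberCell n} {G : Subgroup (End (pt y))}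

/-- The exchange of two neighbours, the left one passing below the right one, is good. -/
def GoodTwist (F : Frame n) {i j : Fin n} (hij : (i : ℕ) + 1 = j) : Prop :=
  ∀ (p q : confSet n) (hp : p ∈ chamberCell n) (hq : relabel (Equiv.swap i j) q ∈ chamberCell n),
    F.Good ((twistCell hij).cls (mem_twistCell hij hp) (mem_twistCell_of_relabel hij hq))

/-- The passage of the `i`-th point below `e` is good. -/
def GoodUnder (F : Frame n) {e : ℝ} (he : e = -1 ∨ e = 1) (i : Fin n) : Prop :=
  ∀ (p q : confSet n) (hp : p.1 ∈ sideSet e (-1) i) (hq : q.1 ∈ sideSet e 1 i),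
    F.Good ((underCell he i).cls (mem_underCell he hp) (mem_underCell he hq))

/-- The ends of a crossing can be moved freely within the chamber on one side and within the swapped
chamber on the other; both lie in the twist cell, and these motions are good. So one good crossing
suffices. -/
theorem goodTwist_of_exists {i j : Fin n} (hij : (i : ℕ) + 1 = j) {p q : confSet n}
    (hp : p ∈ chamberCell n) (hq : relabel (Equiv.swap i j) q ∈ chamberCell n)
    (h : (chamberFrame y hy G).Good
      ((twistCell hij).cls (mem_twistCell hij hp) (mem_twistCell_of_relabel hij hq))) :
    GoodTwist (chamberFrame y hy G) hij := by
  intro p' q' hp' hq'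
  have h1 : (chamberFrame y hy G).Good
      ((twistCell hij).cls (mem_twistCell hij hp') (mem_twistCell hij hp)) := by
    rw [← Cell.cls_eq_cls_of_subset (V := chamberCell n) (W := twistCell hij)
      (chamberSet_subset_twistSet hij) hp' hp]
    exact Frame.good_chamber (F := chamberFrame y hy G) hp' hp
  have h2 : (chamberFrame y hy G).Good ((twistCell hij).cls (mem_twistCell_of_relabel hij hq)
      (mem_twistCell_of_relabel hij hq')) := by
    rw [← Cell.cls_eq_cls_of_subset (V := (chamberCell n).perm (Equiv.swap i j))
      (W := twistCell hij)      (perm_chamberCell_subset_twistSet hij) hq hq']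
    exact (Frame.good_perm_iff _ _ hq hq').2
      (Frame.good_chamber (F := chamberFrame y hy G) hq hq')
  have h3 := (h1.comp h).comp h2
  rwa [Cell.cls_comp_cls, Cell.cls_comp_cls] at h3

/-- Each side cell is simply connected and lies both in the chamber and in the under cell. Moving an
end of the passage within its side has therefore the same class in both, and is good. -/
theorem goodUnder_of_exists {e : ℝ} (he : e = -1 ∨ e = 1) {i : Fin n} {p q : confSet n}
    (hp : p.1 ∈ sideSet e (-1) i) (hq : q.1 ∈ sideSet e 1 i)
    (h : (chamberFrame y hy G).Good
      ((underCell he i).cls (mem_underCell he hp) (mem_underCell he hq))) :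
    GoodUnder (chamberFrame y hy G) he i := by
  have key : ∀ {d : ℝ} (_ : d = -1 ∨ d = 1) {p q : confSet n} (hp : p.1 ∈ sideSet e d i)
      (hq : q.1 ∈ sideSet e d i), (chamberFrame y hy G).Good
        ((underCell he i).cls (mem_underCell he hp) (mem_underCell he hq)) := by
    intro d hd p q hp hq
    have h1 := Frame.good_chamber (F := chamberFrame y hy G) hp.1 hq.1
    have h2 : (chamberCell n).cls hp.1 hq.1 = _ :=
      (Cell.cls_eq_cls_of_subset (V := sideCell he hd i) (W := chamberCell n)
        (fun _ h => h.1) hp hq).symm.trans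
      (Cell.cls_eq_cls_of_subset (V := sideCell he hd i) (W := underCell he i)
        (sideSet_subset_underSet e d i) hp hq)
    rwa [← h2]
  intro p' q' hp' hq'
  have h3 := ((key (Or.inl rfl) hp' hp).comp h).comp (key (Or.inr rfl) hq hq')
  rwa [Cell.cls_comp_cls, Cell.cls_comp_cls] at h3

/-- The `i`-th point lies on the horizontal line at height `1` and the `j`-th point on that at
height `-1`; both are near `e` horizontally, and the other points are far away. -/
def duo (e : ℝ) (i j : Fin n) (a b : ℝ) : Fin n → ℂ := fun k =>
  if k = i then ⟨e + a, 1⟩ else if k = j then ⟨e + b, -1⟩ else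
    if k < i then ⟨e - 3 + ((k : ℕ) - (i : ℕ)), 1⟩ else ⟨e + 3 + ((k : ℕ) - (j : ℕ)), 1⟩

theorem duo_combo (e : ℝ) (i j : Fin n) (a b a' b' : ℝ) {A B : ℝ} (hAB : A + B = 1) :
    A • duo e i j a b + B • duo e i j a' b' = duo e i j (A * a + B * a') (A * b + B * b') := by
  obtain rfl : B = 1 - A := by linarith
  funext k
  simp only [Pi.add_apply, Pi.smul_apply, duo]
  split_ifs <;> apply Complex.ext <;> simp <;> ring

theorem duo_re_lt {e : ℝ} {i j : Fin n} (hij : (i : ℕ) + 1 = j) {a b : ℝ} (ha : |a| < 1)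
    (hb : |b| < 1) {k l : Fin n} (hkl : k < l) (h : ¬(k = i ∧ l = j)) :
    (duo e i j a b k).re < (duo e i j a b l).re := by
  have ha' := abs_lt.1 ha
  have hb' := abs_lt.1 hb
  rw [Fin.lt_def] at hkl
  have hkl' : ((k : ℕ) : ℝ) + 1 ≤ (l : ℕ) := by exact_mod_cast hkl
  have hij' : ((i : ℕ) : ℝ) + 1 = (j : ℕ) := by exact_mod_cast hij
  have h1 : (k : ℕ) < i → ((k : ℕ) : ℝ) < (i : ℕ) := fun h => by exact_mod_cast h
  have h2 : (j : ℕ) < l → ((j : ℕ) : ℝ) < (l : ℕ) := fun h => by exact_mod_cast h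
  simp only [Fin.ext_iff] at h
  simp only [duo, Fin.ext_iff, Fin.lt_def]
  split_ifs <;> first
    | omega
    | (dsimp only; linarith)
    | (have := h1 (by omega); dsimp only; linarith)
    | (have := h2 (by omega); dsimp only; linarith)

variable {e : ℝ} (he : e = -1 ∨ e = 1) {i j : Fin n} (hij : (i : ℕ) + 1 = j) {a b : ℝ}

theorem duo_apply_left : duo e i j a b i = ⟨e + a, 1⟩ := by simp [duo]

include hij in
theorem duo_apply_right : duo e i j a b j = ⟨e + b, -1⟩ := by
  have : j ≠ i := fun h => by rw [h] at hij; omega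
  simp [duo, this]

theorem duo_im_of_ne {k : Fin n} (hk : k ≠ j) : 0 < (duo e i j a b k).im := by
  simp only [duo, hk, if_false]
  split_ifs <;> simp

include hij in
theorem duo_strictMono (ha : |a| < 1) (hb : |b| < 1) (hab : a < b) :
    StrictMono fun k => (duo e i j a b k).re := by
  intro k l hkl
  by_cases h : k = i ∧ l = j
  · obtain ⟨rfl, rfl⟩ := h
    simp only [duo_apply_left, duo_apply_right hij]
    linarith
  · exact duo_re_lt hij ha hb hkl h

include hij in
theorem duo_swap_re_lt (ha : |a| < 1) (hb : |b| < 1) {k l : Fin n} (hkl : k < l)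
    (h : ¬(k = i ∧ l = j)) :
    (duo e i j a b (Equiv.swap i j k)).re < (duo e i j a b (Equiv.swap i j l)).re := by
  refine duo_re_lt hij ha hb (swap_lt_swap hij hkl h) ?_
  rintro ⟨h1, h2⟩
  rw [Equiv.swap_apply_eq_iff, Equiv.swap_apply_left] at h1
  rw [Equiv.swap_apply_eq_iff, Equiv.swap_apply_right] at h2
  subst h1 h2
  rw [Fin.lt_def] at hkl
  omega

include hij in
theorem duo_swap_strictMono (ha : |a| < 1) (hb : |b| < 1) (hab : b < a) :
    StrictMono fun k => (duo e i j a b (Equiv.swap i j k)).re := by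
  intro k l hkl
  by_cases h : k = i ∧ l = j
  · obtain ⟨rfl, rfl⟩ := h
    simp only [Equiv.swap_apply_left, Equiv.swap_apply_right, duo_apply_left,
      duo_apply_right hij]
    linarith
  · exact duo_swap_re_lt hij ha hb hkl h

include he hij in
theorem duo_unslit (hb : |b| < 1) (hb0 : b ≠ 0) (k : Fin n) : Unslit (duo e i j a b k) := by
  by_cases hk : k = j
  · subst hk
    rw [duo_apply_right hij]
    have := abs_lt.1 hb
    intro h
    exfalso
    rcases he with rfl | rfl <;> rcases h with h | h <;> dsimp only at h <;>
      first | linarith | exact hb0 (by linarith)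
  · exact unslit_of_im_pos (duo_im_of_ne hk)

include he hij in
theorem duo_mem_chamberSet (ha : |a| < 1) (hb : |b| < 1) (hab : a < b) (hb0 : b ≠ 0) :
    duo e i j a b ∈ chamberSet n :=
  ⟨duo_strictMono hij ha hb hab, duo_unslit he hij hb hb0⟩

include he hij in
theorem duo_swap_mem_chamberSet (ha : |a| < 1) (hb : |b| < 1) (hab : b < a) (hb0 : b ≠ 0) :
    duo e i j a b ∘ Equiv.swap i j ∈ chamberSet n :=
  ⟨duo_swap_strictMono hij ha hb hab, fun _ => duo_unslit he hij hb hb0 _⟩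

include he hij in
theorem duo_swap_mem_twistSet (ha : |a| < 1) (hb : |b| < 1) (hb0 : b ≠ 0) :
    duo e i j a b ∘ Equiv.swap i j ∈ twistSet i j := by
  refine ⟨fun k l hkl h => duo_swap_re_lt hij ha hb hkl h, fun _ => ?_,
    fun _ => duo_unslit he hij hb hb0 _⟩
  simp only [Function.comp_apply, Equiv.swap_apply_left, Equiv.swap_apply_right,
    duo_apply_left, duo_apply_right hij]
  norm_num

include he in
theorem neg_one_lt_mul_add (hb : |b| < 1) : -1 < e * (e + b) := by
  have := abs_lt.1 hb
  rcases he with rfl | rfl <;> linarith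

include he hij in
theorem duo_mem_underSet (ha : |a| < 1) (hb : |b| < 1) (hab : a < b) :
    duo e i j a b ∈ underSet e j := by
  refine ⟨duo_strictMono hij ha hb hab, fun k hk => unslit_of_im_pos (duo_im_of_ne hk), ?_, ?_⟩
  · rw [duo_apply_right hij]
    exact neg_one_lt_mul_add he hb
  · rw [duo_apply_right hij]
    norm_num

include he hij in
theorem duo_swap_mem_underSet (ha : |a| < 1) (hb : |b| < 1) (hab : b < a) :
    duo e i j a b ∘ Equiv.swap i j ∈ underSet e i := by
  refine ⟨duo_swap_strictMono hij ha hb hab, fun k hk => unslit_of_im_pos (duo_im_of_ne ?_), ?_, ?_⟩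
  · rwa [Ne, Equiv.swap_apply_eq_iff, Equiv.swap_apply_right]
  · simp only [Function.comp_apply, Equiv.swap_apply_left, duo_apply_right hij]
    exact neg_one_lt_mul_add he hb
  · simp only [Function.comp_apply, Equiv.swap_apply_left, duo_apply_right hij]
    norm_num

include he hij in
theorem duo_mem_sideSet {d : ℝ} (ha : |a| < 1) (hb : |b| < 1) (hab : a < b) (hd : 0 < d * b) :
    duo e i j a b ∈ sideSet e d j := by
  refine ⟨duo_mem_chamberSet he hij ha hb hab fun h => by simp [h] at hd, ?_, ?_⟩
  · rw [duo_apply_right hij]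
    exact neg_one_lt_mul_add he hb
  · rw [duo_apply_right hij]
    simpa using hd

include he hij in
theorem duo_swap_mem_sideSet {d : ℝ} (ha : |a| < 1) (hb : |b| < 1) (hab : b < a)
    (hd : 0 < d * b) : duo e i j a b ∘ Equiv.swap i j ∈ sideSet e d i := by
  refine ⟨duo_swap_mem_chamberSet he hij ha hb hab fun h => by simp [h] at hd, ?_, ?_⟩
  · simp only [Function.comp_apply, Equiv.swap_apply_left, duo_apply_right hij]
    exact neg_one_lt_mul_add he hb
  · simp only [Function.comp_apply, Equiv.swap_apply_left, duo_apply_right hij]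
    simpa using hd

theorem abs_combo_lt {x y A B : ℝ} (hx : |x| < 1) (hy : |y| < 1) (hA : 0 ≤ A) (hB : 0 ≤ B)
    (hAB : A + B = 1) : |A * x + B * y| < 1 := by
  have h1 : ∀ x : ℝ, x ∈ Metric.ball (0 : ℝ) 1 ↔ |x| < 1 := fun x => by simp
  exact (h1 _).1 (convex_ball (0 : ℝ) 1 ((h1 x).2 hx) ((h1 y).2 hy) hA hB hAB)

/-- The configurations `duo` form a cell. -/
def duoCell : Cell n where
  carrier := {p | ∃ a b : ℝ, |a| < 1 ∧ |b| < 1 ∧ duo e i j a b = p}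
  subset := by
    rintro _ ⟨a, b, ha, hb, rfl⟩
    refine ⟨?_, fun k => ?_⟩
    · have key : ∀ k l, k < l → duo e i j a b k ≠ duo e i j a b l := by
        intro k l hkl h
        by_cases hc : k = i ∧ l = j
        · obtain ⟨rfl, rfl⟩ := hc
          have := congrArg Complex.im h
          rw [duo_apply_left, duo_apply_right hij] at this
          norm_num at this
        · exact (duo_re_lt hij ha hb hkl hc).ne (congrArg Complex.re h)
      intro k l h
      by_contra hne
      rcases lt_or_gt_of_ne hne with h' | h'
      · exact key k l h' h
      · exact key l k h' h.symm
    · have : (duo e i j a b k).im ≠ 0 := by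
        by_cases hk : k = j
        · subst hk
          rw [duo_apply_right hij]
          norm_num
        · exact (duo_im_of_ne hk).ne'
      constructor <;> intro h <;> simp [h] at this
  simplyConnected := by
    refine isSimplyConnected_of_convex ?_ ⟨_, 0, 0, by simp, by simp, rfl⟩
    rintro _ ⟨a, b, ha, hb, rfl⟩ _ ⟨a', b', ha', hb', rfl⟩ A B hA hB hAB
    exact ⟨_, _, abs_combo_lt ha ha' hA hB hAB, abs_combo_lt hb hb' hA hB hAB,
      (duo_combo e i j _ _ _ _ hAB).symm⟩

end Crossings

/-! ### Carrying the passage below a puncture over to a neighbour -/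

section Shift

variable {n : ℕ} {y : confSet n} {hy : y ∈ chamberCell n} {G : Subgroup (End (pt y))}
variable {e : ℝ} (he : e = -1 ∨ e = 1) {i j : Fin n} (hij : (i : ℕ) + 1 = j)

theorem duo_mem_duoCell {a b : ℝ} (ha : |a| < 1) (hb : |b| < 1) :
    duo e i j a b ∈ (duoCell (e := e) hij).carrier := ⟨a, b, ha, hb, rfl⟩

/-- The configuration `duo`, as an element of the configuration space. -/
def duoPt (e : ℝ) (a b : ℝ) (ha : |a| < 1) (hb : |b| < 1) : confSet n :=
  ⟨duo e i j a b, (duoCell hij).subset (duo_mem_duoCell hij ha hb)⟩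

/-- `duo` is affine in `(a, b)`, so a line segment in the square of parameters is a segment of
configurations and can be compared with any cell containing it. -/
theorem duoCell_cls_eq {V : Cell n} {a b a' b' : ℝ} (ha : |a| < 1) (hb : |b| < 1) (ha' : |a'| < 1)
    (hb' : |b'| < 1) (hp : duoPt hij e a b ha hb ∈ V) (hq : duoPt hij e a' b' ha' hb' ∈ V)
    (h : ∀ A B : ℝ, 0 ≤ A → 0 ≤ B → A + B = 1 → |A * a + B * a'| < 1 → |A * b + B * b'| < 1 →
      duo e i j (A * a + B * a') (A * b + B * b') ∈ V.carrier) :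
    (duoCell (e := e) hij).cls (p := duoPt hij e a b ha hb) (q := duoPt hij e a' b' ha' hb')
      (duo_mem_duoCell hij ha hb) (duo_mem_duoCell hij ha' hb') = V.cls hp hq := by
  have key : ∀ A B : ℝ, 0 ≤ A → 0 ≤ B → A + B = 1 →
      |A * a + B * a'| < 1 ∧ |A * b + B * b'| < 1 := fun A B hA hB hAB =>
    ⟨abs_combo_lt ha ha' hA hB hAB, abs_combo_lt hb hb' hA hB hAB⟩
  refine Cell.cls_eq_cls_of_segment _ _ _ _ ?_ ?_
  · rintro _ ⟨A, B, hA, hB, hAB, rfl⟩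
    exact ⟨_, _, (key A B hA hB hAB).1, (key A B hA hB hAB).2, (duo_combo e i j _ _ _ _ hAB).symm⟩
  · rintro _ ⟨A, B, hA, hB, hAB, rfl⟩
    have := h A B hA hB hAB (key A B hA hB hAB).1 (key A B hA hB hAB).2
    rwa [← duo_combo e i j _ _ _ _ hAB] at this

include he hij in
-- In the square of parameters `(a, b)` the relevant walls are `a = b`, where the low point passes
-- below the high one, and `b = 0`, where the low point passes below `e`; the high point, at height
-- `1`, passes above `e` without leaving the chamber. The walls meet at the origin, which is still a
-- legitimate configuration, so the hexagon of six moves around it is contractible. Two edges cross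
-- no wall and two cross `a = b`, so these four are good. The other two cross `b = 0`: there the low
-- point is the `j`-th one from the left if `a < b` and the `i`-th one if `b < a`. Hence one of
-- these passages is good exactly when the other is.
theorem goodUnder_succ_iff (ht : GoodTwist (chamberFrame y hy G) hij) :
    GoodUnder (chamberFrame y hy G) he i ↔ GoodUnder (chamberFrame y hy G) he j := by
  set F := chamberFrame y hy G with hF
  have a1 : |(1 / 2 : ℝ)| < 1 := by norm_num [abs_lt]
  have a2 : |(-1 / 2 : ℝ)| < 1 := by norm_num [abs_lt]
  have b1 : |(3 / 4 : ℝ)| < 1 := by norm_num [abs_lt]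
  have b3 : |(-1 / 4 : ℝ)| < 1 := by norm_num [abs_lt]
  have b4 : |(-3 / 4 : ℝ)| < 1 := by norm_num [abs_lt]
  have b6 : |(1 / 4 : ℝ)| < 1 := by norm_num [abs_lt]
  have hm := fun {a b : ℝ} (ha : |a| < 1) (hb : |b| < 1) => duo_mem_duoCell (e := e) hij ha hb
  let W : Cell n := duoCell (e := e) hij
  let D := fun {a b : ℝ} (ha : |a| < 1) (hb : |b| < 1) => duoPt hij e a b ha hb
  let g := fun {a b a' b' : ℝ} (ha : |a| < 1) (hb : |b| < 1) (ha' : |a'| < 1) (hb' : |b'| < 1) =>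
    F.Good (W.cls (p := D ha hb) (q := D ha' hb') (hm ha hb) (hm ha' hb'))
  have gtrans : ∀ {a b a' b' a'' b'' : ℝ} {ha : |a| < 1} {hb : |b| < 1} {ha' : |a'| < 1}
      {hb' : |b'| < 1} {ha'' : |a''| < 1} {hb'' : |b''| < 1}, g ha hb ha' hb' →
      g ha' hb' ha'' hb'' → g ha hb ha'' hb'' := by
    intro a b a' b' a'' b'' ha hb ha' hb' ha'' hb'' h h'
    exact Frame.Good.cls_trans h h'
  have gsymm : ∀ {a b a' b' : ℝ} {ha : |a| < 1} {hb : |b| < 1} {ha' : |a'| < 1}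
      {hb' : |b'| < 1}, g ha hb ha' hb' → g ha' hb' ha hb := fun h => h.cls_symm
  have g12 : g a1 b1 a2 b1 := by
    have h1 := duo_mem_chamberSet he hij a1 b1 (by norm_num) (by norm_num)
    have h2 := duo_mem_chamberSet he hij a2 b1 (by norm_num) (by norm_num)
    have := Frame.good_chamber (F := F) (p := D a1 b1) (q := D a2 b1) h1 h2
    rwa [← duoCell_cls_eq hij a1 b1 a2 b1 h1 h2 fun A B hA hB hAB h h' =>
      duo_mem_chamberSet he hij h h' (by linarith) (by intro; linarith)] at this
  have g45 : g a2 b4 a1 b4 := by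
    have h1 := duo_swap_mem_chamberSet he hij a2 b4 (by norm_num) (by norm_num)
    have h2 := duo_swap_mem_chamberSet he hij a1 b4 (by norm_num) (by norm_num)
    have := (F.good_perm_iff (chamberCell n) (Equiv.swap i j) (p := D a2 b4) (q := D a1 b4) h1 h2).2
      (Frame.good_chamber (F := F) h1 h2)
    rwa [← duoCell_cls_eq (V := (chamberCell n).perm (Equiv.swap i j)) hij a2 b4 a1 b4 h1 h2
      fun A B hA hB hAB h h' =>
      duo_swap_mem_chamberSet he hij h h' (by linarith) (by intro; linarith)] at this
  -- The sign condition keeps the edge on one side of `b = 0`, so that only the wall `a = b` is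
  -- crossed. After swapping labels the low point has label `i`, as the twist cell demands.
  have gtwist : ∀ {a b b' : ℝ} (ha : |a| < 1) (hb : |b| < 1) (hb' : |b'| < 1), a < b → b' < a →
      0 < b * b' → g ha hb ha hb' := by
    intro a b b' ha hb hb' h h' hbb
    have hb0 : b ≠ 0 := by rintro rfl; simp at hbb
    have hb0' : b' ≠ 0 := by rintro rfl; simp at hbb
    have h1 : duo e i j a b ∈ ((twistCell hij).perm (Equiv.swap i j)).carrier :=
      duo_swap_mem_twistSet he hij ha hb hb0
    have h2 : duo e i j a b' ∈ ((twistCell hij).perm (Equiv.swap i j)).carrier :=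
      duo_swap_mem_twistSet he hij ha hb' hb0'
    have h3 : relabel (Equiv.swap i j) (relabel (Equiv.swap i j) (D ha hb)) ∈ chamberCell n := by
      rw [relabel_swap_relabel_swap]
      exact duo_mem_chamberSet he hij ha hb h hb0
    have h4 : relabel (Equiv.swap i j) (D ha hb') ∈ chamberCell n :=
      duo_swap_mem_chamberSet he hij ha hb' h' hb0'
    have := (F.good_perm_iff (twistCell hij) (Equiv.swap i j) (p := D ha hb) (q := D ha hb') h1 h2).2
      (ht _ _ h4 h3).cls_symm
    rwa [← duoCell_cls_eq (V := (twistCell hij).perm (Equiv.swap i j)) hij ha hb ha hb' h1 h2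
      fun A B hA hB hAB h h' => duo_swap_mem_twistSet he hij h h' ?_] at this
    have hcc := hbb
    rcases mul_pos_iff.1 hbb with ⟨p1, p2⟩ | ⟨p1, p2⟩
    · exact (combo_pos hA hB hAB p1 p2).ne'
    · have := combo_pos hA hB hAB (neg_pos.2 p1) (neg_pos.2 p2)
      intro h0
      linarith
  have g61 : g a1 b1 a1 b6 := gtwist a1 b1 b6 (by norm_num) (by norm_num) (by norm_num)
  have g34 : g a2 b3 a2 b4 := gtwist a2 b3 b4 (by norm_num) (by norm_num) (by norm_num)
  have e23 : g a2 b3 a2 b1 ↔ GoodUnder F he j := by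
    have h1 := duo_mem_sideSet he hij (d := -1) a2 b3 (by norm_num) (by norm_num)
    have h2 := duo_mem_sideSet he hij (d := 1) a2 b1 (by norm_num) (by norm_num)
    have hc := duoCell_cls_eq (V := underCell he j) hij a2 b3 a2 b1 (mem_underCell he h1)
      (mem_underCell he h2) fun A B hA hB hAB h h' =>
        duo_mem_underSet he hij h h' (by linarith)
    change F.Good (W.cls (p := D a2 b3) (q := D a2 b1) _ _) ↔ _
    rw [hc]
    exact ⟨fun h => goodUnder_of_exists he (p := D a2 b3) (q := D a2 b1) h1 h2 h,
      fun h => h _ _ h1 h2⟩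
  -- Here the low point stays to the left of the high one, so the sorted labelling is the swapped
  -- one and the passage is that of the `i`-th point.
  have e56 : g a1 b4 a1 b6 ↔ GoodUnder F he i := by
    have h1 := duo_swap_mem_sideSet he hij (d := -1) a1 b4 (by norm_num) (by norm_num)
    have h2 := duo_swap_mem_sideSet he hij (d := 1) a1 b6 (by norm_num) (by norm_num)
    have h1' : relabel (Equiv.swap i j) (D a1 b4) ∈ underCell he i := mem_underCell he h1
    have h2' : relabel (Equiv.swap i j) (D a1 b6) ∈ underCell he i := mem_underCell he h2
    have hc := duoCell_cls_eq (V := (underCell he i).perm (Equiv.swap i j)) hij a1 b4 a1 b6 h1' h2'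
      fun A B hA hB hAB h h' => duo_swap_mem_underSet he hij h h' (by linarith)
    change F.Good (W.cls (p := D a1 b4) (q := D a1 b6) _ _) ↔ _
    rw [hc]
    refine (F.good_perm_iff (underCell he i) (Equiv.swap i j) h1' h2').trans
      ⟨fun h => goodUnder_of_exists he (p := relabel (Equiv.swap i j) (D a1 b4))
        (q := relabel (Equiv.swap i j) (D a1 b6)) h1 h2 h, fun h => h _ _ h1 h2⟩
  rw [← e23, ← e56]
  constructor
  · intro h
    exact gtrans g34 (gtrans g45 (gtrans h (gtrans (gsymm g61) g12)))
  · intro h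
    exact gtrans (gsymm g45) (gtrans (gsymm g34) (gtrans h (gtrans (gsymm g12) g61)))

theorem goodUnder_of_goodUnder (ht : ∀ (i j : Fin n) (hij : (i : ℕ) + 1 = j),
      GoodTwist (chamberFrame y hy G) hij) {i : Fin n} (h : GoodUnder (chamberFrame y hy G) he i)
    (j : Fin n) : GoodUnder (chamberFrame y hy G) he j := by
  have key : ∀ k : ℕ, ∀ hk : k < n, GoodUnder (chamberFrame y hy G) he ⟨k, hk⟩ ↔
      GoodUnder (chamberFrame y hy G) he ⟨0, by omega⟩ := by
    intro k
    induction k with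
    | zero => exact fun _ => Iff.rfl
    | succ k ih =>
      intro hk
      rw [← ih (by omega)]
      exact (goodUnder_succ_iff he (i := ⟨k, by omega⟩) (j := ⟨k + 1, hk⟩) rfl (ht _ _ rfl)).symm
  exact (key j j.2).2 ((key i i.2).1 h)

end Shift

/-! ### Moving a single point -/

/-- The real parts of the points of a configuration are different from each other and from the
real parts of the punctures. -/
def Generic {n : ℕ} (p : confSet n) : Prop :=
  Function.Injective (fun k => (p.1 k).re) ∧ ∀ k, (p.1 k).re ≠ -1 ∧ (p.1 k).re ≠ 1

theorem Generic.relabel {n : ℕ} {p : confSet n} (hp : Generic p) (π : Equiv.Perm (Fin n)) :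
    Generic (relabel π p) :=
  ⟨hp.1.comp π.injective, fun k => hp.2 (π k)⟩

theorem Generic.exists_relabel_mem_chamberCell {n : ℕ} {p : confSet n} (hp : Generic p) :
    ∃ π, PlaneBraids.relabel π p ∈ chamberCell n := by
  refine ⟨Tuple.sort fun k => (p.1 k).re, ?_, fun k h => ?_⟩
  · exact (Tuple.monotone_sort fun k => (p.1 k).re).strictMono_of_injective
      (hp.1.comp (Equiv.injective _))
  · have := hp.2 (Tuple.sort (fun k => (p.1 k).re) k)
    exact absurd h (by simpa [PlaneBraids.relabel] using this)

/-- The frames for which all elementary moves are good. -/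
structure AllGood {n : ℕ} (F : Frame n) : Prop where
  chamber : F.chamber = chamberCell n
  twist : ∀ (i j : Fin n) (hij : (i : ℕ) + 1 = j), GoodTwist F hij
  under : ∀ (e : ℝ) (he : e = -1 ∨ e = 1) (i : Fin n), GoodUnder F he i

/-- `w` is the real part of a puncture or of a point other than the `k`-th one. -/
def IsWall {n : ℕ} (p : confSet n) (k : Fin n) (w : ℝ) : Prop :=
  w = -1 ∨ w = 1 ∨ ∃ l, l ≠ k ∧ (p.1 l).re = w

theorem exists_crossing {a b w : ℝ} (ha : a < w) (hb : w < b) :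
    ∃ A B : ℝ, 0 ≤ A ∧ 0 ≤ B ∧ A + B = 1 ∧ A * a + B * b = w ∧
      ∀ A' B' : ℝ, A' + B' = 1 → A' * a + B' * b = w → A' = A ∧ B' = B := by
  have h : 0 < b - a := by linarith
  have h1 : (b - w) / (b - a) + (w - a) / (b - a) = 1 := by field_simp; ring
  have h2 : (b - w) / (b - a) * a + (w - a) / (b - a) * b = w := by field_simp; ring
  refine ⟨(b - w) / (b - a), (w - a) / (b - a), div_nonneg (by linarith) h.le,
    div_nonneg (by linarith) h.le, h1, h2, fun A' B' h3 h4 => ?_⟩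
  have : A' = (b - w) / (b - a) := by
    rw [eq_div_iff h.ne']
    linear_combination b * h3 - h4
  exact ⟨this, by linarith⟩

theorem swap_ne_of_lt {n : ℕ} {i j : Fin n} (hij : (i : ℕ) + 1 = j) {k l : Fin n} (hkl : k < l) :
    ¬(Equiv.swap i j k = i ∧ Equiv.swap i j l = j) := by
  rintro ⟨h1, h2⟩
  rw [Equiv.swap_apply_eq_iff, Equiv.swap_apply_left] at h1
  rw [Equiv.swap_apply_eq_iff, Equiv.swap_apply_right] at h2
  subst h1 h2
  rw [Fin.lt_def] at hkl
  omega

section SingleMove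

variable {n : ℕ} {F : Frame n} (hF : AllGood F) {U : Cell n} (hU : Convex ℝ U.carrier)
  {p q : confSet n} (hp : p ∈ U) (hq : q ∈ U) (gp : Generic p) (gq : Generic q) {k : Fin n}
  (hpq : ∀ l, l ≠ k → q.1 l = p.1 l)

include hU hp hq in
theorem good_of_segment_subset {V : Cell n} (hp' : p ∈ V) (hq' : q ∈ V) (hV : F.Good (V.cls hp' hq'))
    (h : segment ℝ p.1 q.1 ⊆ V.carrier) : F.Good (U.cls hp hq) := by
  rwa [Cell.cls_eq_cls_of_segment hp hq hp' hq' (hU.segment_subset hp hq) h]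

include hF hU gp gq hpq in
-- With at most one wall in the way there are three cases: no wall, a puncture, or another point,
-- which must then be the right neighbour. The height at the moment of crossing decides between
-- passing above and passing below, and a tie is impossible because the segment stays in the
-- configuration space.
theorem good_of_move_sorted (hc : p ∈ chamberCell n) (hle : (p.1 k).re ≤ (q.1 k).re)
    (hw : ∀ w w', IsWall p k w → IsWall p k w' → w ∈ Set.Ioo (p.1 k).re (q.1 k).re →
      w' ∈ Set.Ioo (p.1 k).re (q.1 k).re → w = w') : F.Good (U.cls hp hq) := by
  have hk : ∀ r : Fin n → ℂ, r ∈ segment ℝ p.1 q.1 → (∀ l, l ≠ k → r l = p.1 l) ∧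
      (p.1 k).re ≤ (r k).re ∧ (r k).re ≤ (q.1 k).re := by
    rintro _ ⟨A, B, hA, hB, hAB, rfl⟩
    obtain rfl : B = 1 - A := by linarith
    refine ⟨fun l hl => ?_, ?_, ?_⟩
    · simp only [Pi.add_apply, Pi.smul_apply, hpq l hl, ← add_smul]
      rw [hAB, one_smul]
    · rw [combo_re]
      nlinarith
    · rw [combo_re]
      nlinarith
  have hlt : ∀ l, l < k → (p.1 l).re < (p.1 k).re := fun l h => hc.1 h
  have hgt : ∀ l, k < l → (p.1 l).re ∉ Set.Ioo (p.1 k).re (q.1 k).re →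
      (q.1 k).re < (p.1 l).re := by
    intro l h h'
    have h1 : (p.1 k).re < (p.1 l).re := hc.1 h
    have h2 : (q.1 l).re ≠ (q.1 k).re := fun h2 => h.ne' (gq.1 h2)
    rw [hpq l h.ne'] at h2
    exact lt_of_le_of_ne (not_lt.1 fun h3 => h' ⟨h1, h3⟩) h2.symm
  -- As both ends are generic, a puncture's real part that is reached at all is reached strictly
  -- between them, so it counts as a wall in the way.
  have hend : ∀ {w x : ℝ}, w = -1 ∨ w = 1 → (p.1 k).re ≤ x → x ≤ (q.1 k).re → x = w →
      w ∈ Set.Ioo (p.1 k).re (q.1 k).re := by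
    rintro w x hw h1 h2 rfl
    have e1 : (p.1 k).re ≠ x := by rcases hw with rfl | rfl; exacts [(gp.2 k).1, (gp.2 k).2]
    have e2 : (q.1 k).re ≠ x := by rcases hw with rfl | rfl; exacts [(gq.2 k).1, (gq.2 k).2]
    exact ⟨lt_of_le_of_ne h1 e1, lt_of_le_of_ne h2 e2.symm⟩
  have hmono : (∀ l, l ≠ k → (p.1 l).re ∉ Set.Ioo (p.1 k).re (q.1 k).re) →
      ∀ r ∈ segment ℝ p.1 q.1, StrictMono fun l => (r l).re := by
    intro h r hr a b hab
    obtain ⟨h1, h2, h3⟩ := hk r hr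
    dsimp only
    by_cases ha : a = k
    · subst ha
      rw [h1 b hab.ne']
      exact h3.trans_lt (hgt b hab (h b hab.ne'))
    · by_cases hb : b = k
      · subst hb
        rw [h1 a ha]
        exact (hlt a hab).trans_le h2
      · rw [h1 a ha, h1 b hb]
        exact hc.1 hab
  have hps := left_mem_segment ℝ p.1 q.1
  have hqs := right_mem_segment ℝ p.1 q.1
  have hsU := hU.segment_subset hp hq
  have hchamber : segment ℝ p.1 q.1 ⊆ chamberSet n → F.Good (U.cls hp hq) := by
    intro h
    refine good_of_segment_subset hU hp hq (V := chamberCell n) (h hps) (h hqs) ?_ h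
    have := F.good_chamber (p := p) (q := q)
    rw [hF.chamber] at this
    exact this (h hps) (h hqs)
  by_cases hno : ∃ w, IsWall p k w ∧ w ∈ Set.Ioo (p.1 k).re (q.1 k).re
  swap
  · refine hchamber fun r hr => ⟨hmono (fun l hl h => hno ⟨_, Or.inr (Or.inr ⟨l, hl, rfl⟩), h⟩) r hr,
      fun l h => ?_⟩
    obtain ⟨h1, h2, h3⟩ := hk r hr
    by_cases hl : l = k
    · subst hl
      exfalso
      rcases h with h | h
      · exact hno ⟨_, Or.inl rfl, hend (Or.inl rfl) h2 h3 h⟩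
      · exact hno ⟨_, Or.inr (Or.inl rfl), hend (Or.inr rfl) h2 h3 h⟩
    · rw [h1 l hl] at h ⊢
      exact hc.2 l h
  obtain ⟨w, hww, hwI⟩ := hno
  obtain ⟨A, B, hA, hB, hAB, hcross, huniq⟩ := exists_crossing hwI.1 hwI.2
  set c : Fin n → ℂ := A • p.1 + B • q.1 with hcdef
  have hcs : c ∈ segment ℝ p.1 q.1 := ⟨A, B, hA, hB, hAB, rfl⟩
  have hcre : (c k).re = w := by rw [hcdef, combo_re, hcross]
  have hcconf := U.subset (hsU hcs)
  have hcu : ∀ r ∈ segment ℝ p.1 q.1, (r k).re = w → r = c := by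
    rintro _ ⟨A', B', hA', hB', hAB', rfl⟩ h
    rw [combo_re] at h
    obtain ⟨rfl, rfl⟩ := huniq A' B' hAB' h
    rfl
  rcases or_assoc.2 hww with he | ⟨m, hmk, hm⟩
  · have hwalls : ∀ l, l ≠ k → (p.1 l).re ∉ Set.Ioo (p.1 k).re (q.1 k).re := by
      intro l hl h
      have := hw _ _ hww (Or.inr (Or.inr ⟨l, hl, rfl⟩)) hwI h
      rcases he with rfl | rfl
      · exact (gp.2 l).1 this.symm
      · exact (gp.2 l).2 this.symm
    have hother : ∀ r ∈ segment ℝ p.1 q.1, (r k).re = -1 ∨ (r k).re = 1 → (r k).re = w := by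
      intro r hr h
      obtain ⟨-, h2, h3⟩ := hk r hr
      have h4 := hend h h2 h3 rfl
      have h5 : IsWall p k (r k).re := h.elim Or.inl fun h => Or.inr (Or.inl h)
      exact hw _ _ h5 hww h4 hwI
    have him : (c k).im ≠ 0 := by
      intro h
      have : c k = (w : ℂ) := Complex.ext hcre (by simpa using h)
      rcases he with rfl | rfl
      · exact (hcconf.2 k).1 (by simpa using this)
      · exact (hcconf.2 k).2 (by simpa using this)
    -- Passing below the puncture is an elementary move; passing above it never leaves the chamber.
    rcases him.lt_or_gt with him | him
    -- If the moving point were beyond the other puncture at one end, that puncture would be a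
    -- second wall in the way.
    · have hbounds : -1 < w * (p.1 k).re ∧ -1 < w * (q.1 k).re := by
        rcases he with rfl | rfl
        · have : (q.1 k).re < 1 := by
            refine lt_of_not_ge fun h => ?_
            have h1 : (1 : ℝ) ∈ Set.Ioo (p.1 k).re (q.1 k).re :=
              ⟨by linarith [hwI.1], lt_of_le_of_ne h (gq.2 k).2.symm⟩
            have := hw _ _ hww (Or.inr (Or.inl rfl)) hwI h1
            norm_num at this
          constructor <;> linarith
        · have : -1 < (p.1 k).re := by
            refine lt_of_not_ge fun h => ?_
            have h1 : (-1 : ℝ) ∈ Set.Ioo (p.1 k).re (q.1 k).re :=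
              ⟨lt_of_le_of_ne h (gp.2 k).1, by linarith [hwI.2]⟩
            have := hw _ _ hww (Or.inl rfl) hwI h1
            norm_num at this
          constructor <;> linarith
      have hqc : q.1 ∈ chamberSet n := by
        refine ⟨hmono hwalls _ hqs, fun l h => ?_⟩
        rcases h with h | h
        · exact absurd h (gq.2 l).1
        · exact absurd h (gq.2 l).2
      have hps' : p.1 ∈ sideSet w (-1) k := ⟨hc, hbounds.1, by linarith [hwI.1]⟩
      have hqs' : q.1 ∈ sideSet w 1 k := ⟨hqc, hbounds.2, by linarith [hwI.2]⟩
      refine good_of_segment_subset hU hp hq _ _ (hF.under w he k p q hps' hqs') ?_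
      intro r hr
      obtain ⟨h1, -, -⟩ := hk r hr
      refine ⟨hmono hwalls r hr, fun l hl => ?_, ?_, fun h => ?_⟩
      · rw [h1 l hl]
        exact hc.2 l
      · obtain ⟨A', B', hA', hB', hAB', rfl⟩ := hr
        have := combo_pos hA' hB' hAB' (x := w * (p.1 k).re + 1) (y := w * (q.1 k).re + 1)
          (by linarith [hbounds.1]) (by linarith [hbounds.2])
        rw [combo_re]
        linear_combination this + hAB'
      · rw [hcu r hr h]
        exact him
    · refine hchamber fun r hr => ⟨hmono hwalls r hr, fun l h => ?_⟩
      by_cases hl : l = k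
      · subst hl
        rw [hcu r hr (hother r hr h)]
        exact him
      · rw [(hk r hr).1 l hl] at h ⊢
        exact hc.2 l h
  · subst hm
    have hkm : k < m := by
      refine lt_of_not_ge fun h => ?_
      have : (p.1 m).re < (p.1 k).re := hc.1 (lt_of_le_of_ne h hmk)
      exact absurd hwI.1 (not_lt.2 this.le)
    have hnw : ∀ l, l ≠ k → l ≠ m → (p.1 l).re ∉ Set.Ioo (p.1 k).re (q.1 k).re := by
      intro l hl hlm h
      exact hlm (gp.1 (hw _ _ (Or.inr (Or.inr ⟨l, hl, rfl⟩)) hww h hwI))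
    -- A point with a label strictly between would be a second wall.
    have hij : (k : ℕ) + 1 = m := by
      by_contra hne
      rw [Fin.lt_def] at hkm
      let l : Fin n := ⟨k + 1, by omega⟩
      have h1 : k < l := Fin.lt_def.2 (by simp [l])
      have h2 : l < m := Fin.lt_def.2 (by simp only [l]; omega)
      refine hnw l h1.ne' h2.ne ⟨hc.1 h1, lt_trans (hc.1 h2) hwI.2⟩
    have hm' : ∀ r ∈ segment ℝ p.1 q.1, r m = p.1 m := fun r hr => (hk r hr).1 m hmk
    have hord : ∀ r ∈ segment ℝ p.1 q.1, ∀ a b, a < b → ¬(a = k ∧ b = m) →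
        (r a).re < (r b).re := by
      intro r hr a b hab hnot
      obtain ⟨h1, h2, h3⟩ := hk r hr
      by_cases ha : a = k
      · subst ha
        rw [h1 b hab.ne']
        exact h3.trans_lt (hgt b hab (hnw b hab.ne' fun h => hnot ⟨rfl, h⟩))
      · by_cases hb : b = k
        · subst hb
          rw [h1 a ha]
          exact (hlt a hab).trans_le h2
        · rw [h1 a ha, h1 b hb]
          exact hc.1 hab
    have hord' : ∀ r ∈ segment ℝ p.1 q.1, ∀ a b, a < b → ¬(a = k ∧ b = m) →
        (r (Equiv.swap k m a)).re < (r (Equiv.swap k m b)).re := fun r hr a b hab hnot =>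
      hord r hr _ _ (swap_lt_swap hij hab hnot) (swap_ne_of_lt hij hab)
    have hunslit : ∀ r ∈ segment ℝ p.1 q.1, ∀ l, Unslit (r l) := by
      intro r hr l h
      obtain ⟨h1, h2, h3⟩ := hk r hr
      by_cases hl : l = k
      · subst hl
        have h4 := hend h h2 h3 rfl
        have h5 : IsWall p l (r l).re := h.elim Or.inl fun h => Or.inr (Or.inl h)
        have h6 := hw _ _ h5 hww h4 hwI
        rw [h6] at h
        rcases h with h | h
        · exact absurd h (gp.2 m).1
        · exact absurd h (gp.2 m).2
      · rw [h1 l hl] at h ⊢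
        exact hc.2 l h
    have hqc : relabel (Equiv.swap k m) q ∈ chamberCell n := by
      refine ⟨fun a b hab => ?_, fun l => hunslit _ hqs _⟩
      by_cases h : a = k ∧ b = m
      · obtain ⟨rfl, rfl⟩ := h
        simp only [relabel, Function.comp_apply, Equiv.swap_apply_left, Equiv.swap_apply_right]
        rw [hpq b hmk]
        exact hwI.2
      · exact hord' _ hqs a b hab h
    have him : (c k).im ≠ (c m).im := by
      intro h
      refine hmk (hcconf.1 (Complex.ext ?_ h.symm))
      rw [hcre, hm' c hcs]
    rcases him.lt_or_gt with him | him
    · refine good_of_segment_subset hU hp hq _ _ (hF.twist k m hij p q hc hqc) ?_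
      intro r hr
      refine ⟨hord r hr, fun h => ?_, hunslit r hr⟩
      rw [hm' r hr] at h
      rw [hcu r hr h]
      exact him
    -- If the left point passes above the right one, the right one passes below it in the reversed
    -- move; after swapping the labels this is the inverse of an elementary exchange.
    · have hpc : relabel (Equiv.swap k m) (relabel (Equiv.swap k m) p) ∈ chamberCell n := by
        rwa [relabel_swap_relabel_swap]
      have hs : segment ℝ p.1 q.1 ⊆ ((twistCell hij).perm (Equiv.swap k m)).carrier := by
        intro r hr
        refine ⟨hord' r hr, fun h => ?_, fun l => hunslit r hr _⟩
        simp only [Function.comp_apply, Equiv.swap_apply_left, Equiv.swap_apply_right] at h ⊢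
        rw [hm' r hr] at h
        rw [hcu r hr h.symm]
        exact him
      refine good_of_segment_subset hU hp hq (hs hps) (hs hqs) ?_ hs
      exact (F.good_perm_iff (twistCell hij) (Equiv.swap k m) (hs hps) (hs hqs)).2
        (hF.twist k m hij _ _ hqc hpc).cls_symm

end SingleMove

theorem convex_perm {n : ℕ} {U : Cell n} (hU : Convex ℝ U.carrier) (π : Equiv.Perm (Fin n)) :
    Convex ℝ (U.perm π).carrier := fun _ hp _ hq _ _ ha hb hab => hU hp hq ha hb hab

theorem relabel_inv_relabel {n : ℕ} (π : Equiv.Perm (Fin n)) (p : confSet n) :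
    relabel π⁻¹ (relabel π p) = p :=
  Subtype.ext (funext fun k => by simp [relabel])

theorem good_id {n : ℕ} {F : Frame n} (hF : AllGood F) {p : confSet n} (gp : Generic p) :
    F.Good (𝟙 (pt p)) := by
  obtain ⟨π, hπ⟩ := gp.exists_relabel_mem_chamberCell
  rw [← hF.chamber] at hπ
  have h := Frame.good_chamber hπ hπ
  rw [Cell.cls_self] at h
  exact h.of_heq (pt_relabel π p) (pt_relabel π p) (by rw [pt_relabel])

section SingleMove

variable {n : ℕ} {F : Frame n} (hF : AllGood F) {U : Cell n} (hU : Convex ℝ U.carrier)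

include hF hU in
theorem good_of_move_right {p q : confSet n} (hp : p ∈ U) (hq : q ∈ U) (gp : Generic p)
    (gq : Generic q) {k : Fin n} (hpq : ∀ l, l ≠ k → q.1 l = p.1 l)
    (hle : (p.1 k).re ≤ (q.1 k).re)
    (hw : ∀ w w', IsWall p k w → IsWall p k w' → w ∈ Set.Ioo (p.1 k).re (q.1 k).re →
      w' ∈ Set.Ioo (p.1 k).re (q.1 k).re → w = w') : F.Good (U.cls hp hq) := by
  obtain ⟨π, hπ⟩ := gp.exists_relabel_mem_chamberCell
  obtain ⟨p', rfl⟩ : ∃ p', relabel π⁻¹ p' = p := ⟨_, relabel_inv_relabel π p⟩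
  obtain ⟨q', rfl⟩ : ∃ q', relabel π⁻¹ q' = q := ⟨_, relabel_inv_relabel π q⟩
  have e : ∀ p : confSet n, relabel π (relabel π⁻¹ p) = p := fun p => by
    simpa using relabel_inv_relabel π⁻¹ p
  rw [e] at hπ
  refine (F.good_perm_iff U π⁻¹ hp hq).1 ?_
  have ek : ∀ p : confSet n, (relabel π⁻¹ p).1 k = p.1 (π⁻¹ k) := fun _ => rfl
  rw [ek, ek] at hle
  refine good_of_move_sorted hF (convex_perm hU _) _ _ (by simpa [e] using gp.relabel π)
    (by simpa [e] using gq.relabel π) (k := π⁻¹ k) ?_ hπ hle ?_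
  · intro l hl
    have := hpq (π l) (fun h => hl (by rw [← h]; simp))
    simpa [relabel] using this
  · have hwall : ∀ w, IsWall p' (π⁻¹ k) w → IsWall (relabel π⁻¹ p') k w := by
      rintro w (h | h | ⟨l, hl, h⟩)
      · exact Or.inl h
      · exact Or.inr (Or.inl h)
      · exact Or.inr (Or.inr ⟨π l, fun h' => hl (by rw [← h']; simp), by simpa [relabel] using h⟩)
    exact fun w w' h h' => hw w w' (hwall w h) (hwall w' h')

/-- The walls for the `k`-th point. -/
def walls (p : confSet n) (k : Fin n) : Finset ℝ :=
  insert (-1) (insert 1 ((Finset.univ.erase k).image fun l => (p.1 l).re))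

theorem mem_walls {p : confSet n} {k : Fin n} {w : ℝ} : w ∈ walls p k ↔ IsWall p k w := by
  simp [walls, IsWall]

theorem walls_congr {p q : confSet n} {k : Fin n} (hpq : ∀ l, l ≠ k → q.1 l = p.1 l) :
    walls q k = walls p k := by
  have : (Finset.univ.erase k).image (fun l => (q.1 l).re) =
      (Finset.univ.erase k).image fun l => (p.1 l).re :=
    Finset.image_congr fun l hl => by
      have hl' : l ≠ k := by simpa using hl
      rw [hpq l hl']
  rw [walls, walls, this]

theorem generic_of_notMem_walls {p r : confSet n} {k : Fin n} (gp : Generic p)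
    (hpr : ∀ l, l ≠ k → r.1 l = p.1 l) (h : (r.1 k).re ∉ walls p k) : Generic r := by
  rw [mem_walls] at h
  have h1 : ∀ l, l ≠ k → (r.1 l).re ≠ (r.1 k).re := fun l hl h' =>
    h (Or.inr (Or.inr ⟨l, hl, by rw [← hpr l hl, h']⟩))
  refine ⟨fun a b hab => ?_, fun l => ?_⟩
  · dsimp only at hab
    by_cases ha : a = k
    · by_contra hne
      rw [ha] at hab hne
      exact h1 b (Ne.symm hne) hab.symm
    · by_cases hb : b = k
      · rw [hb] at hab
        exact absurd hab (h1 a ha)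
      · rw [hpr a ha, hpr b hb] at hab
        exact gp.1 hab
  · by_cases hl : l = k
    · subst hl
      exact ⟨fun h' => h (Or.inl h'), fun h' => h (Or.inr (Or.inl h'))⟩
    · rw [hpr l hl]
      exact gp.2 l

include hF hU in
-- Induction on the number of walls in the way: with two of them, the move is split at a real part
-- between them that is not a wall, where the configuration is again generic, and each half loses at
-- least one wall.
theorem good_of_single_move_right (N : ℕ) : ∀ {p q : confSet n} (hp : p ∈ U) (hq : q ∈ U)
    (_ : Generic p) (_ : Generic q) {k : Fin n} (_ : ∀ l, l ≠ k → q.1 l = p.1 l)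
    (_ : (p.1 k).re ≤ (q.1 k).re)
    (_ : ((walls p k).filter fun w => w ∈ Set.Ioo (p.1 k).re (q.1 k).re).card ≤ N),
    F.Good (U.cls hp hq) := by
  induction N using Nat.strong_induction_on with
  | _ N ih =>
  intro p q hp hq gp gq k hpq hle hN
  by_cases hw : ∀ w w', IsWall p k w → IsWall p k w' → w ∈ Set.Ioo (p.1 k).re (q.1 k).re →
      w' ∈ Set.Ioo (p.1 k).re (q.1 k).re → w = w'
  · exact good_of_move_right hF hU hp hq gp gq hpq hle hw
  · push Not at hw
    obtain ⟨w, w', h1, h1', h2, h2', hne⟩ := hw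
    wlog hlt : w < w' generalizing w w'
    · exact this w' w h1' h1 h2' h2 hne.symm (lt_of_le_of_ne (not_lt.1 hlt) hne.symm)
    obtain ⟨m, hm, hmw⟩ := (Set.Ioo_infinite hlt).exists_notMem_finset (walls p k)
    obtain ⟨A, B, hA, hB, hAB, hcross, -⟩ :=
      exists_crossing (h2.1.trans hm.1) (hm.2.trans h2'.2)
    have hrU := hU hp hq hA hB hAB
    let r : confSet n := ⟨A • p.1 + B • q.1, U.subset hrU⟩
    have hrk : (r.1 k).re = m := by rw [← hcross]; exact combo_re A B p.1 q.1 k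
    have hpr : ∀ l, l ≠ k → r.1 l = p.1 l := fun l hl => by
      simp only [r, Pi.add_apply, Pi.smul_apply, hpq l hl, ← add_smul]
      rw [hAB, one_smul]
    have hrq : ∀ l, l ≠ k → q.1 l = r.1 l := fun l hl => by rw [hpq l hl, hpr l hl]
    have gr : Generic r := generic_of_notMem_walls gp hpr (by rwa [hrk])
    have hwm := mem_walls.2 h1
    have hwm' := mem_walls.2 h1'
    have c1 : ((walls p k).filter fun x => x ∈ Set.Ioo (p.1 k).re (r.1 k).re).card < N := by
      refine lt_of_lt_of_le (Finset.card_lt_card ?_) hN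
      rw [Finset.ssubset_iff_of_subset]
      · refine ⟨w', Finset.mem_filter.2 ⟨hwm', h2'⟩, fun h => ?_⟩
        have := (Finset.mem_filter.1 h).2.2
        rw [hrk] at this
        exact absurd hm.2 (not_lt.2 this.le)
      · refine Finset.monotone_filter_right _ fun x _ hx => ⟨hx.1, hx.2.trans ?_⟩
        rw [hrk]
        exact hm.2.trans h2'.2
    have c2 : ((walls r k).filter fun x => x ∈ Set.Ioo (r.1 k).re (q.1 k).re).card < N := by
      refine lt_of_lt_of_le (Finset.card_lt_card ?_) hN
      rw [walls_congr hpr, Finset.ssubset_iff_of_subset]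
      · refine ⟨w, Finset.mem_filter.2 ⟨hwm, h2⟩, fun h => ?_⟩
        have := (Finset.mem_filter.1 h).2.1
        rw [hrk] at this
        exact absurd hm.1 (not_lt.2 this.le)
      · refine Finset.monotone_filter_right _ fun x _ hx => ⟨lt_trans ?_ hx.1, hx.2⟩
        rw [hrk]
        exact h2.1.trans hm.1
    exact (ih _ c1 hp (q := r) hrU gp gr hpr (by rw [hrk]; exact (h2.1.trans hm.1).le)
      le_rfl).cls_trans (ih _ c2 (p := r) hrU hq gr gq hrq
        (by rw [hrk]; exact (hm.2.trans h2'.2).le) le_rfl)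

include hF hU in
theorem good_of_single_move {p q : confSet n} (hp : p ∈ U) (hq : q ∈ U) (gp : Generic p)
    (gq : Generic q) {k : Fin n} (hpq : ∀ l, l ≠ k → q.1 l = p.1 l) : F.Good (U.cls hp hq) := by
  rcases le_total (p.1 k).re (q.1 k).re with h | h
  · exact good_of_single_move_right hF hU _ hp hq gp gq hpq h le_rfl
  · exact (good_of_single_move_right hF hU _ hq hp gq gp (fun l hl => (hpq l hl).symm) h
      le_rfl).cls_symm

end SingleMove

/-! ### Moving all points inside a box -/

/-- The open boxes: in such a set the points can be moved independently of each other. -/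
structure IsBox {n : ℕ} (U : Cell n) : Prop where
  convex : Convex ℝ U.carrier
  isOpen : IsOpen U.carrier
  piecewise : ∀ p ∈ U.carrier, ∀ q ∈ U.carrier, ∀ s : Finset (Fin n), s.piecewise q p ∈ U.carrier

theorem isOpen_confSet (n : ℕ) : IsOpen (confSet n) := by
  have : confSet n = (⋂ k, ⋂ l, {p : Fin n → ℂ | k ≠ l → p k ≠ p l}) ∩
      ⋂ k, {p | p k ≠ -1 ∧ p k ≠ 1} := by
    ext p
    simp only [confSet, Function.Injective, Set.mem_ofPred_eq, Set.mem_inter_iff, Set.mem_iInter]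
    refine and_congr_left fun _ => ⟨fun h k l hkl h' => hkl (h h'), fun h k l hkl => ?_⟩
    by_contra hne
    exact h k l hne hkl
  rw [this]
  refine IsOpen.inter (isOpen_iInter_of_finite fun k => isOpen_iInter_of_finite fun l => ?_)
    (isOpen_iInter_of_finite fun k => ?_)
  · by_cases h : k = l
    · simp [h]
    · simp only [ne_eq, h, not_false_eq_true, true_imp_iff]
      exact isOpen_ne_fun (continuous_apply k) (continuous_apply l)
  · exact (isOpen_ne_fun (continuous_apply k) continuous_const).inter
      (isOpen_ne_fun (continuous_apply k) continuous_const)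

theorem exists_isBox_mem {n : ℕ} (p : confSet n) : ∃ U : Cell n, IsBox U ∧ p ∈ U := by
  obtain ⟨ε, hε, h⟩ := Metric.isOpen_iff.1 (isOpen_confSet n) p.1 p.2
  refine ⟨⟨Metric.ball p.1 ε, h, isSimplyConnected_of_convex (convex_ball _ _)
    ⟨p.1, Metric.mem_ball_self hε⟩⟩, ⟨convex_ball _ _, Metric.isOpen_ball, ?_⟩,
    Metric.mem_ball_self hε⟩
  intro q hq r hr s
  rw [Metric.mem_ball, dist_pi_lt_iff hε] at hq hr ⊢
  intro k
  by_cases hk : k ∈ s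
  · rw [Finset.piecewise_eq_of_mem _ _ _ hk]
    exact hr k
  · rw [Finset.piecewise_eq_of_notMem _ _ _ hk]
    exact hq k

/-- Translating the points horizontally with the distinct nonzero speeds `k + 1` excludes only
finitely many times `s`: each coincidence of real parts, or with a value in `T'`, happens for a
single `s`. Arbitrarily small times therefore remain. -/
theorem exists_generic_mem {n : ℕ} {V : Set (Fin n → ℂ)} (hV : IsOpen V) (hsub : V ⊆ confSet n)
    (hne : V.Nonempty) (T : Finset ℝ) :
    ∃ r : confSet n, r.1 ∈ V ∧ Generic r ∧ ∀ k, (r.1 k).re ∉ T := by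
  obtain ⟨p, hp⟩ := hne
  let f : ℝ → Fin n → ℂ := fun s k => p k + ((s * ((k : ℕ) + 1) : ℝ) : ℂ)
  have hf : Continuous f := by fun_prop
  have hfre : ∀ s k, (f s k).re = (p k).re + s * ((k : ℕ) + 1) := fun s k => by
    simp only [f, Complex.add_re, Complex.ofReal_re]
  let T' : Finset ℝ := insert (-1) (insert 1 T)
  let B : Finset ℝ := (Finset.univ.biUnion fun k : Fin n => T'.image fun t =>
      (t - (p k).re) / ((k : ℕ) + 1)) ∪
    Finset.univ.image fun z : Fin n × Fin n =>
      ((p z.2).re - (p z.1).re) / (((z.1 : ℕ) : ℝ) - (z.2 : ℕ))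
  have hdense : Dense ((B : Set ℝ)ᶜ) := B.countable_toSet.dense_compl ℝ
  obtain ⟨s, hs, hsB⟩ := hdense.inter_open_nonempty _ (hV.preimage hf)
    ⟨0, by simpa [f] using hp⟩
  have hT : ∀ k, (f s k).re ∉ T' := by
    intro k h
    refine hsB (Finset.mem_coe.2 (Finset.mem_union_left _ (Finset.mem_biUnion.2
      ⟨k, Finset.mem_univ _, Finset.mem_image.2 ⟨_, h, ?_⟩⟩)))
    have : ((k : ℕ) : ℝ) + 1 ≠ 0 := by positivity
    rw [hfre]
    field_simp
    ring
  refine ⟨⟨f s, hsub hs⟩, hs, ⟨?_, fun k => ⟨fun h => hT k (by rw [h]; simp [T']),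
      fun h => hT k (by rw [h]; simp [T'])⟩⟩,
    fun k h => hT k (by simp [T', h])⟩
  · intro k l hkl
    by_contra hne
    have hne' : ((k : ℕ) : ℝ) - (l : ℕ) ≠ 0 := by
      rw [sub_ne_zero]
      exact_mod_cast fun h => hne (Fin.ext h)
    refine hsB (Finset.mem_coe.2 (Finset.mem_union_right _ (Finset.mem_image.2
      ⟨(k, l), Finset.mem_univ _, ?_⟩)))
    simp only [hfre] at hkl
    rw [div_eq_iff hne']
    linear_combination -hkl

section Box

variable {n : ℕ} {F : Frame n} (hF : AllGood F) {U : Cell n} (hU : IsBox U)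

include hF hU in
-- The points are moved from `p` to `q` one after the other. The mixed configurations stay in the
-- box, and they are generic because no real part of `p` is one of `q`.
theorem good_of_mem_box_of_disjoint {p q : confSet n} (hp : p ∈ U) (hq : q ∈ U) (gp : Generic p)
    (gq : Generic q) (hd : ∀ k l, (p.1 k).re ≠ (q.1 l).re) : F.Good (U.cls hp hq) := by
  have hm : ∀ s : Finset (Fin n), s.piecewise q.1 p.1 ∈ U.carrier := hU.piecewise _ hp _ hq
  let h : Finset (Fin n) → confSet n := fun s => ⟨s.piecewise q.1 p.1, U.subset (hm s)⟩
  have hmem : ∀ s, h s ∈ U := hm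
  have hgen : ∀ s, Generic (h s) := by
    intro s
    have h1 : ∀ k, k ∈ s → (h s).1 k = q.1 k := fun k hk =>
      Finset.piecewise_eq_of_mem _ _ _ hk
    have h2 : ∀ k, k ∉ s → (h s).1 k = p.1 k := fun k hk =>
      Finset.piecewise_eq_of_notMem _ _ _ hk
    refine ⟨fun k l hkl => ?_, fun k => ?_⟩
    · dsimp only at hkl
      by_cases hk : k ∈ s <;> by_cases hl : l ∈ s
      · rw [h1 k hk, h1 l hl] at hkl
        exact gq.1 hkl
      · rw [h1 k hk, h2 l hl] at hkl
        exact absurd hkl.symm (hd _ _)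
      · rw [h2 k hk, h1 l hl] at hkl
        exact absurd hkl (hd _ _)
      · rw [h2 k hk, h2 l hl] at hkl
        exact gp.1 hkl
    · by_cases hk : k ∈ s
      · rw [h1 k hk]
        exact gq.2 k
      · rw [h2 k hk]
        exact gp.2 k
  have h0 : h ∅ = p := Subtype.ext (by simp [h])
  have h1 : h Finset.univ = q := Subtype.ext (by simp [h])
  have key : ∀ s : Finset (Fin n), F.Good (U.cls (p := h ∅) (q := h s) (hmem _) (hmem s)) := by
    intro s
    induction s using Finset.induction_on with
    | empty =>
      rw [Cell.cls_self]
      exact good_id hF (hgen _)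
    | insert k s hk ih =>
      refine ih.cls_trans (good_of_single_move hF hU.convex _ _ (hgen _) (hgen _) (k := k) ?_)
      intro l hl
      simp [h, hl]
  -- The membership proofs mention the ends, so they are generalised before the ends are rewritten
  -- to `p` and `q`.
  have := key Finset.univ
  revert this
  generalize_proofs a b
  revert a b
  rw [h0, h1]
  exact fun _ _ h => h

include hF hU in
-- A detour through a third generic configuration, whose real parts avoid those of both `p` and `q`,
-- removes the disjointness condition.
theorem good_of_mem_box {p q : confSet n} (hp : p ∈ U) (hq : q ∈ U) (gp : Generic p)
    (gq : Generic q) : F.Good (U.cls hp hq) := by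
  obtain ⟨r, hr, gr, hd⟩ := exists_generic_mem hU.isOpen U.subset ⟨p.1, hp⟩
    ((Finset.univ.image fun k => (p.1 k).re) ∪ Finset.univ.image fun k => (q.1 k).re)
  simp only [Finset.mem_union, Finset.mem_image, Finset.mem_univ, true_and, not_or,
    not_exists] at hd
  exact (good_of_mem_box_of_disjoint hF hU hp (q := r) hr gp gr
    fun k l => (hd l).1 k).cls_trans
    (good_of_mem_box_of_disjoint hF hU (p := r) hr hq gr gq fun k l h => (hd k).2 l h.symm)

end Box

/-! ### All paths are good -/

section Global

variable {n : ℕ} {F : Frame n} (hF : AllGood F)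

include hF in
theorem good_pathClass {p q : confSet n} (gp : Generic p) (gq : Generic q) (γ : Path p q) :
    F.Good (pathClass γ) := by
  choose U hU hmem using fun p : confSet n => exists_isBox_mem p
  obtain ⟨t, t0, tmono, ⟨N, hN⟩, tsub⟩ := exists_monotone_Icc_subset_open_cover_unitInterval
    (c := fun s : I => {u | γ u ∈ U (γ s)})
    (fun s => (hU (γ s)).isOpen.preimage (continuous_subtype_val.comp γ.continuous))
    (fun s _ => Set.mem_iUnion.2 ⟨s, hmem (γ s)⟩)
  -- The subdivision points need not be generic, so the induction follows the path up to such a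
  -- point and then turns aside, inside an arbitrary box around it, to an arbitrary generic
  -- configuration.
  have key : ∀ k, ∀ s : I, s = t k → ∀ (V : Cell n) (_ : IsBox V) (hV : γ s ∈ V) (r : confSet n)
      (hr : r ∈ V) (_ : Generic r), F.Good (pathClass (γ.subpath 0 s) ≫ V.cls hV hr) := by
    intro k
    induction k with
    | zero =>
      intro s hs V hVb hV r hr gr
      rw [t0] at hs
      subst hs
      rw [Path.subpath_self, pathClass_refl, Category.id_comp]
      refine good_of_mem_box hF hVb hV hr ?_ gr
      rwa [γ.source]
    | succ k ih =>
      intro s hs V hVb hV r hr gr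
      subst hs
      obtain ⟨i, hi⟩ := tsub k
      set W := U (γ i)
      have hWb : IsBox W := hU (γ i)
      have hle := tmono k.le_succ
      have hW0 : γ (t k) ∈ W := hi (Set.left_mem_Icc.2 hle)
      have hW1 : γ (t (k + 1)) ∈ W := hi (Set.right_mem_Icc.2 hle)
      -- The new box and the box of the last piece share a generic configuration `q'`. The path is
      -- rerouted through it: up to `q'` the last piece lies in `W`, and from there to `r`
      -- everything lies in `V`.
      obtain ⟨q', ⟨hqV, hqW⟩, gq', -⟩ := exists_generic_mem (hVb.isOpen.inter hWb.isOpen)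
        (fun _ h => V.subset h.1) ⟨_, hV, hW1⟩ ∅
      have e1 : pathClass (γ.subpath 0 (t (k + 1))) =
          pathClass (γ.subpath 0 (t k)) ≫ W.cls hW0 hW1 := by
        rw [← pathClass_eq_of_homotopic ⟨Path.Homotopy.subpathTransSubpath γ 0 (t k) (t (k + 1))⟩,
          pathClass_trans]
        congr 1
        refine W.pathClass_eq_cls hW0 hW1 _ fun u => ?_
        have : (γ.subpath (t k) (t (k + 1))) u ∈ Set.range (γ.subpath (t k) (t (k + 1))) :=
          Set.mem_range_self u
        rw [Path.range_subpath_of_le _ _ _ hle] at this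
        obtain ⟨v, hv, hvu⟩ := this
        rw [← hvu]
        exact hi hv
      have e2 : V.cls hV hqV = W.cls hW1 hqW :=
        Cell.cls_eq_cls_of_segment _ _ _ _ (hVb.convex.segment_subset hV hqV)
          (hWb.convex.segment_subset hW1 hqW)
      rw [e1, ← V.cls_comp_cls hV hqV hr, e2, Category.assoc, ← Category.assoc (W.cls hW0 hW1),
        W.cls_comp_cls, ← Category.assoc]
      exact (ih (t k) rfl W hWb hW0 q' hqW gq').comp (good_of_mem_box hF hVb hqV hr gq' gr)
  have h1 := key N 1 (hN N le_rfl).symm (U (γ 1)) (hU _) (hmem _) (γ 1) (hmem _)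
    (by rwa [γ.target])
  rw [Cell.cls_self, Category.comp_id] at h1
  refine h1.of_heq (by rw [γ.source]) (by rw [γ.target]) (pathClass_heq _ _ fun u => ?_)
  rw [Path.subpath_zero_one]
  rfl

end Global

/-! ### Generators of the fundamental group of the configuration space of the punctured plane -/

/-- At time `t`, the points with label in `M` have been rotated about `c` through the angle `t θ`;
the other points stay where they are. -/
def spin {n : ℕ} (y : Fin n → ℝ) (M : Finset (Fin n)) (c θ : ℝ) (t : I) : Fin n → ℂ := fun k =>
  if k ∈ M then c + ((y k : ℂ) - c) * Complex.exp (((t : ℝ) * θ : ℝ) * Complex.I) else y k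

section Spin

variable {n : ℕ} (y : Fin n → ℝ) (M : Finset (Fin n)) (c θ : ℝ)

theorem continuous_spin : Continuous (spin y M c θ) := by
  refine continuous_pi fun k => ?_
  by_cases hk : k ∈ M
  · simp only [spin, hk, if_true]
    fun_prop
  · simp only [spin, hk, if_false]
    fun_prop

theorem spin_re (t : I) {k : Fin n} (hk : k ∈ M) :
    (spin y M c θ t k).re = c + (y k - c) * Real.cos (t * θ) := by
  simp only [spin, hk, if_true, Complex.add_re, Complex.mul_re, Complex.sub_re, Complex.sub_im,
    Complex.ofReal_re, Complex.ofReal_im, Complex.exp_ofReal_mul_I_re]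
  ring

theorem spin_im (t : I) {k : Fin n} (hk : k ∈ M) :
    (spin y M c θ t k).im = (y k - c) * Real.sin (t * θ) := by
  simp only [spin, hk, if_true, Complex.add_im, Complex.mul_im, Complex.sub_re, Complex.sub_im,
    Complex.ofReal_re, Complex.ofReal_im, Complex.exp_ofReal_mul_I_im]
  ring

theorem spin_of_notMem (t : I) {k : Fin n} (hk : k ∉ M) : spin y M c θ t k = y k := by
  simp [spin, hk]

theorem spin_zero : spin y M c θ 0 = fun k => (y k : ℂ) := by
  funext k
  simp [spin]

theorem spin_full_one : spin y M c (2 * Real.pi) 1 = fun k => (y k : ℂ) := by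
  funext k
  by_cases hk : k ∈ M <;> simp [spin, hk, Complex.exp_two_pi_mul_I]

theorem spin_half_one {i j : Fin n} :
    spin y {i, j} ((y i + y j) / 2) Real.pi 1 = (fun k => (y k : ℂ)) ∘ Equiv.swap i j := by
  funext k
  by_cases h1 : k = i
  · subst h1
    simp [spin, Complex.exp_pi_mul_I]
    ring
  · by_cases h2 : k = j
    · subst h2
      simp [spin, Complex.exp_pi_mul_I]
      ring
    · simp [spin, h1, h2, Equiv.swap_apply_of_ne_of_ne h1 h2]

end Spin

theorem sin_ne_zero_of_cos_eq_zero {φ : ℝ} (h : Real.cos φ = 0) : Real.sin φ ≠ 0 := fun h' => by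
  have := Real.sin_sq_add_cos_sq φ
  rw [h, h'] at this
  norm_num at this

/-! ### Rotations of points on the real segment and the cells that contain them -/

section Membership

variable {n : ℕ} {y : Fin n → ℝ} (hy : StrictMono y) (hy1 : ∀ k, -1 < y k ∧ y k < 1)

include hy1 in
theorem unslit_ofReal (k : Fin n) : Unslit (y k : ℂ) := by
  rintro (h | h)
  · exact absurd h (hy1 k).1.ne'
  · exact absurd h (hy1 k).2.ne

include hy hy1 in
theorem ofReal_mem_chamberSet : (fun k => (y k : ℂ)) ∈ chamberSet n :=
  ⟨fun _ _ h => hy h, unslit_ofReal hy1⟩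

include hy hy1 in
-- The real parts of the two points agree only at the quarter turn, and there counter-clockwise
-- rotation has put the left point below the right one.
theorem spin_mem_twistSet {i j : Fin n} (hij : (i : ℕ) + 1 = j) (t : I) :
    spin y {i, j} ((y i + y j) / 2) Real.pi t ∈ twistSet i j := by
  have hlt : i < j := by rw [Fin.lt_def]; omega
  have hd := hy hlt
  have c1 := Real.neg_one_le_cos (t * Real.pi)
  have c2 := Real.cos_le_one (t * Real.pi)
  have hi := spin_re y {i, j} ((y i + y j) / 2) Real.pi t (k := i) (by simp)
  have hj := spin_re y {i, j} ((y i + y j) / 2) Real.pi t (k := j) (by simp)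
  have hin : ∀ k, k = i ∨ k = j → y i ≤ (spin y {i, j} ((y i + y j) / 2) Real.pi t k).re ∧
      (spin y {i, j} ((y i + y j) / 2) Real.pi t k).re ≤ y j := by
    rintro k (rfl | rfl)
    · rw [hi]
      constructor <;> nlinarith
    · rw [hj]
      constructor <;> nlinarith
  have hout : ∀ k, ¬(k = i ∨ k = j) →
      spin y {i, j} ((y i + y j) / 2) Real.pi t k = y k := fun k hk =>
    spin_of_notMem _ _ _ _ _ (by simpa using hk)
  refine ⟨fun k l hkl hnot => ?_, fun h => ?_, fun k => ?_⟩
  · by_cases hk : k = i ∨ k = j <;> by_cases hl : l = i ∨ l = j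
    · exfalso
      rw [Fin.lt_def] at hkl hlt
      rcases hk with rfl | rfl <;> rcases hl with rfl | rfl <;> omega
    · rw [hout l hl, Complex.ofReal_re]
      refine (hin k hk).2.trans_lt (hy ?_)
      simp only [Fin.ext_iff] at hk hl
      rw [Fin.lt_def] at hkl ⊢
      omega
    · rw [hout k hk, Complex.ofReal_re]
      refine lt_of_lt_of_le (hy ?_) (hin l hl).1
      simp only [Fin.ext_iff] at hk hl
      rw [Fin.lt_def] at hkl ⊢
      omega
    · rw [hout k hk, hout l hl]
      exact hy hkl
  · rw [hi, hj] at h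
    have hcos : Real.cos (t * Real.pi) = 0 := by
      have : (y j - y i) * Real.cos (t * Real.pi) = 0 := by linear_combination -h
      exact (mul_eq_zero.1 this).resolve_left (by linarith)
    have hsin : 0 < Real.sin (t * Real.pi) :=
      lt_of_le_of_ne (Real.sin_nonneg_of_nonneg_of_le_pi (mul_nonneg t.2.1 Real.pi_pos.le)
        (mul_le_of_le_one_left Real.pi_pos.le t.2.2)) (sin_ne_zero_of_cos_eq_zero hcos).symm
    rw [spin_im _ _ _ _ _ (by simp), spin_im _ _ _ _ _ (by simp)]
    nlinarith
  · by_cases hk : k = i ∨ k = j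
    · obtain ⟨h1, h2⟩ := hin k hk
      rintro (h | h)
      · linarith [(hy1 i).1]
      · linarith [(hy1 j).2]
    · rw [hout k hk]
      exact unslit_ofReal hy1 k

variable {e : ℝ} (he : e = -1 ∨ e = 1) {i : Fin n}
  (hord : ∀ l, l ≠ i → ∀ u : ℝ, -1 ≤ u → u ≤ 1 →
    (l < i → y l < e + (y i - e) * u) ∧ (i < l → e + (y i - e) * u < y l))

include hy hord in
-- The values `e + (y i - e) * u` in `hord` are the real parts on the circle about `e` through `y
-- i`, with `u` the cosine; `hord` says that the `i`-th point never changes its rank along it.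
theorem spin_strictMono (θ : ℝ) (t : I) : StrictMono fun k => (spin y {i} e θ t k).re := by
  have hi := spin_re y {i} e θ t (k := i) (by simp)
  have hout : ∀ k, k ≠ i → spin y {i} e θ t k = y k := fun k hk =>
    spin_of_notMem _ _ _ _ _ (by simpa using hk)
  intro k l hkl
  dsimp only
  by_cases hk : k = i
  · subst hk
    rw [hi, hout l hkl.ne']
    exact (hord l hkl.ne' _ (Real.neg_one_le_cos _) (Real.cos_le_one _)).2 hkl
  · by_cases hl : l = i
    · subst hl
      rw [hi, hout k hk]
      exact (hord k hk _ (Real.neg_one_le_cos _) (Real.cos_le_one _)).1 hkl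
    · rw [hout k hk, hout l hl]
      exact hy hkl

include hy1 he in
theorem neg_one_lt_mul_spin_re (θ : ℝ) (t : I) : -1 < e * (spin y {i} e θ t i).re := by
  rw [spin_re _ _ _ _ _ (by simp)]
  have h1 := Real.neg_one_le_cos (t * θ)
  have h2 := Real.cos_le_one (t * θ)
  obtain ⟨h3, h4⟩ := hy1 i
  rcases he with rfl | rfl <;> nlinarith

include hy1 he in
theorem cos_eq_zero_of_spin_re {θ : ℝ} {t : I} (h : (spin y {i} e θ t i).re = e) :
    Real.cos (t * θ) = 0 := by
  rw [spin_re _ _ _ _ _ (by simp)] at h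
  have h1 : (y i - e) * Real.cos (t * θ) = 0 := by linear_combination h
  refine (mul_eq_zero.1 h1).resolve_left (sub_ne_zero.2 fun h => ?_)
  rcases he with rfl | rfl
  · exact (hy1 i).1.ne' h
  · exact (hy1 i).2.ne h

include hy hy1 he hord in
-- The circle does not reach the real part of the other puncture, so the only slit to be avoided is
-- that of `e`, and only at the times where the cosine vanishes.
theorem spin_mem_chamberSet {θ : ℝ} {t : I}
    (h : Real.cos (t * θ) = 0 → 0 < (y i - e) * Real.sin (t * θ)) :
    spin y {i} e θ t ∈ chamberSet n := by
  refine ⟨spin_strictMono hy hord θ t, fun k => ?_⟩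
  by_cases hk : k = i
  · subst hk
    intro hre
    have hb := neg_one_lt_mul_spin_re (i := k) hy1 he θ t
    have hre' : (spin y {k} e θ t k).re = e := by
      rcases he with rfl | rfl <;> rcases hre with hre | hre <;> rw [hre] at hb ⊢ <;>
        norm_num at hb
    rw [spin_im _ _ _ _ _ (by simp)]
    exact h (cos_eq_zero_of_spin_re hy1 he hre')
  · rw [spin_of_notMem _ _ _ _ _ (by simpa using hk)]
    exact unslit_ofReal hy1 k

include hy hy1 he hord in
theorem spin_mem_underSet {θ : ℝ} {t : I}
    (h : Real.cos (t * θ) = 0 → (y i - e) * Real.sin (t * θ) < 0) :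
    spin y {i} e θ t ∈ underSet e i := by
  refine ⟨spin_strictMono hy hord θ t, fun k hk => ?_, neg_one_lt_mul_spin_re hy1 he θ t,
    fun hre => ?_⟩
  · rw [spin_of_notMem _ _ _ _ _ (by simpa using hk)]
    exact unslit_ofReal hy1 k
  · rw [spin_im _ _ _ _ _ (by simp)]
    exact h (cos_eq_zero_of_spin_re hy1 he hre)

end Membership

/-! ### Goodness of one part of a path from that of the whole and the rest -/

section Halves

variable {n : ℕ} {F : Frame n} {p q : confSet n}

theorem good_subpath_zero_one_iff (γ : Path p q) :
    F.Good (pathClass (γ.subpath 0 1)) ↔ F.Good (pathClass γ) := by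
  have h : HEq (pathClass (γ.subpath 0 1)) (pathClass γ) := pathClass_heq _ _ fun u => by
    rw [Path.subpath_zero_one]
    rfl
  have e0 : pt (γ 0) = pt p := by rw [γ.source]
  have e1 : pt (γ 1) = pt q := by rw [γ.target]
  exact ⟨Frame.Good.of_heq e0 e1 h, Frame.Good.of_heq e0.symm e1.symm h.symm⟩

theorem pathClass_subpath_comp (γ : Path p q) (s : I) :
    pathClass (γ.subpath 0 s) ≫ pathClass (γ.subpath s 1) = pathClass (γ.subpath 0 1) := by
  rw [← pathClass_trans]
  exact pathClass_eq_of_homotopic ⟨Path.Homotopy.subpathTransSubpath γ 0 s 1⟩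

theorem good_subpath_right {γ : Path p q} {s : I} (h : F.Good (pathClass γ))
    (h' : F.Good (pathClass (γ.subpath 0 s))) : F.Good (pathClass (γ.subpath s 1)) := by
  have := h'.inv.comp ((good_subpath_zero_one_iff γ).2 h)
  rwa [← pathClass_subpath_comp γ s, IsIso.inv_hom_id_assoc] at this

theorem good_subpath_left {γ : Path p q} {s : I} (h : F.Good (pathClass γ))
    (h' : F.Good (pathClass (γ.subpath s 1))) : F.Good (pathClass (γ.subpath 0 s)) := by
  have := ((good_subpath_zero_one_iff γ).2 h).comp h'.inv
  rwa [← pathClass_subpath_comp γ s, Category.assoc, IsIso.hom_inv_id, Category.comp_id] at this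

theorem pathClass_subpath_eq_cls {V : Cell n} {γ : Path p q} {s t : I} (hst : s ≤ t)
    (h : ∀ u, s ≤ u → u ≤ t → γ u ∈ V) :
    pathClass (γ.subpath s t) = V.cls (h s le_rfl hst) (h t hst le_rfl) := by
  refine V.pathClass_eq_cls _ _ _ fun u => ?_
  have hu : γ.subpath s t u ∈ Set.range (γ.subpath s t) := Set.mem_range_self u
  rw [Path.range_subpath_of_le _ _ _ hst] at hu
  obtain ⟨v, hv, hvu⟩ := hu
  rw [← hvu]
  exact h v hv.1 hv.2

end Halves

/-! ### From good elementary moves to generators -/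

section Generation

variable {n : ℕ} {y : confSet n} {hy : y ∈ chamberCell n} {G : Subgroup (End (pt y))}

theorem good_of_loop {ℓ : Path (toConf y) (toConf y)} (hℓ : loopClass ℓ ∈ G) {p q : confSet n}
    (γ : Path p q) (h : ∀ t, toConf (γ t) = ℓ t) : (chamberFrame y hy G).Good (pathClass γ) := by
  have h1 : (chamberFrame y hy G).Good (a := pt y) (b := pt y) (loopClass ℓ) :=
    (Frame.good_base_iff (F := chamberFrame y hy G) _).2 hℓ
  refine h1.of_heq ?_ ?_ (Path.Homotopic.hpath_hext fun t => (h t).symm)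
  · have := h 0
    rw [γ.source, ℓ.source] at this
    exact (congrArg FundamentalGroupoid.mk this).symm
  · have := h 1
    rw [γ.target, ℓ.target] at this
    exact (congrArg FundamentalGroupoid.mk this).symm

/-- A loop of unordered configurations lifts to a path of ordered ones, whose end is a relabelling
of `y` and hence generic; so `good_pathClass` applies to the lift. -/
theorem eq_top_of_allGood (gy : Generic y) (h : AllGood (chamberFrame y hy G)) : G = ⊤ := by
  refine eq_top_iff.2 fun g _ => ?_
  obtain ⟨ℓ, rfl⟩ := Path.Homotopic.Quotient.mk_surjective g
  let f : OConf PuncturedPlane n :=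
    ⟨fun i => ⟨y.1 i, y.2.2 i⟩, fun _ _ h => y.2.1 (congrArg Subtype.val h)⟩
  obtain ⟨Γ, hΓ, hΓ0⟩ := (Conf.isCoveringMap_mk PuncturedPlane n).exists_path_lifts
    ℓ.toContinuousMap f ℓ.source
  let c : C(I, confSet n) := ⟨fun t => ⟨fun i => ((Γ t).1 i : ℂ),
    Subtype.val_injective.comp (Γ t).2, fun i => ((Γ t).1 i).2⟩, by
      refine Continuous.subtype_mk (continuous_pi fun i => continuous_subtype_val.comp ?_) _
      exact (continuous_apply i).comp (continuous_subtype_val.comp Γ.continuous)⟩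
  have hc : ∀ t, toConf (c t) = ℓ t := fun t => congrFun hΓ t
  have hc0 : c 0 = y := Subtype.ext (funext fun i => by
    change ((Γ 0).1 i : ℂ) = _
    rw [hΓ0])
  have hr : Set.range (c 1).1 = Set.range y.1 := range_eq_of_toConf_eq ((hc 1).trans ℓ.target)
  have gc1 : Generic (c 1) := by
    have hre : Set.range (c 1).1 ⊆ Set.range y.1 := hr.subset
    refine ⟨fun k l hkl => ?_, fun k => ?_⟩
    · obtain ⟨a, ha⟩ := hre (Set.mem_range_self k)
      obtain ⟨b, hb⟩ := hre (Set.mem_range_self l)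
      dsimp only at hkl
      rw [← ha, ← hb] at hkl
      have hab : a = b := gy.1 hkl
      rw [hab, hb] at ha
      exact (c 1).2.1 ha.symm
    · obtain ⟨a, ha⟩ := hre (Set.mem_range_self k)
      rw [← ha]
      exact gy.2 a
  have hgood := good_pathClass h gy gc1 ⟨c, hc0, rfl⟩
  refine (Frame.good_base_iff (F := chamberFrame y hy G) _).1 ?_
  exact hgood.of_heq rfl (congrArg FundamentalGroupoid.mk ((hc 1).trans ℓ.target))
    (Path.Homotopic.hpath_hext fun t => hc t)

theorem half_mem : (1 / 2 : ℝ) ∈ I := ⟨by norm_num, by norm_num⟩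

/-- The midpoint of the unit interval. -/
def half : I := ⟨1 / 2, half_mem⟩

theorem sin_nonneg_of_le_half {t : I} (h : t ≤ half) : 0 ≤ Real.sin (t * (2 * Real.pi)) := by
  have h1 : (t : ℝ) ≤ 1 / 2 := h
  refine Real.sin_nonneg_of_nonneg_of_le_pi (mul_nonneg t.2.1 (by positivity)) ?_
  nlinarith [Real.pi_pos]

theorem sin_nonpos_of_half_le {t : I} (h : half ≤ t) : Real.sin (t * (2 * Real.pi)) ≤ 0 := by
  have h1 : (1 / 2 : ℝ) ≤ t := h
  rw [← Real.sin_sub_two_pi]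
  refine Real.sin_nonpos_of_nonpos_of_neg_pi_le ?_ ?_
  · nlinarith [Real.pi_pos, t.2.2]
  · nlinarith [Real.pi_pos]

theorem cos_half : Real.cos ((half : ℝ) * (2 * Real.pi)) = -1 := by
  have : (half : ℝ) * (2 * Real.pi) = Real.pi := by
    change (1 / 2 : ℝ) * (2 * Real.pi) = Real.pi
    ring
  rw [this, Real.cos_pi]

/-- The fundamental group of the configuration space of the twice punctured plane is generated by
the exchanges of neighbours and by the rotations of the first point about `-1` and of the last point
about `1`. -/
theorem eq_top_of_generators {y : Fin n → ℝ} (hy : StrictMono y) (hy1 : ∀ k, -1 < y k ∧ y k < 1)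
    (hn : 0 < n) {β : Conf PuncturedPlane n}
    (hβ : ∀ h : (fun k => (y k : ℂ)) ∈ confSet n, toConf ⟨_, h⟩ = β)
    (G : Subgroup (FundamentalGroup (Conf PuncturedPlane n) β))
    (ht : ∀ i j : Fin n, (i : ℕ) + 1 = j → ∃ ℓ : Path β β, loopClass ℓ ∈ G ∧
      ∀ t (h : spin y {i, j} ((y i + y j) / 2) Real.pi t ∈ confSet n), ℓ t = toConf ⟨_, h⟩)
    (h0 : ∃ ℓ : Path β β, loopClass ℓ ∈ G ∧ ∀ t (h : spin y {⟨0, hn⟩} (-1) (2 * Real.pi) t ∈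
      confSet n), ℓ t = toConf ⟨_, h⟩)
    (h1 : ∃ ℓ : Path β β, loopClass ℓ ∈ G ∧ ∀ t (h : spin y {⟨n - 1, by omega⟩} 1 (2 * Real.pi) t ∈
      confSet n), ℓ t = toConf ⟨_, h⟩) : G = ⊤ := by
  have hmem := ofReal_mem_chamberSet hy hy1
  let b : confSet n := ⟨_, chamberSet_subset n hmem⟩
  have hb : b ∈ chamberCell n := hmem
  obtain rfl : toConf b = β := hβ b.2
  have gb : Generic b := ⟨hy.injective, fun k => ⟨(hy1 k).1.ne', (hy1 k).2.ne⟩⟩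
  set F := chamberFrame b hb G
  have htwist : ∀ (i j : Fin n) (hij : (i : ℕ) + 1 = j), GoodTwist F hij := by
    intro i j hij
    obtain ⟨ℓ, hℓ, h⟩ := ht i j hij
    have hm := spin_mem_twistSet hy hy1 hij
    let γ : Path b (relabel (Equiv.swap i j) b) :=
      ⟨⟨fun t => ⟨_, twistSet_subset i j (hm t)⟩, (continuous_spin _ _ _ _).subtype_mk _⟩,
        Subtype.ext (spin_zero _ _ _ _), Subtype.ext (spin_half_one _)⟩
    have hq : relabel (Equiv.swap i j) (relabel (Equiv.swap i j) b) ∈ chamberCell n := by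
      rwa [relabel_swap_relabel_swap]
    refine goodTwist_of_exists hij hb hq ?_
    rw [← (twistCell hij).pathClass_eq_cls _ _ γ hm]
    exact good_of_loop hℓ γ fun t => (h t _).symm
  -- The upper half of the circle about `e` lies in the chamber and is good for free, so the lower
  -- half, the passage below `e`, is good with the full circle.
  have hcircle : ∀ {e : ℝ} (he : e = -1 ∨ e = 1) {i : Fin n}, (∀ l, l ≠ i → ∀ u : ℝ, -1 ≤ u →
      u ≤ 1 → (l < i → y l < e + (y i - e) * u) ∧ (i < l → e + (y i - e) * u < y l)) →
      (∃ ℓ : Path (toConf b) (toConf b), loopClass ℓ ∈ G ∧ ∀ t (h : spin y {i} e (2 * Real.pi) t ∈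
      confSet n), ℓ t = toConf ⟨_, h⟩) → GoodUnder F he i := by
    rintro e he i hord ⟨ℓ, hℓ, h⟩
    have hcs : ∀ {t : I}, 0 ≤ (y i - e) * Real.sin (t * (2 * Real.pi)) →
        spin y {i} e (2 * Real.pi) t ∈ chamberSet n := fun {t} hs =>
      spin_mem_chamberSet hy hy1 he hord fun hcos => lt_of_le_of_ne hs
        (mul_ne_zero (sub_ne_zero.2 fun h => by
          rcases he with rfl | rfl
          exacts [(hy1 i).1.ne' h, (hy1 i).2.ne h]) (sin_ne_zero_of_cos_eq_zero hcos)).symm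
    have hus : ∀ {t : I}, (y i - e) * Real.sin (t * (2 * Real.pi)) ≤ 0 →
        spin y {i} e (2 * Real.pi) t ∈ underSet e i := fun {t} hs =>
      spin_mem_underSet hy hy1 he hord fun hcos => lt_of_le_of_ne hs
        (mul_ne_zero (sub_ne_zero.2 fun h => by
          rcases he with rfl | rfl
          exacts [(hy1 i).1.ne' h, (hy1 i).2.ne h]) (sin_ne_zero_of_cos_eq_zero hcos))
    have hm : ∀ t, spin y {i} e (2 * Real.pi) t ∈ confSet n := fun t => by
      rcases le_total 0 ((y i - e) * Real.sin (t * (2 * Real.pi))) with hs | hs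
      · exact chamberSet_subset n (hcs hs)
      · exact underSet_subset he i (hus hs)
    let γ : Path b b := ⟨⟨fun t => ⟨_, hm t⟩, (continuous_spin _ _ _ _).subtype_mk _⟩,
      Subtype.ext (spin_zero _ _ _ _), Subtype.ext (spin_full_one _ _ _)⟩
    have hγ : F.Good (pathClass γ) := good_of_loop hℓ γ fun t => (h t _).symm
    have h0h : (0 : I) ≤ half := half.2.1
    have hh1 : half ≤ 1 := half.2.2
    have hre : ∀ t, ((γ t).1 i).re - e = (y i - e) * Real.cos (t * (2 * Real.pi)) := fun t => by
      rw [← add_sub_cancel_left e ((y i - e) * Real.cos (t * (2 * Real.pi)))]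
      exact congrArg (· - e) (spin_re y {i} e (2 * Real.pi) t (Finset.mem_singleton_self i))
    have hb' := neg_one_lt_mul_spin_re (i := i) hy1 he (2 * Real.pi)
    have cos_zero : Real.cos (((0 : I) : ℝ) * (2 * Real.pi)) = 1 := by simp
    have cos_one : Real.cos (((1 : I) : ℝ) * (2 * Real.pi)) = 1 := by simp
    rcases he with rfl | rfl
    · have hd : 0 < y i - -1 := by linarith [(hy1 i).1]
      -- About `-1` the point starts on the right: it first passes above to the left, then returns
      -- below from left to right, the direction required by `GoodUnder`.
      have hc1 : ∀ t : I, 0 ≤ t → t ≤ half → γ t ∈ chamberCell n := fun t _ ht =>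
        hcs (mul_nonneg hd.le (sin_nonneg_of_le_half ht))
      have hu1 : ∀ t : I, half ≤ t → t ≤ 1 → γ t ∈ underCell (Or.inl rfl) i := fun t ht _ =>
        hus (mul_nonpos_of_nonneg_of_nonpos hd.le (sin_nonpos_of_half_le ht))
      have g1 : F.Good (pathClass (γ.subpath 0 half)) := by
        rw [pathClass_subpath_eq_cls h0h hc1]
        exact F.good_chamber _ _
      have g2 := good_subpath_right hγ g1
      rw [pathClass_subpath_eq_cls hh1 hu1] at g2
      refine goodUnder_of_exists _ (p := γ half) (q := γ 1) ⟨hc1 _ h0h le_rfl, hb' half, ?_⟩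
        ⟨?_, hb' 1, ?_⟩ g2
      · rw [hre, cos_half]
        linarith
      · rw [γ.target]
        exact hmem
      · rw [hre, cos_one]
        linarith
    · have hd : y i - 1 < 0 := by linarith [(hy1 i).2]
      -- About `1` the point starts on the left, so the passage below comes first, again from left
      -- to right.
      have hc1 : ∀ t : I, half ≤ t → t ≤ 1 → γ t ∈ chamberCell n := fun t ht _ =>
        hcs (mul_nonneg_of_nonpos_of_nonpos hd.le (sin_nonpos_of_half_le ht))
      have hu1 : ∀ t : I, 0 ≤ t → t ≤ half → γ t ∈ underCell (Or.inr rfl) i := fun t _ ht =>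
        hus (mul_nonpos_of_nonpos_of_nonneg hd.le (sin_nonneg_of_le_half ht))
      have g1 : F.Good (pathClass (γ.subpath half 1)) := by
        rw [pathClass_subpath_eq_cls hh1 hc1]
        exact F.good_chamber _ _
      have g2 := good_subpath_left hγ g1
      rw [pathClass_subpath_eq_cls h0h hu1] at g2
      refine goodUnder_of_exists _ (p := γ 0) (q := γ half) ⟨?_, hb' 0, ?_⟩
        ⟨hc1 _ le_rfl hh1, hb' half, ?_⟩ g2
      · rw [γ.source]
        exact hmem
      · rw [hre, cos_zero]
        linarith
      · rw [hre, cos_half]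
        linarith
  refine eq_top_of_allGood gb ⟨rfl, htwist, ?_⟩
  rintro e (rfl | rfl) i
  · refine goodUnder_of_goodUnder (Or.inl rfl) htwist (i := ⟨0, hn⟩) (hcircle _ ?_ h0) i
    -- No label is smaller than that of the first point, and the circle about `-1` extends to the
    -- right only as far as `y 0`.
    refine fun l hl u hu1 hu2 => ⟨fun h => absurd h (by simp [Fin.lt_def]), fun h => ?_⟩
    have h2 := hy h
    nlinarith [(hy1 ⟨0, hn⟩).1]
  · refine goodUnder_of_goodUnder (Or.inr rfl) htwist (i := ⟨n - 1, by omega⟩) (hcircle _ ?_ h1) i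
    refine fun l hl u hu1 hu2 => ⟨fun h => ?_, fun h => absurd h ?_⟩
    · have h2 := hy h
      nlinarith [(hy1 ⟨n - 1, by omega⟩).2]
    · rw [Fin.lt_def]
      dsimp only
      omega

end Generation

end Groupoid

/-! ### The square of a half twist -/

section Twist

variable {n : ℕ} {S : Finset ℝ} {x : Fin (n + 2) → ℝ}

theorem loopClass_sq {X : Type} [TopologicalSpace X] {p : X} (γ : Path p p) :
    loopClass γ ^ 2 = loopClass (γ.trans γ) := by
  rw [pow_two]
  rfl

/-- The rotation of the `a`-th and the `b`-th point about their midpoint (at `u = 0`) is deformed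
into the rotation of the `b`-th point about the `a`-th one (at `u = 1`). -/
def slide (x : Fin (n + 2) → ℝ) (a b : Fin (n + 2)) (m : ℝ) (u t : I) : Fin (n + 2) → ℂ := fun k =>
  let w := Complex.exp (((t : ℝ) * (2 * Real.pi) : ℝ) * Complex.I)
  let z := m + ((x a : ℂ) - m) * ((1 - (u : ℝ)) * w + (u : ℝ))
  if k = a then z else if k = b then z + ((x b : ℂ) - x a) * w else x k

theorem continuous_slide (x : Fin (n + 2) → ℝ) (a b : Fin (n + 2)) (m : ℝ) :
    Continuous fun z : I × I => slide x a b m z.1 z.2 := by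
  refine continuous_pi fun k => ?_
  simp only [slide]
  split_ifs <;> fun_prop

theorem norm_combo_le {u : I} {w : ℂ} (hw : ‖w‖ = 1) :
    ‖((u : ℝ) : ℂ) + (1 - (u : ℝ)) * w‖ ≤ 1 := by
  refine (norm_add_le _ _).trans ?_
  have h : (1 : ℂ) - (u : ℝ) = ((1 - (u : ℝ) : ℝ) : ℂ) := by push_cast; rfl
  rw [norm_mul, hw, mul_one, h, Complex.norm_real, Complex.norm_real, Real.norm_of_nonneg u.2.1,
    Real.norm_of_nonneg (by linarith [u.2.2])]
  linarith

/-- The difference of the two moving points is `(x b - x a) * w` with `w` of norm one, so they never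
meet. Both stay in the closed disc about `x a` of radius `|x b - x a|`, while by `hout` the resting
points lie outside it. -/
theorem slide_injective (hx : Function.Injective x) {a b : Fin (n + 2)} (hab : a ≠ b) {m : ℝ}
    (hm : 2 * m = x a + x b) (hout : ∀ l, l ≠ a → l ≠ b → |x b - x a| < |x l - x a|) (u t : I) :
    Function.Injective (slide x a b m u t) := by
  set w := Complex.exp (((t : ℝ) * (2 * Real.pi) : ℝ) * Complex.I) with hwdef
  have hw : ‖w‖ = 1 := Complex.norm_exp_ofReal_mul_I _
  have hm' : (m : ℂ) = ((x a : ℂ) + x b) / 2 := by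
    rw [eq_div_iff two_ne_zero, mul_comm]
    exact_mod_cast hm
  have ha : slide x a b m u t a = m + ((x a : ℂ) - m) * ((1 - (u : ℝ)) * w + (u : ℝ)) := by
    simp [slide, hwdef]
  have hb : slide x a b m u t b =
      m + ((x a : ℂ) - m) * ((1 - (u : ℝ)) * w + (u : ℝ)) + ((x b : ℂ) - x a) * w := by
    simp [slide, hwdef, hab.symm]
  have hk : ∀ k, k ≠ a → k ≠ b → slide x a b m u t k = x k := fun k h1 h2 => by
    simp [slide, h1, h2]
  have hd : ‖((x b : ℂ) - x a)‖ = |x b - x a| := by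
    rw [← Complex.ofReal_sub, Complex.norm_real, Real.norm_eq_abs]
  have na : ‖slide x a b m u t a - x a‖ ≤ |x b - x a| := by
    have h1 : slide x a b m u t a - x a =
        ((x b : ℂ) - x a) * (((1 - (u : ℝ)) / 2) * (1 - w)) := by
      rw [ha, hm']
      ring
    have h2 : ‖(1 : ℂ) - w‖ ≤ 2 := by
      refine (norm_sub_le _ _).trans ?_
      rw [hw, norm_one]
      norm_num
    have h3 : ((1 : ℂ) - (u : ℝ)) / 2 = (((1 - (u : ℝ)) / 2 : ℝ) : ℂ) := by push_cast; rfl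
    rw [h1, norm_mul, hd, norm_mul, h3, Complex.norm_real,
      Real.norm_of_nonneg (by linarith [u.2.2])]
    refine mul_le_of_le_one_right (abs_nonneg _) ?_
    nlinarith [u.2.1, u.2.2, norm_nonneg ((1 : ℂ) - w)]
  have nb : ‖slide x a b m u t b - x a‖ ≤ |x b - x a| := by
    have hs : (1 - (u : ℝ)) / 2 ∈ I := ⟨by linarith [u.2.2], by linarith [u.2.1]⟩
    have h1 : slide x a b m u t b - x a = ((x b : ℂ) - x a) *
        ((((⟨_, hs⟩ : I) : ℝ) : ℂ) + (1 - (((⟨_, hs⟩ : I) : ℝ) : ℂ)) * w) := by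
      rw [hb, hm']
      push_cast
      ring
    rw [h1, norm_mul, hd]
    exact mul_le_of_le_one_right (abs_nonneg _) (norm_combo_le hw)
  have hne : ∀ k l, (k = a ∨ k = b) → ¬(l = a ∨ l = b) →
      slide x a b m u t k ≠ slide x a b m u t l := by
    intro k l hk' hl h
    push Not at hl
    have h1 : ‖slide x a b m u t k - x a‖ ≤ |x b - x a| := by
      rcases hk' with rfl | rfl
      exacts [na, nb]
    rw [h, hk l hl.1 hl.2, ← Complex.ofReal_sub, Complex.norm_real, Real.norm_eq_abs] at h1
    exact absurd (hout l hl.1 hl.2) (not_lt.2 h1)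
  have hneab : slide x a b m u t a ≠ slide x a b m u t b := by
    intro h
    rw [ha, hb, left_eq_add, mul_eq_zero, sub_eq_zero] at h
    rcases h with h | h
    · exact hab (hx (Complex.ofReal_injective h)).symm
    · rw [h, norm_zero] at hw
      norm_num at hw
  intro k l h
  by_cases h1 : k = a ∨ k = b <;> by_cases h2 : l = a ∨ l = b
  · rcases h1 with rfl | rfl <;> rcases h2 with rfl | rfl
    · rfl
    · exact absurd h hneab
    · exact absurd h.symm hneab
    · rfl
  · exact absurd h (hne k l h1 h2)
  · exact absurd h.symm (hne l k h2 h1)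
  · push Not at h1 h2
    rw [hk k h1.1 h1.2, hk l h2.1 h2.2] at h
    exact hx (Complex.ofReal_injective h)

theorem rotationLoop_homotopic (hx : ListsAlongSegment S x) {a b : Fin (n + 2)} (hab : a ≠ b)
    {m : ℝ} (hm : 2 * m = x a + x b)
    (hout : ∀ l, l ≠ a → l ≠ b → |x b - x a| < |x l - x a|)
    {M M' : Finset (Fin (n + 2))} (hM : ∀ k, k ∈ M ↔ k = a ∨ k = b) (hM' : ∀ k, k ∈ M' ↔ k = b)
    (h1 h2 h3 h4) :
    (rotationLoop hx M m (2 * Real.pi) h1 h2).Homotopic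
      (rotationLoop hx M' (x a) (2 * Real.pi) h3 h4) := by
  have hm' : (m : ℂ) = ((x a : ℂ) + x b) / 2 := by
    rw [eq_div_iff two_ne_zero, mul_comm]
    exact_mod_cast hm
  have e0 : ∀ t, slide x a b m 0 t = rotation x M m (2 * Real.pi) t := by
    intro t
    funext k
    by_cases hka : k = a
    · simp [slide, rotation, hM, hka]
    · by_cases hkb : k = b
      · simp only [slide, rotation, hM, hkb, hab.symm, if_true, if_false, or_true, hm']
        simp
        ring
      · simp [slide, rotation, hM, hka, hkb]
  have e1 : ∀ t, slide x a b m 1 t = rotation x M' (x a) (2 * Real.pi) t := by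
    intro t
    funext k
    by_cases hka : k = a
    · simp [slide, rotation, hM', hka, hab]
    · by_cases hkb : k = b
      · simp [slide, rotation, hM', hkb, hab.symm]
      · simp [slide, rotation, hM', hka, hkb]
  have ee : ∀ u t, t ∈ ({0, 1} : Set I) → slide x a b m u t = fun k => (x k : ℂ) := by
    intro u t ht
    have hw : Complex.exp (((t : ℝ) * (2 * Real.pi) : ℝ) * Complex.I) = 1 := by
      rcases ht with rfl | rfl
      · simp
      · simp
    funext k
    simp only [slide, hw]
    split_ifs with h1 h2
    · subst h1; ring
    · subst h2; ring
    · rfl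
  refine ⟨{ toFun := fun z => Conf.mk ⟨_, slide_injective hx.injective hab hm hout z.1 z.2⟩
            continuous_toFun := Conf.continuous_mk.comp ((continuous_slide x a b m).subtype_mk _)
            map_zero_left := fun t => congrArg Conf.mk (Subtype.ext (e0 t))
            map_one_left := fun t => congrArg Conf.mk (Subtype.ext (e1 t))
            prop' := fun u t ht => ?_ }⟩
  refine congrArg Conf.mk (Subtype.ext ?_)
  exact (ee u t ht).trans ((ee 0 t ht).symm.trans (e0 t))

/-- An equality of paths, not just a homotopy: after the first half turn the two points have traded
places, and a factor `exp (π * I) = -1` is the same as swapping the two labels. -/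
theorem halfTwist_trans_halfTwist (hx : ListsAlongSegment S x) (j : Fin (n + 1)) (h1 h2 h3 h4) :
    (rotationLoop hx {j.castSucc, j.succ} ((x j.castSucc + x j.succ) / 2) Real.pi h1 h2).trans
      (rotationLoop hx {j.castSucc, j.succ} ((x j.castSucc + x j.succ) / 2) Real.pi h1 h2) =
    rotationLoop hx {j.castSucc, j.succ} ((x j.castSucc + x j.succ) / 2) (2 * Real.pi) h3 h4 := by
  ext t
  rw [Path.trans_apply]
  split_ifs with ht
  · refine congrArg Conf.mk (Subtype.ext (funext fun k => ?_))
    have : 2 * (t : ℝ) * Real.pi = t * (2 * Real.pi) := by ring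
    simp only [rotation, this]
  · refine Conf.mk_eq_of_range_eq ?_
    have hne : j.succ ≠ j.castSucc := (Fin.castSucc_lt_succ (i := j)).ne'
    have hexp : Complex.exp (((t : ℝ) * (2 * Real.pi) : ℝ) * Complex.I) =
        -Complex.exp (((2 * (t : ℝ) - 1) * Real.pi : ℝ) * Complex.I) := by
      have : (((t : ℝ) * (2 * Real.pi) : ℝ) : ℂ) * Complex.I =
          ((2 * (t : ℝ) - 1) * Real.pi : ℝ) * Complex.I + Real.pi * Complex.I := by
        push_cast
        ring
      rw [this, Complex.exp_add, Complex.exp_pi_mul_I]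
      ring
    have key : rotation x {j.castSucc, j.succ} ((x j.castSucc + x j.succ) / 2) (2 * Real.pi) t =
        rotation x {j.castSucc, j.succ} ((x j.castSucc + x j.succ) / 2) Real.pi
          ⟨2 * t - 1, unitInterval.two_mul_sub_one_mem_iff.2 ⟨(not_le.1 ht).le, t.2.2⟩⟩ ∘
            Equiv.swap j.castSucc j.succ := by
      funext k
      by_cases h1 : k = j.castSucc
      · subst h1
        simp only [rotation, Function.comp_apply, Equiv.swap_apply_left, Finset.mem_insert,
          Finset.mem_singleton, true_or, or_true, if_true, hexp]
        push_cast
        ring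
      · by_cases h2 : k = j.succ
        · subst h2
          simp only [rotation, Function.comp_apply, Equiv.swap_apply_right, Finset.mem_insert,
            Finset.mem_singleton, true_or, or_true, if_true, hexp]
          push_cast
          ring
        · simp [rotation, h1, h2, Equiv.swap_apply_of_ne_of_ne h1 h2]
    change _ = Set.range (rotation x _ _ (2 * Real.pi) t)
    rw [key]
    exact ((Equiv.surjective _).range_comp _).symm

theorem ListsAlongSegment.abs_lt_of_lt (hx : ListsAlongSegment S x) {a b c : Fin (n + 2)}
    (h : (a < b ∧ b < c) ∨ (c < b ∧ b < a)) : |x b - x a| < |x c - x a| := by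
  rcases hx.ordered with hm | hm <;> rcases h with ⟨h1, h2⟩ | ⟨h1, h2⟩ <;>
    have e1 := hm h1 <;> have e2 := hm h2
  · rw [abs_of_pos (by linarith), abs_of_pos (by linarith)]
    linarith
  · rw [abs_of_neg (by linarith), abs_of_neg (by linarith)]
    linarith
  · rw [abs_of_neg (by linarith), abs_of_neg (by linarith)]
    linarith
  · rw [abs_of_pos (by linarith), abs_of_pos (by linarith)]
    linarith

theorem tau₁_eq_sigma_sq (hx : ListsAlongSegment S x) (h : 1 ≤ n + 1) :
    tau₁ hx = sigma hx 1 le_rfl h ^ 2 := by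
  dsimp only [sigma]
  rw [loopClass_sq, halfTwist_trans_halfTwist hx _ _ _ (hx.halfTwist_aux _)
    (congrArg Set.range (rotation_full_one x _ _)), tau₁]
  refine Quotient.sound (rotationLoop_homotopic hx (a := 0) (b := 1) (by simp) ?_ ?_ ?_
    (by simp) _ _ _ _).symm
  · have h1 : (⟨1 - 1, by omega⟩ : Fin (n + 1)).castSucc = 0 := rfl
    have h2 : (⟨1 - 1, by omega⟩ : Fin (n + 1)).succ = 1 := rfl
    rw [h1, h2]
    ring
  · intro l h0 h1
    refine hx.abs_lt_of_lt (Or.inl ?_)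
    simp only [Fin.lt_def, ne_eq, Fin.ext_iff, Fin.val_zero, Fin.val_one] at h0 h1 ⊢
    omega
  · intro k
    rw [Finset.mem_insert, Finset.mem_singleton]
    exact Iff.rfl

theorem tau₂_eq_sigma_sq (hx : ListsAlongSegment S x) (h : 1 ≤ n + 1) :
    tau₂ hx = sigma hx (n + 1) h le_rfl ^ 2 := by
  dsimp only [sigma]
  rw [loopClass_sq, halfTwist_trans_halfTwist hx _ _ _ (hx.halfTwist_aux _)
    (congrArg Set.range (rotation_full_one x _ _)), tau₂]
  refine Quotient.sound (rotationLoop_homotopic hx (a := Fin.last (n + 1))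
    (b := (Fin.last n).castSucc) (Fin.castSucc_lt_last _).ne' ?_ ?_ ?_ (by simp) _ _ _ _).symm
  · have h1 : (⟨n + 1 - 1, by omega⟩ : Fin (n + 1)).castSucc = (Fin.last n).castSucc := rfl
    have h2 : (⟨n + 1 - 1, by omega⟩ : Fin (n + 1)).succ = Fin.last (n + 1) := rfl
    rw [h1, h2]
    ring
  · intro l h0 h1
    refine hx.abs_lt_of_lt (Or.inr ?_)
    simp only [Fin.lt_def, ne_eq, Fin.ext_iff, Fin.val_last, Fin.val_castSucc] at h0 h1 ⊢
    omega
  · intro k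
    simp [Fin.ext_iff, or_comm]

end Twist

/-! ### Lifting the generators -/

section Lift

variable {n : ℕ} {S : Finset ℝ} {x : Fin (n + 2) → ℝ}

theorem range_eq_insert_ends {X : Type*} (f : Fin (n + 2) → X) :
    Set.range f = insert (f 0) (insert (f (Fin.last _))
      (Set.range fun i : Fin n => f i.castSucc.succ)) := by
  ext z
  simp only [Set.mem_range, Set.mem_insert_iff]
  rw [Fin.exists_fin_succ, Fin.exists_fin_succ']
  simp only [Fin.succ_last, eq_comm (b := z)]
  tauto

theorem addEnds_toConf {p : confSet n} {f : OConf ℂ (n + 2)}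
    (h : Set.range f.1 = insert (-1) (insert 1 (Set.range p.1))) :
    addEnds n (toConf p) = Conf.mk f :=
  Conf.mk_eq_of_range_eq ((range_addEndsOrdered _).trans h.symm)

/-- The inner points are recovered as the points different from `-1` and `1`. This makes lifted
loops close up at the right base point. -/
theorem addEnds_injective : Function.Injective (addEnds n) := by
  intro a b
  refine Quotient.inductionOn₂ a b fun f g h => ?_
  have h2 := Conf.range_eq_of_mk_eq (h : Conf.mk (addEndsOrdered f) = Conf.mk (addEndsOrdered g))
  rw [range_addEndsOrdered, range_addEndsOrdered] at h2
  refine Conf.mk_eq_of_range_eq ?_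
  have key : ∀ f : OConf PuncturedPlane n, Set.range f.1 =
      Subtype.val ⁻¹' insert (-1 : ℂ) (insert 1 (Set.range fun i => (f.1 i : ℂ))) := by
    intro f
    ext z
    simp [z.2.1, z.2.2, Subtype.ext_iff]
  rw [key f, key g, h2]

theorem inclHom_loopClass (hS : IsSegmentSet S) (hx : ListsAlongSegment S x)
    {ℓ : Path (innerBase hS hx) (innerBase hS hx)} {L : Path (base hx) (base hx)}
    (h : ∀ t, addEnds n (ℓ t) = L t) : inclHom hS hx (loopClass ℓ) = loopClass L := by
  have : L = (ℓ.map (addEnds n).continuous).cast (addEnds_innerBase hS hx).symm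
      (addEnds_innerBase hS hx).symm := by
    ext t
    exact (h t).symm
  rw [this, inclHom, FundamentalGroup.mapOfEq_apply]
  rfl

/-- The end points do not rotate, so the other points avoid `-1` and `1` throughout, and dropping
the ends gives the lift. The permutation `ρ` translates labels by increasing real part into labels
along the orientation. -/
theorem exists_lift_rotationLoop (hS : IsSegmentSet S) (hx : ListsAlongSegment S x)
    (ρ : Equiv.Perm (Fin n)) {y : Fin n → ℝ} (hy : ∀ k, y k = x (ρ k).castSucc.succ)
    {M : Finset (Fin (n + 2))} {c θ : ℝ} (hM hend) (h0 : 0 ∉ M) (h1 : Fin.last (n + 1) ∉ M)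
    {M' : Finset (Fin n)} (hM' : ∀ k, k ∈ M' ↔ (ρ k).castSucc.succ ∈ M) {c' : ℝ} (hc : c' = c) :
    ∃ ℓ : Path (innerBase hS hx) (innerBase hS hx),
      inclHom hS hx (loopClass ℓ) = loopClass (rotationLoop hx M c θ hM hend) ∧
      ∀ t (h : spin y M' c' θ t ∈ confSet n), ℓ t = toConf ⟨_, h⟩ := by
  subst hc
  have hspin : ∀ t k, spin y M' c' θ t k = rotation x M c' θ t (ρ k).castSucc.succ := by
    intro t k
    simp only [spin, rotation, hM', hy]
  have hinj := fun t => rotation_injective hx.injective θ hM t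
  have hends : ∀ t, insert (rotation x M c' θ t 0) {rotation x M c' θ t (Fin.last _)} =
      ({-1, 1} : Set ℂ) := by
    intro t
    simp only [rotation, h0, h1, if_false]
    rcases hx.ends hS with ⟨e0, e1⟩ | ⟨e0, e1⟩
    · simp [e0, e1]
    · simp [e0, e1, Set.pair_comm]
  have hmem : ∀ t, spin y M' c' θ t ∈ confSet n := by
    intro t
    refine ⟨fun k l h => ?_, fun k => ?_⟩
    · rw [hspin, hspin] at h
      exact ρ.injective (Fin.castSucc_injective _ (Fin.succ_injective _ (hinj t h)))
    · have : spin y M' c' θ t k ∉ ({-1, 1} : Set ℂ) := by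
        rw [← hends t, hspin]
        rintro (h | h)
        · exact Fin.succ_ne_zero _ (hinj t h)
        · have := hinj t h
          rw [← Fin.succ_last, Fin.succ_inj] at this
          exact (Fin.castSucc_lt_last _).ne this
      simpa [not_or] using this
  have hadd : ∀ t, addEnds n (toConf ⟨_, hmem t⟩) = rotationLoop hx M c' θ hM hend t := by
    intro t
    refine addEnds_toConf (f := ⟨_, hinj t⟩) ?_
    have e : Set.range (spin y M' c' θ t) =
        Set.range fun k : Fin n => rotation x M c' θ t k.castSucc.succ := by
      rw [show spin y M' c' θ t = (fun k : Fin n => rotation x M c' θ t k.castSucc.succ) ∘ ρ from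
        funext (hspin t)]
      exact ρ.surjective.range_comp _
    change Set.range (rotation x M c' θ t) = _
    rw [range_eq_insert_ends, e]
    have := congrArg (· ∪ Set.range fun k : Fin n => rotation x M c' θ t k.castSucc.succ) (hends t)
    simpa only [Set.insert_union, Set.singleton_union] using this
  let ℓ : Path (innerBase hS hx) (innerBase hS hx) :=
    { toFun := fun t => toConf ⟨_, hmem t⟩
      continuous_toFun := continuous_toConf.comp ((continuous_spin y M' c' θ).subtype_mk hmem)
      source' := addEnds_injective (by rw [hadd, Path.source, addEnds_innerBase])
      target' := addEnds_injective (by rw [hadd, Path.target, addEnds_innerBase]) }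
  exact ⟨ℓ, inclHom_loopClass hS hx hadd, fun t h => rfl⟩

theorem exists_lift_sigma (hS : IsSegmentSet S) (hx : ListsAlongSegment S x)
    (ρ : Equiv.Perm (Fin n)) {y : Fin n → ℝ} (hy : ∀ k, y k = x (ρ k).castSucc.succ)
    {s : ℕ} (h1 : 1 ≤ s) (hs : s ≤ n + 1) {i j : Fin n}
    (hij : ((ρ i : ℕ) + 2 = s ∧ (ρ j : ℕ) + 1 = s) ∨ ((ρ j : ℕ) + 2 = s ∧ (ρ i : ℕ) + 1 = s)) :
    ∃ ℓ : Path (innerBase hS hx) (innerBase hS hx),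
      inclHom hS hx (loopClass ℓ) = sigma hx s h1 hs ∧
      ∀ t (h : spin y {i, j} ((y i + y j) / 2) Real.pi t ∈ confSet n), ℓ t = toConf ⟨_, h⟩ := by
  dsimp only [sigma]
  refine exists_lift_rotationLoop hS hx ρ hy _ _ ?_ ?_ (fun k => ?_) ?_
  · simp only [Finset.mem_insert, Finset.mem_singleton, Fin.ext_iff, Fin.val_zero, Fin.val_castSucc,
      Fin.val_succ]
    omega
  · simp only [Finset.mem_insert, Finset.mem_singleton, Fin.ext_iff, Fin.val_last, Fin.val_castSucc,
      Fin.val_succ]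
    omega
  · rw [Finset.mem_insert, Finset.mem_singleton, ← ρ.injective.eq_iff, ← ρ.injective.eq_iff (b := j)]
    simp only [Finset.mem_insert, Finset.mem_singleton, Fin.ext_iff, Fin.val_castSucc, Fin.val_succ]
    omega
  · rw [hy, hy]
    rcases hij with ⟨a, b⟩ | ⟨a, b⟩
    · congr 3 <;> refine Fin.ext ?_ <;>
        simp only [Fin.val_castSucc, Fin.val_succ] <;> omega
    · rw [add_comm]
      congr 3 <;> refine Fin.ext ?_ <;>
        simp only [Fin.val_castSucc, Fin.val_succ] <;> omega

theorem exists_lift_tau₁ (hS : IsSegmentSet S) (hx : ListsAlongSegment S x)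
    (ρ : Equiv.Perm (Fin n)) {y : Fin n → ℝ} (hy : ∀ k, y k = x (ρ k).castSucc.succ)
    {i : Fin n} (hi : (ρ i : ℕ) = 0) {e : ℝ} (he : x 0 = e) :
    ∃ ℓ : Path (innerBase hS hx) (innerBase hS hx), inclHom hS hx (loopClass ℓ) = tau₁ hx ∧
      ∀ t (h : spin y {i} e (2 * Real.pi) t ∈ confSet n), ℓ t = toConf ⟨_, h⟩ := by
  have hn := i.2
  refine exists_lift_rotationLoop hS hx ρ hy _ _ ?_ ?_ (fun k => ?_) he.symm
  · simp
  · simp only [Finset.mem_singleton, Fin.ext_iff, Fin.val_last, Fin.val_one]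
    omega
  · rw [Finset.mem_singleton, ← ρ.injective.eq_iff]
    simp only [Finset.mem_singleton, Fin.ext_iff, Fin.val_castSucc, Fin.val_succ, Fin.val_one]
    omega

theorem exists_lift_tau₂ (hS : IsSegmentSet S) (hx : ListsAlongSegment S x)
    (ρ : Equiv.Perm (Fin n)) {y : Fin n → ℝ} (hy : ∀ k, y k = x (ρ k).castSucc.succ)
    {i : Fin n} (hi : (ρ i : ℕ) + 1 = n) {e : ℝ} (he : x (Fin.last _) = e) :
    ∃ ℓ : Path (innerBase hS hx) (innerBase hS hx), inclHom hS hx (loopClass ℓ) = tau₂ hx ∧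
      ∀ t (h : spin y {i} e (2 * Real.pi) t ∈ confSet n), ℓ t = toConf ⟨_, h⟩ := by
  have hn := i.2
  refine exists_lift_rotationLoop hS hx ρ hy _ _ ?_ ?_ (fun k => ?_) he.symm
  · simp only [Finset.mem_singleton, Fin.ext_iff, Fin.val_last, Fin.val_castSucc, Fin.val_zero]
    omega
  · simp only [Finset.mem_singleton, Fin.ext_iff, Fin.val_last, Fin.val_castSucc]
    omega
  · rw [Finset.mem_singleton, ← ρ.injective.eq_iff]
    simp only [Finset.mem_singleton, Fin.ext_iff, Fin.val_castSucc, Fin.val_succ, Fin.val_last]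
    omega

theorem innerBase_eq_toConf (hS : IsSegmentSet S) (hx : ListsAlongSegment S x)
    (ρ : Equiv.Perm (Fin n)) {y : Fin n → ℝ} (hy : ∀ k, y k = x (ρ k).castSucc.succ)
    (h : (fun k => (y k : ℂ)) ∈ confSet n) : toConf ⟨_, h⟩ = innerBase hS hx := by
  have hb : (fun k : Fin n => (x k.castSucc.succ : ℂ)) ∈ confSet n :=
    ⟨fun k l h => Fin.castSucc_injective _ (Fin.succ_injective _
      (hx.injective (Complex.ofReal_injective h))), hx.inner_ne hS⟩
  refine toConf_eq_of_range_eq (q := ⟨_, hb⟩) ?_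
  have : (fun k => (y k : ℂ)) = (fun k : Fin n => (x k.castSucc.succ : ℂ)) ∘ ρ :=
    funext fun k => by simp [hy]
  exact (congrArg Set.range this).trans (ρ.surjective.range_comp _)

theorem ListsAlongSegment.inner_bounds (hx : ListsAlongSegment S x) (hS : IsSegmentSet S)
    (k : Fin n) : -1 < x k.castSucc.succ ∧ x k.castSucc.succ < 1 := by
  have h1 := hS.subset _ (Finset.mem_coe.1 (hx.range_eq ▸ Set.mem_range_self k.castSucc.succ))
  have h2 := hx.inner_ne hS k
  exact ⟨h1.1.lt_of_ne fun h => h2.1 (by rw [← h]; simp),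
    h1.2.lt_of_ne fun h => h2.2 (by rw [h]; simp)⟩

/-- It suffices that the preimage of `H` is the whole group, and for this `eq_top_of_generators` is
applied to the lifts of the generators. -/
theorem range_inclHom_le (hn : 1 ≤ n) (hS : IsSegmentSet S) (hx : ListsAlongSegment S x)
    (H : Subgroup (FundamentalGroup (Conf ℂ (n + 2)) (base hx)))
    (hs : ∀ i (hi : 1 ≤ i) (hi' : i ≤ n + 1), 2 ≤ i → i ≤ n → sigma hx i hi hi' ∈ H)
    (h1 : tau₁ hx ∈ H) (h2 : tau₂ hx ∈ H) : (inclHom hS hx).range ≤ H := by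
  suffices h : H.comap (inclHom hS hx) = ⊤ by
    rintro _ ⟨g, rfl⟩
    exact (h ▸ Subgroup.mem_top g : g ∈ H.comap (inclHom hS hx))
  rcases hx.ordered with hm | hm
  · have hlt : x 0 < x (Fin.last _) := hm (Fin.last_pos)
    obtain ⟨e0, e1⟩ : x 0 = -1 ∧ x (Fin.last _) = 1 :=
      (hx.ends hS).resolve_right fun h => by linarith [h.1, h.2]
    let ρ : Equiv.Perm (Fin n) := 1
    have hy : ∀ k, x k.castSucc.succ = x (ρ k).castSucc.succ := fun _ => rfl
    refine eq_top_of_generators (y := fun k => x k.castSucc.succ)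
      (fun k l h => hm (Fin.succ_lt_succ_iff.2 h)) (hx.inner_bounds hS) hn
      (innerBase_eq_toConf hS hx ρ hy) _ (fun i j hij => ?_) ?_ ?_
    · have := j.2
      obtain ⟨ℓ, h, h'⟩ := exists_lift_sigma hS hx ρ hy (s := i + 2) (i := i) (j := j) (by omega)
        (by omega) (Or.inl ⟨rfl, by change (j : ℕ) + 1 = _; omega⟩)
      exact ⟨ℓ, Subgroup.mem_comap.2 (h ▸ hs _ _ _ (by omega) (by omega)), h'⟩
    · obtain ⟨ℓ, h, h'⟩ := exists_lift_tau₁ hS hx ρ hy (i := ⟨0, hn⟩) rfl e0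
      exact ⟨ℓ, Subgroup.mem_comap.2 (h ▸ h1), h'⟩
    · obtain ⟨ℓ, h, h'⟩ := exists_lift_tau₂ hS hx ρ hy (i := ⟨n - 1, by omega⟩)
        (Nat.sub_add_cancel hn) e1
      exact ⟨ℓ, Subgroup.mem_comap.2 (h ▸ h2), h'⟩
  · have hlt : x (Fin.last _) < x 0 := hm (Fin.last_pos)
    obtain ⟨e0, e1⟩ : x 0 = 1 ∧ x (Fin.last _) = -1 :=
      (hx.ends hS).resolve_left fun h => by linarith [h.1, h.2]
    -- For the opposite orientation the labels are reversed: `tau₂` now turns about `-1` and `tau₁`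
    -- about `1`.
    let ρ : Equiv.Perm (Fin n) := Fin.revPerm
    have hρ : ∀ k, (ρ k : ℕ) = n - (k + 1) := fun k => Fin.val_rev k
    have hy : ∀ k, x (ρ k).castSucc.succ = x (ρ k).castSucc.succ := fun _ => rfl
    refine eq_top_of_generators (y := fun k => x (ρ k).castSucc.succ)
      (fun k l h => hm (Fin.succ_lt_succ_iff.2 (Fin.castSucc_lt_castSucc_iff.2 (Fin.rev_lt_rev.2 h))))
      (fun k => hx.inner_bounds hS _) hn
      (innerBase_eq_toConf hS hx ρ hy) _ (fun i j hij => ?_) ?_ ?_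
    · have := j.2
      -- The `i`-th and `j`-th points from the left, counted from zero, are the points numbered `n -
      -- i + 1` and `n - i` along the orientation.
      obtain ⟨ℓ, h, h'⟩ := exists_lift_sigma hS hx ρ hy (s := n - i) (i := i) (j := j) (by omega)
        (by omega) (Or.inr ⟨by rw [hρ]; omega, by rw [hρ]; omega⟩)
      exact ⟨ℓ, Subgroup.mem_comap.2 (h ▸ hs _ _ _ (by omega) (by omega)), h'⟩
    · obtain ⟨ℓ, h, h'⟩ := exists_lift_tau₂ hS hx ρ hy (i := ⟨0, hn⟩)
        (by rw [hρ]; dsimp only; omega) e1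
      exact ⟨ℓ, Subgroup.mem_comap.2 (h ▸ h2), h'⟩
    · obtain ⟨ℓ, h, h'⟩ := exists_lift_tau₁ hS hx ρ hy (i := ⟨n - 1, by omega⟩)
        (by rw [hρ]; dsimp only; omega) e0
      exact ⟨ℓ, Subgroup.mem_comap.2 (h ▸ h1), h'⟩

theorem sigma_mem_range_inclHom (hS : IsSegmentSet S) (hx : ListsAlongSegment S x) {i : ℕ}
    (hi : 1 ≤ i) (hi' : i ≤ n + 1) (h2 : 2 ≤ i) (hn : i ≤ n) :
    sigma hx i hi hi' ∈ (inclHom hS hx).range := by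
  obtain ⟨ℓ, h, -⟩ := exists_lift_sigma hS hx 1 (fun _ => rfl) hi hi' (i := ⟨i - 2, by omega⟩)
    (j := ⟨i - 1, by omega⟩) (Or.inl ⟨Nat.sub_add_cancel h2, Nat.sub_add_cancel hi⟩)
  exact ⟨_, h⟩

theorem tau₁_mem_range_inclHom (hn : 1 ≤ n) (hS : IsSegmentSet S) (hx : ListsAlongSegment S x) :
    tau₁ hx ∈ (inclHom hS hx).range := by
  obtain ⟨ℓ, h, -⟩ := exists_lift_tau₁ hS hx 1 (fun _ => rfl) (i := ⟨0, hn⟩) rfl rfl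
  exact ⟨_, h⟩

theorem tau₂_mem_range_inclHom (hn : 1 ≤ n) (hS : IsSegmentSet S) (hx : ListsAlongSegment S x) :
    tau₂ hx ∈ (inclHom hS hx).range := by
  obtain ⟨ℓ, h, -⟩ := exists_lift_tau₂ hS hx 1 (fun _ => rfl) (i := ⟨n - 1, by omega⟩)
    (Nat.sub_add_cancel hn) rfl
  exact ⟨_, h⟩

end Lift

end PlaneBraids

end

theorem mainTheorem12 (n : ℕ) (hn : 1 ≤ n) (S : Finset ℝ) (hS : IsSegmentSet S)
    (x : Fin (n + 2) → ℝ) (hx : ListsAlongSegment S x) :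
    Function.Injective (inclHom hS hx) ∧
    (inclHom hS hx).range =
      Subgroup.closure
        ({g | ∃ (i : ℕ) (h2 : 2 ≤ i) (hi : i ≤ n),
            g = sigma hx i (by omega) (by omega)} ∪ {tau₁ hx, tau₂ hx}) ∧
    tau₁ hx = sigma hx 1 le_rfl (by omega) ^ 2 ∧
    tau₂ hx = sigma hx (n + 1) (by omega) le_rfl ^ 2 := by
  refine ⟨inclHom_injective hS hx, le_antisymm ?_ ?_, tau₁_eq_sigma_sq hx _, tau₂_eq_sigma_sq hx _⟩
  · exact range_inclHom_le hn hS hx _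
      (fun i _ _ h2 hi => Subgroup.subset_closure (Or.inl ⟨i, h2, hi, rfl⟩))
      (Subgroup.subset_closure (Or.inr (Or.inl rfl)))
      (Subgroup.subset_closure (Or.inr (Or.inr rfl)))
  · rw [Subgroup.closure_le]
    rintro _ (⟨i, h2, hi, rfl⟩ | rfl | rfl)
    · exact sigma_mem_range_inclHom hS hx _ _ h2 hi
    · exact tau₁_mem_range_inclHom hn hS hx
    · exact tau₂_mem_range_inclHom hn hS hx
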